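/- Let $\mathcal H$ be a separable complex Hilbert space. A state on $\mathcal H$ is a positive trace-class operator with unit trace. For a state $\rho$ let $S(\rho)=-\operatorname{Tr}\rho\log\rho\in[0,\infty]$ be its von Neumann entropy, let $D(\rho\|\sigma)\in[0,\infty]$ be the quantum relative entropy, and let $h(x)=-x\log x-(1-x)\log(1-x)$ be the binary entropy on $[0,1]$. A finite or countable ensemble $\mu=\{p_i,\rho_i\}_{i\in I}$ consists of states $\rho_i$ and a probability distribution $\{p_i\}$; its average state is $\bar\rho(\mu)=\sum_i p_i\rho_i$ and its Holevo quantity is $\chi(\mu)=\sum_i p_iD(\rho_i\|\bar\rho(\mu))\in[0,\infty]$. Let $\mu=\{p_i,\rho_i\}_{i\in I}$ be an ensemble with $S(\bar\rho(\mu))<\infty$. Put $\varepsilon_i=\tfrac12\|\rho_i-\bar\rho(\mu)\|_1$ (half the trace norm), $\varepsilon_{av}=\sum_i p_i\varepsilon_i$, and $$\mu_\pm=\Big\{\frac{p_i\varepsilon_i}{\varepsilon_{av}},\ \tau_i^\pm\Big\}_{i\in I},\qquad \tau_i^{\pm}=\frac1{\varepsilon_i}[\rho_i-\bar\rho(\mu)]_\pm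 ,$$ where $[A]_+$ and $[A]_-$ are the positive and negative parts of a self-adjoint operator $A$, and where $\tau_i^\pm$ is a fixed arbitrary state $\sigma$ (with weight zero) if $\varepsilon_i=0$. If $\varepsilon_{av}>0$ then $\mu_+$ and $\mu_-$ are ensembles of states; if $\varepsilon_{av}=0$ then all their weights are taken to be zero and $\chi(\mu_\pm)=0$. Then $\chi(\mu)<\infty$ and $$\chi(\mu)\le\varepsilon_{av}\big(\chi(\mu_+)-\chi(\mu_-)\big)+\sum_{i\in I}p_ih(\varepsilon_i),$$ and the last term can be replaced by $h(\varepsilon_{av})$. Here the inequality is understood as an inequality of real numbers if $\chi(\mu_+)<\infty$, in which case $\chi(\mu_-)<\infty$ as well; this is always so if $I$ is finite. In general it is understood as $\chi(\mu)+\varepsilon_{av}\chi(\mu_-)\le\varepsilon_{av}\chi(\mu_+)+\sum_i p_ih(\varepsilon_i)$ in $[0,\infty]$ (and likewise with $h(\varepsilon_{av})$). The inequality is tight: for every natural $m\ge1$ and every separable complex Hilbert space $\mathcal H$ of dimension at least $m$ there is an ensemble of $m$ states on $\mathcal H$, consisting of mutually orthogonal pure states with equal probabilities $1/m$, such that $S(\bar\rho(\mu))$,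 $\chi(\mu)$, $\chi(\mu_+)$ and $\chi(\mu_-)$ are finite and $$\chi(\mu)=\varepsilon_{av}\big(\chi(\mu_+)-\chi(\mu_-)\big)+\sum_{i}p_ih(\varepsilon_i).$$ -/

import Mathlib

open scoped ENNReal

/-- The trace of a positive bounded operator, with values in `[0, ∞]`: the sum of the diagonal
entries in a Hilbert basis (for positive operators the sum does not depend on the basis). It is
only ever applied to positive operators. -/
noncomputable def opTrace {H : Type*} [NormedAddCommGroup H] [InnerProductSpace ℂ H]
    [CompleteSpace H] (A : H →L[ℂ] H) : ℝ≥0∞ :=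
  ∑' i : (exists_hilbertBasis ℂ H).choose,
    ENNReal.ofReal (inner ℂ (i : H) (A (i : H))).re

/-- A quantum state: a positive operator with unit trace. -/
def IsState {H : Type*} [NormedAddCommGroup H] [InnerProductSpace ℂ H]
    [CompleteSpace H] (ρ : H →L[ℂ] H) : Prop :=
  ρ.IsPositive ∧ opTrace ρ = 1

/-- The trace norm `‖A‖₁ = Tr |A|`, `|A| = √(A* A)`, with values in `[0, ∞]`. -/
noncomputable def traceNorm {H : Type*} [NormedAddCommGroup H] [InnerProductSpace ℂ H]
    [CompleteSpace H] (A : H →L[ℂ] H) : ℝ≥0∞ :=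
  opTrace (CFC.abs A)

/-- The von Neumann entropy `S(ρ) = Tr η(ρ)`, `η(x) = - x log x`, `η(0) = 0`, of a state, with
values in `[0, ∞]`; `η(ρ)` is given by the continuous functional calculus. -/
noncomputable def vnEntropy {H : Type*} [NormedAddCommGroup H] [InnerProductSpace ℂ H]
    [CompleteSpace H] (ρ : H →L[ℂ] H) : ℝ≥0∞ :=
  opTrace (cfc Real.negMulLog ρ)

/-- A Hilbert basis of eigenvectors of `A`, with real eigenvalues. By the spectral theorem every
state has one. -/
structure Eigenbasis {H : Type*} [NormedAddCommGroup H] [InnerProductSpace ℂ H]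
    [CompleteSpace H] (A : H →L[ℂ] H) where
  index : Set H
  basis : HilbertBasis index ℂ H
  eigenvalue : index → ℝ
  apply_basis : ∀ i, A (basis i) = (eigenvalue i : ℂ) • basis i

/-- The value of `x log x - x log y + y - x` for `x, y ≥ 0`, with `0 log 0 = 0` and
`- log 0 = ∞`. It lies in `[0, ∞]`. -/
noncomputable def klTerm (x y : ℝ) : ℝ≥0∞ :=
  if x = 0 then ENNReal.ofReal y
  else if y = 0 then ⊤
  else ENNReal.ofReal (x * Real.log (x / y) + y - x)

open Classical in
/-- The quantum relative entropy `D(ρ‖σ) = Tr ρ (log ρ - log σ)` of two states, in Lindblad's form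
`∑ i, ⟨φ i| ρ log ρ - ρ log σ + σ - ρ |φ i⟩`, where `φ` is a basis of eigenvectors of `ρ`, and
`log σ` is expanded in a basis `ψ` of eigenvectors of `σ`. All the terms are in `[0, ∞]`, and the
terms `σ - ρ` contribute `Tr σ - Tr ρ = 0`; the sum does not depend on the eigenbases. It is `∞` if
the support of `ρ` is not contained in the support of `σ`, because some term then has
`⟨φ i, ψ j⟩ ≠ 0` with eigenvalues `x ≠ 0` of `ρ` and `y = 0` of `σ`. -/
noncomputable def relEntropy {H : Type*} [NormedAddCommGroup H] [InnerProductSpace ℂ H]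
    [CompleteSpace H] (ρ σ : H →L[ℂ] H) : ℝ≥0∞ :=
  if h : Nonempty (Eigenbasis ρ) ∧ Nonempty (Eigenbasis σ) then
    ∑' (i : h.1.some.index) (j : h.2.some.index),
      ENNReal.ofReal (‖inner ℂ (h.1.some.basis i) (h.2.some.basis j)‖ ^ 2) *
        klTerm (h.1.some.eigenvalue i) (h.2.some.eigenvalue j)
  else ⊤

/-- A family of operators with weights: the data of a discrete ensemble. The conditions on the
data are in `IsEnsemble`. -/
structure EnsembleData (I H : Type*) [NormedAddCommGroup H] [InnerProductSpace ℂ H] where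
  prob : I → ℝ
  state : I → (H →L[ℂ] H)

namespace EnsembleData

variable {I H : Type*} [NormedAddCommGroup H] [InnerProductSpace ℂ H] [CompleteSpace H]

/-- `{p i, ρ i}` is an ensemble: `p` is a probability distribution, all `ρ i` are states. -/
def IsEnsemble (μ : EnsembleData I H) : Prop :=
  (∀ i, 0 ≤ μ.prob i) ∧ HasSum μ.prob 1 ∧ ∀ i, IsState (μ.state i)

/-- The average state `∑ i, p i ρ i` (the series converges absolutely). -/
noncomputable def avg (μ : EnsembleData I H) : H →L[ℂ] H :=
  ∑' i, (μ.prob i : ℂ) • μ.state i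

/-- The Holevo quantity `χ(μ) = ∑ i, p i D(ρ i ‖ avg μ)`, with values in `[0, ∞]`. -/
noncomputable def holevo (μ : EnsembleData I H) : ℝ≥0∞ :=
  ∑' i, ENNReal.ofReal (μ.prob i) * relEntropy (μ.state i) μ.avg

/-- `ε i = ½ ‖ρ i - avg μ‖₁`. -/
noncomputable def eps (μ : EnsembleData I H) (i : I) : ℝ :=
  (traceNorm (μ.state i - μ.avg)).toReal / 2

/-- `ε_av = ∑ i, p i ε i`. -/
noncomputable def epsAv (μ : EnsembleData I H) : ℝ :=
  ∑' i, μ.prob i * μ.eps i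

/-- The mean binary entropy `∑ i, p i h(ε i)`. -/
noncomputable def meanBinEntropy (μ : EnsembleData I H) : ℝ :=
  ∑' i, μ.prob i * Real.binEntropy (μ.eps i)

open Classical in
/-- The ensemble `μ₊ = {p i ε i / ε_av, (1 / ε i) [ρ i - avg μ]₊}`. If `ε i = 0`, the `i`-th
state, which has weight zero, is `σ`. -/
noncomputable def plus (μ : EnsembleData I H) (σ : H →L[ℂ] H) : EnsembleData I H where
  prob i := μ.prob i * μ.eps i / μ.epsAv
  state i := if μ.eps i = 0 then σ else ((μ.eps i)⁻¹ : ℂ) • (μ.state i - μ.avg)⁺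

open Classical in
/-- The ensemble `μ₋ = {p i ε i / ε_av, (1 / ε i) [ρ i - avg μ]₋}`. If `ε i = 0`, the `i`-th
state, which has weight zero, is `σ`. -/
noncomputable def minus (μ : EnsembleData I H) (σ : H →L[ℂ] H) : EnsembleData I H where
  prob i := μ.prob i * μ.eps i / μ.epsAv
  state i := if μ.eps i = 0 then σ else ((μ.eps i)⁻¹ : ℂ) • (μ.state i - μ.avg)⁻

end EnsembleData

/-- The ensemble of the `m` pure states `|e k⟩⟨e k|` with equal probabilities `1 / m`. -/
noncomputable def uniformPureEnsemble {H : Type*} [NormedAddCommGroup H] [InnerProductSpace ℂ H]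
    {m : ℕ} (e : Fin m → H) : EnsembleData (Fin m) H where
  prob _ := 1 / (m : ℝ)
  state k := InnerProductSpace.rankOne ℂ (e k) (e k)

/-!
The proof rests on the identity `χ(μ) = S(ω) - ∑ i, p i S(ρ i)` for an ensemble with average state
`ω` (`EnsembleData.IsEnsemble.holevo_add`), which comes from `D(ρ‖σ) + S(ρ) = - Tr ρ log σ`
(`Eigenbasis.relEnt_add`) and the linearity of the cross entropy in its first argument.

For one index, write `N = [ρ - ω]₊`, `P = [ρ - ω]₋`, so that `ω + N = ρ + P =: T` and `Tr N = Tr P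
= ε`. The key inequality, `vnEntropy_add_le_of_add_eq`, is `S(ω) + S(N) ≤ S(ρ) + S(P) + h(ε)`. On
one side `S(T) ≤ S(ρ) + S(P)`, by operator monotonicity of the logarithm (`vnEntropy_add_le`). On
the other side `S(ω) + S(N) ≤ S(T) + h(ε)` (`vnEntropy_half_add_le`): up to traces, `S(T) - S(ω) -
S(N)` is the sum of the relative entropies of `ω` and of `N` with respect to `T`, and these are
bounded below by the relative entropies of the outcomes of the measurement `{Q, 1 - Q}`, `Q` being
the projection onto the support of `N`, where `Tr Q ω ≤ 1 - ε`. The special case of monotonicity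
under measurements that is needed, `ofReal_le_relEnt`, follows from the integral formula `x log (x
/ y) + y - x = ∫ (1 - s) (x - y)² / (s x + (1 - s) y) ds` by completing the square (`tangent_le`),
summed over pairs of eigenvectors; the mixed terms cancel in the sum.

Multiplying by `p i` and summing gives the inequality for the Holevo quantities, because the
positive parts and the negative parts have the same mixture `K = ∑ i, p i N i = ∑ i, p i P i`,
whose entropy would cancel. As `S(K)` may be infinite, the summation is carried out for finite
sets of indices, with the cross entropies relative to `K` of the truncated mixtures compared in
`sum_crossEntropy_le` up to an error that depends on the tail of the ensemble `μ` only, and hence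
vanishes in the limit since `S(ω) < ∞`. The bound with `h(ε_av)` follows by concavity of `h`.

For `m` orthogonal pure states with equal probabilities all the operators involved are multiples
of projections, and the entropy of a normalised projection of rank `n` is `log n`: one finds `χ(μ)
= χ(μ₊) = log m`, `χ(μ₋) = log m - log (m - 1)` and `ε i = 1 - 1 / m`.
-/

set_option linter.unusedSectionVars false

/-! ### Quadratic forms and the trace -/

section Trace

variable {H : Type*} [NormedAddCommGroup H] [InnerProductSpace ℂ H] [CompleteSpace H]

/-- The quadratic form `⟨v, A v⟩` of a positive operator, with values in `[0, ∞]`. -/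
noncomputable def quadForm (A : H →L[ℂ] H) (v : H) : ℝ≥0∞ :=
  ENNReal.ofReal (inner ℂ v (A v)).re

theorem re_inner_apply_nonneg {A : H →L[ℂ] H} (hA : A.IsPositive) (v : H) :
    0 ≤ (inner ℂ v (A v)).re :=
  hA.re_inner_nonneg_right v

theorem quadForm_add {A B : H →L[ℂ] H} (hA : A.IsPositive) (hB : B.IsPositive) (v : H) :
    quadForm (A + B) v = quadForm A v + quadForm B v := by
  rw [quadForm, quadForm, quadForm, ← ENNReal.ofReal_add (re_inner_apply_nonneg hA v)
    (re_inner_apply_nonneg hB v)]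
  simp

theorem quadForm_smul {r : ℝ} (hr : 0 ≤ r) (A : H →L[ℂ] H) (v : H) :
    quadForm ((r : ℂ) • A) v = ENNReal.ofReal r * quadForm A v := by
  rw [quadForm, quadForm, ← ENNReal.ofReal_mul hr]
  simp

theorem quadForm_mono {A B : H →L[ℂ] H} (h : A ≤ B) (v : H) : quadForm A v ≤ quadForm B v := by
  apply ENNReal.ofReal_le_ofReal
  have := re_inner_apply_nonneg (ContinuousLinearMap.le_def A B |>.mp h) v
  simpa [inner_sub_right] using this

theorem isPositive_smul {r : ℝ} (hr : 0 ≤ r) {A : H →L[ℂ] H} (hA : A.IsPositive) :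
    ((r : ℂ) • A).IsPositive :=
  hA.smul_of_nonneg (by exact_mod_cast hr)

/-- Parseval's identity in `[0, ∞]`. -/
theorem HilbertBasis.tsum_ofReal_norm_inner_sq {ι : Type*} (b : HilbertBasis ι ℂ H) (v : H) :
    ∑' i, ENNReal.ofReal (‖inner ℂ (b i) v‖ ^ 2) = ENNReal.ofReal (‖v‖ ^ 2) := by
  have h := b.hasSum_inner_mul_inner v v
  have h2 : HasSum (fun i => ‖inner ℂ (b i) v‖ ^ 2) (‖v‖ ^ 2) := by
    have h3 := (Complex.hasSum_iff _ _ |>.mp h).1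
    convert h3 using 1
    · ext i
      rw [← inner_conj_symm v (b i), mul_comm, Complex.mul_conj, Complex.normSq_eq_norm_sq,
        Complex.ofReal_re]
    · rw [inner_self_eq_norm_sq_to_K]
      norm_cast
  rw [← h2.tsum_eq, ENNReal.ofReal_tsum_of_nonneg (fun _ => by positivity) h2.summable]

theorem HilbertBasis.tsum_ofReal_norm_inner_sq' {ι : Type*} (b : HilbertBasis ι ℂ H) (v : H) :
    ∑' i, ENNReal.ofReal (‖inner ℂ v (b i)‖ ^ 2) = ENNReal.ofReal (‖v‖ ^ 2) := by
  simp_rw [norm_inner_symm v]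
  exact b.tsum_ofReal_norm_inner_sq v

/-- A positive operator is `S * S` for a self-adjoint `S`. -/
theorem ContinuousLinearMap.IsPositive.exists_sq {A : H →L[ℂ] H} (hA : A.IsPositive) :
    ∃ S : H →L[ℂ] H, (∀ v w, inner ℂ (S v) w = inner ℂ v (S w)) ∧ S * S = A := by
  have h0 : (0 : H →L[ℂ] H) ≤ A := (ContinuousLinearMap.nonneg_iff_isPositive A).mpr hA
  refine ⟨CFC.sqrt A, fun v w => ?_, CFC.sqrt_mul_sqrt_self A h0⟩
  exact (ContinuousLinearMap.nonneg_iff_isPositive _ |>.mp (CFC.sqrt_nonneg A)).isSymmetric v w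

theorem quadForm_eq_norm_sq {A S : H →L[ℂ] H} (hS : ∀ v w, inner ℂ (S v) w = inner ℂ v (S w))
    (hSA : S * S = A) (v : H) : quadForm A v = ENNReal.ofReal (‖S v‖ ^ 2) := by
  rw [quadForm, ← hSA, mul_apply_eq_comp, ← hS, inner_self_eq_norm_sq_to_K]
  norm_cast

/-- The trace of a positive operator can be computed in any Hilbert basis. -/
theorem opTrace_eq_tsum {A : H →L[ℂ] H} (hA : A.IsPositive) {ι : Type*}
    (b : HilbertBasis ι ℂ H) : opTrace A = ∑' i, quadForm A (b i) := by
  obtain ⟨S, hS, hSA⟩ := hA.exists_sq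
  have key : ∀ {κ κ' : Type _} (c : HilbertBasis κ ℂ H) (d : HilbertBasis κ' ℂ H),
      ∑' i, quadForm A (c i) = ∑' j, quadForm A (d j) := by
    intro κ κ' c d
    simp_rw [quadForm_eq_norm_sq hS hSA]
    calc ∑' i, ENNReal.ofReal (‖S (c i)‖ ^ 2)
        = ∑' i, ∑' j, ENNReal.ofReal (‖inner ℂ (d j) (S (c i))‖ ^ 2) := by
          simp_rw [d.tsum_ofReal_norm_inner_sq]
      _ = ∑' j, ∑' i, ENNReal.ofReal (‖inner ℂ (d j) (S (c i))‖ ^ 2) := ENNReal.tsum_comm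
      _ = ∑' j, ENNReal.ofReal (‖S (d j)‖ ^ 2) := by
          refine tsum_congr fun j => ?_
          simp_rw [← hS (d j)]
          exact c.tsum_ofReal_norm_inner_sq' _
  obtain ⟨c, hc⟩ := (exists_hilbertBasis ℂ H).choose_spec
  rw [← key c b]
  refine tsum_congr fun i => ?_
  rw [hc, quadForm]

theorem opTrace_add {A B : H →L[ℂ] H} (hA : A.IsPositive) (hB : B.IsPositive) :
    opTrace (A + B) = opTrace A + opTrace B := by
  obtain ⟨w, b, -⟩ := exists_hilbertBasis ℂ H
  rw [opTrace_eq_tsum hA b, opTrace_eq_tsum hB b, opTrace_eq_tsum (hA.add hB) b,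
    ← ENNReal.tsum_add]
  exact tsum_congr fun i => quadForm_add hA hB _

theorem opTrace_smul {r : ℝ} (hr : 0 ≤ r) {A : H →L[ℂ] H} (hA : A.IsPositive) :
    opTrace ((r : ℂ) • A) = ENNReal.ofReal r * opTrace A := by
  obtain ⟨w, b, -⟩ := exists_hilbertBasis ℂ H
  rw [opTrace_eq_tsum hA b, opTrace_eq_tsum (isPositive_smul hr hA) b, ← ENNReal.tsum_mul_left]
  exact tsum_congr fun i => quadForm_smul hr _ _

theorem opTrace_mono {A B : H →L[ℂ] H} (hA : A.IsPositive) (h : A ≤ B) :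
    opTrace A ≤ opTrace B := by
  obtain ⟨w, b, -⟩ := exists_hilbertBasis ℂ H
  have hB : B.IsPositive := by
    rw [← ContinuousLinearMap.nonneg_iff_isPositive] at hA ⊢
    exact hA.trans h
  rw [opTrace_eq_tsum hA b, opTrace_eq_tsum hB b]
  exact ENNReal.tsum_le_tsum fun i => quadForm_mono h _

theorem opTrace_zero : opTrace (0 : H →L[ℂ] H) = 0 := by
  simp [opTrace]

/-- A unit vector is part of a Hilbert basis, so the quadratic form is bounded by the trace. -/
theorem quadForm_le_opTrace {A : H →L[ℂ] H} (hA : A.IsPositive) {v : H} (hv : ‖v‖ = 1) :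
    quadForm A v ≤ opTrace A := by
  classical
  have hs : Orthonormal ℂ ((↑) : ({v} : Set H) → H) := by
    rw [orthonormal_subtype_iff_ite]
    intro a ha b hb
    simp only [Set.mem_singleton_iff] at ha hb
    subst ha hb
    simp [inner_self_eq_norm_sq_to_K, hv]
  obtain ⟨w, b, hw, hb⟩ := hs.exists_hilbertBasis_extension
  rw [opTrace_eq_tsum hA b]
  have := ENNReal.le_tsum (f := fun i => quadForm A (b i)) ⟨v, hw rfl⟩
  simpa [hb] using this

theorem norm_le_of_opTrace {A : H →L[ℂ] H} (hA : A.IsPositive) (h : opTrace A ≠ ⊤) :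
    ‖A‖ ≤ (opTrace A).toReal := by
  obtain ⟨S, hS, hSA⟩ := hA.exists_sq
  have hS1 : ∀ v, ‖S v‖ ^ 2 ≤ (opTrace A).toReal * ‖v‖ ^ 2 := by
    intro v
    by_cases hv : v = 0
    · simp [hv]
    have hv' : ‖v‖ ≠ 0 := norm_ne_zero_iff.mpr hv
    have h1 : ‖((‖v‖⁻¹ : ℝ) : ℂ) • v‖ = 1 := by
      rw [norm_smul]; simp [hv']
    have h2 := quadForm_le_opTrace hA h1
    rw [quadForm_eq_norm_sq hS hSA, ENNReal.ofReal_le_iff_le_toReal h, map_smul, norm_smul] at h2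
    have h3 : (‖v‖⁻¹ * ‖S v‖) ^ 2 ≤ (opTrace A).toReal := by simpa using h2
    calc ‖S v‖ ^ 2 = (‖v‖⁻¹ * ‖S v‖) ^ 2 * ‖v‖ ^ 2 := by field_simp
      _ ≤ _ := by gcongr
  have hS2 : ‖S‖ ≤ Real.sqrt (opTrace A).toReal := by
    refine S.opNorm_le_bound (Real.sqrt_nonneg _) fun v => ?_
    rw [← Real.sqrt_sq (norm_nonneg v), ← Real.sqrt_mul ENNReal.toReal_nonneg]
    exact Real.le_sqrt_of_sq_le (hS1 v)
  calc ‖A‖ ≤ ‖S‖ * ‖S‖ := by rw [← hSA]; exact norm_mul_le _ _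
    _ ≤ Real.sqrt (opTrace A).toReal * Real.sqrt (opTrace A).toReal := by gcongr
    _ = _ := Real.mul_self_sqrt ENNReal.toReal_nonneg

/-- A positive operator with finite trace is compact: its square root is Hilbert–Schmidt. -/
theorem isCompactOperator_of_opTrace {A : H →L[ℂ] H} (hA : A.IsPositive) (h : opTrace A ≠ ⊤) :
    IsCompactOperator A := by
  classical
  obtain ⟨S, hS, hSA⟩ := hA.exists_sq
  obtain ⟨w, b, -⟩ := exists_hilbertBasis ℂ H
  rw [opTrace_eq_tsum hA b] at h
  simp_rw [quadForm_eq_norm_sq hS hSA] at h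
  have hsum : Summable fun i => ‖S (b i)‖ ^ 2 := by
    have := ENNReal.summable_toReal h
    simpa [ENNReal.toReal_ofReal, sq_nonneg] using this
  -- finite-rank truncations of `S`
  let F : Finset w → (H →L[ℂ] H) := fun s =>
    ∑ i ∈ s, InnerProductSpace.rankOne ℂ (b i) (S (b i))
  have hF : ∀ s, IsCompactOperator (F s) := by
    intro s
    have : F s ∈ compactOperator (RingHom.id ℂ) H H := by
      refine Submodule.sum_mem _ fun i _ => ?_
      change IsCompactOperator (InnerProductSpace.rankOne ℂ (b i) (S (b i)))
      have h1 : IsCompactOperator (innerSL ℂ (S (b i))) :=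
        isCompactOperator_of_locallyCompactSpace_dom (innerSL ℂ (S (b i)))
      exact (h1.clm_comp (ContinuousLinearMap.toSpanSingleton ℂ (b i)) :)
    exact this
  have hlim : Filter.Tendsto F Filter.atTop (nhds S) := by
    rw [tendsto_iff_norm_sub_tendsto_zero]
    have htail : Filter.Tendsto (fun s : Finset w =>
        Real.sqrt (∑' i : {i // i ∉ s}, ‖S (b i)‖ ^ 2)) Filter.atTop (nhds 0) := by
      have := tendsto_tsum_compl_atTop_zero (fun i => ‖S (b i)‖ ^ 2)
      simpa using this.sqrt
    refine squeeze_zero (fun _ => norm_nonneg _) (fun s => ?_) htail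
    refine ContinuousLinearMap.opNorm_le_bound _ (Real.sqrt_nonneg _) fun v => ?_
    have h2 : ‖(F s - S) v‖ ^ 2 ≤ (∑' i : {i // i ∉ s}, ‖S (b i)‖ ^ 2) * ‖v‖ ^ 2 := by
      have hnn : 0 ≤ ∑' i : {i // i ∉ s}, ‖S (b i)‖ ^ 2 := tsum_nonneg fun _ => sq_nonneg _
      rw [← ENNReal.ofReal_le_ofReal_iff (by positivity), ENNReal.ofReal_mul hnn,
        ENNReal.ofReal_tsum_of_nonneg (fun _ => sq_nonneg _)
          (hsum.comp_injective Subtype.val_injective),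
        ← ENNReal.tsum_mul_right, ← b.tsum_ofReal_norm_inner_sq]
      have hcoef : ∀ i, inner ℂ (b i) ((F s - S) v) =
          if i ∈ s then 0 else - inner ℂ (S (b i)) v := by
        intro i
        simp only [F, sub_apply, sum_apply, inner_sub_right,
          inner_sum, InnerProductSpace.rankOne_apply, inner_smul_right,
          orthonormal_iff_ite.mp b.orthonormal]
        rw [← hS]
        split_ifs with hi <;> simp [hi]
      have hsupp : (Function.support fun i => ENNReal.ofReal (‖inner ℂ (b i) ((F s - S) v)‖ ^ 2)) ⊆
          {i | i ∉ s} := by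
        intro i hi
        by_contra hc
        simp only [Set.mem_ofPred_eq, not_not] at hc
        rw [Function.mem_support, hcoef, if_pos hc] at hi
        simp at hi
      rw [← tsum_subtype_eq_of_support_subset hsupp]
      refine ENNReal.tsum_le_tsum fun i => ?_
      rw [← ENNReal.ofReal_mul (sq_nonneg _)]
      apply ENNReal.ofReal_le_ofReal
      have hi : (i : w) ∉ s := i.2
      rw [hcoef, if_neg hi, norm_neg, ← mul_pow]
      gcongr
      exact norm_inner_le_norm _ _
    rw [← Real.sqrt_sq (norm_nonneg v), ← Real.sqrt_mul (tsum_nonneg fun _ => sq_nonneg _)]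
    exact Real.le_sqrt_of_sq_le h2
  have hSc : IsCompactOperator S :=
    isCompactOperator_of_tendsto hlim (Filter.Eventually.of_forall hF)
  rw [← hSA]
  exact hSc.comp_clm S

end Trace

/-! ### Eigenbases and the functional calculus -/

section Eigen

variable {H : Type*} [NormedAddCommGroup H] [InnerProductSpace ℂ H] [CompleteSpace H]

/-- Compact self-adjoint operators have eigenbases. -/
theorem exists_eigenbasis {A : H →L[ℂ] H} (hc : IsCompactOperator A) (hA : A.IsSymmetric) :
    Nonempty (Eigenbasis A) := by
  let E : ℂ → Submodule ℂ H := fun μ => Module.End.eigenspace (A : Module.End ℂ H) μ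
  have hcl : ∀ μ, IsClosed (E μ : Set H) := by
    intro μ
    have : (E μ : Set H) = {v | A v = μ • v} := by
      ext v; simp [E]
    rw [this]
    exact isClosed_eq A.continuous (continuous_const_smul μ)
  have hcs : ∀ μ, CompleteSpace (E μ) := fun μ => (hcl μ).completeSpace_coe
  choose w b hb using fun μ => exists_hilbertBasis ℂ (E μ)
  let S : Set H := ⋃ μ, Subtype.val '' (w μ)
  have hmem : ∀ x : S, ∃ μ, ∃ i : w μ, ((i : E μ) : H) = x := by
    rintro ⟨x, hx⟩
    obtain ⟨μ, y, hy, rfl⟩ := Set.mem_iUnion.mp hx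
    exact ⟨μ, ⟨y, hy⟩, rfl⟩
  have hortho : Orthonormal ℂ ((↑) : S → H) := by
    constructor
    · intro x
      obtain ⟨μ, i, hi⟩ := hmem x
      have := (b μ).orthonormal.1 i
      rw [hb] at this
      rw [← hi]
      exact this
    · intro x y hxy
      obtain ⟨μ, i, hi⟩ := hmem x
      obtain ⟨ν, j, hj⟩ := hmem y
      change inner ℂ (x : H) (y : H) = 0
      rw [← hi, ← hj]
      by_cases hμ : μ = ν
      · subst hμ
        have hij : i ≠ j := by
          rintro rfl
          exact hxy (Subtype.ext (hi.symm.trans hj))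
        have := (b μ).orthonormal.2 hij
        simp only at this
        rw [hb] at this
        exact this
      · exact hA.orthogonalFamily_eigenspaces hμ i.1 j.1
  have hbot : (Submodule.span ℂ (Set.range ((↑) : S → H)))ᗮ = ⊥ := by
    rw [eq_bot_iff, ← ContinuousLinearMap.orthogonalComplement_iSup_eigenspaces_eq_bot hc hA]
    intro v hv
    rw [Submodule.mem_orthogonal'] at hv
    have : ⨆ μ, E μ ≤ (ℂ ∙ v)ᗮ := by
      refine iSup_le fun μ x hx => ?_
      rw [Submodule.mem_orthogonal_singleton_iff_inner_right]
      have h1 := (b μ).hasSum_repr ⟨x, hx⟩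
      have h2 := h1.mapL ((innerSL ℂ v).comp (E μ).subtypeL)
      refine h2.unique ?_
      convert hasSum_zero with i
      have : inner ℂ v (((b μ i : E μ)) : H) = 0 := by
        refine hv _ (Submodule.subset_span ⟨⟨_, Set.mem_iUnion.mpr ⟨μ, b μ i, ?_, rfl⟩⟩, rfl⟩)
        rw [hb]
        exact i.2
      simp [this]
    intro u hu
    have := this hu
    rw [Submodule.mem_orthogonal_singleton_iff_inner_right] at this
    exact inner_eq_zero_symm.mp this
  refine ⟨⟨S, HilbertBasis.mkOfOrthogonalEqBot hortho hbot,
    fun i => (inner ℂ (i : H) (A i)).re, fun i => ?_⟩⟩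
  rw [HilbertBasis.coe_mkOfOrthogonalEqBot]
  obtain ⟨μ, j, hj⟩ := hmem i
  have hev : A (i : H) = μ • (i : H) := by
    rw [← hj]
    exact Module.End.mem_eigenspace_iff.mp j.1.2
  have hn : ‖(i : H)‖ = 1 := hortho.1 i
  have hμ : (starRingEnd ℂ) μ = μ := by
    refine hA.conj_eigenvalue_eq_self (Module.End.hasEigenvalue_of_hasEigenvector
      (x := (i : H)) ⟨Module.End.mem_eigenspace_iff.mpr hev, ?_⟩)
    rw [← norm_ne_zero_iff, hn]; exact one_ne_zero
  rw [hev, inner_smul_right, inner_self_eq_norm_sq_to_K, hn]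
  simp only [Complex.coe_algebraMap, Complex.ofReal_one, one_pow, mul_one]
  rw [Complex.conj_eq_iff_re.mp hμ]

/-- The continuous functional calculus acts on an eigenvector through its eigenvalue. -/
theorem cfc_apply_eigenvector {A : H →L[ℂ] H} (hA : IsSelfAdjoint A) {v : H} {t : ℝ}
    (hv : A v = (t : ℂ) • v) {f : ℝ → ℝ} (hf : ContinuousOn f (spectrum ℝ A)) :
    cfc f A v = (f t : ℂ) • v := by
  by_cases hv0 : v = 0
  · simp [hv0]
  have hC : (t : ℂ) ∈ spectrum ℂ A := by
    rw [ContinuousLinearMap.spectrum_eq]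
    exact (Module.End.hasEigenvalue_of_hasEigenvector
      ⟨Module.End.mem_eigenspace_iff.mpr hv, hv0⟩).mem_spectrum
  have ht : t ∈ spectrum ℝ A := by
    rwa [← spectrum.algebraMap_mem_iff ℂ]
  rw [cfc_apply f A hA hf]
  have key : ∀ g : C(spectrum ℝ A, ℝ), cfcHom hA g v = (g ⟨t, ht⟩ : ℂ) • v := by
    intro g
    induction g using ContinuousMap.induction_on_of_compact with
    | const r =>
      have : (ContinuousMap.const (spectrum ℝ A) r) = algebraMap ℝ _ r := rfl
      rw [this, AlgHomClass.commutes, Algebra.algebraMap_eq_smul_one]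
      simp
    | id =>
      rw [cfcHom_id]
      simpa using hv
    | star_id =>
      rw [map_star, cfcHom_id, hA.star_eq]
      simpa using hv
    | add f g hf hg => rw [map_add, add_apply, hf, hg, ← add_smul]; simp
    | mul f g hf hg =>
      rw [map_mul, mul_apply_eq_comp, hg, map_smul, hf, smul_smul]
      simp [mul_comm]
    | frequently f hf =>
      have hcl : IsClosed {g : C(spectrum ℝ A, ℝ) | cfcHom hA g v = (g ⟨t, ht⟩ : ℂ) • v} := by
        refine isClosed_eq ?_ ?_
        · exact (ContinuousLinearMap.apply ℂ H v).continuous.comp (cfcHom_continuous hA)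
        · exact (Complex.continuous_ofReal.comp (continuous_eval_const _)).smul continuous_const
      exact hcl.mem_of_frequently_of_tendsto hf Filter.tendsto_id
  rw [key]
  rfl

namespace Eigenbasis

variable {A : H →L[ℂ] H} (E : Eigenbasis A)

theorem norm_basis (i : E.index) : ‖E.basis i‖ = 1 := E.basis.orthonormal.1 i

theorem inner_basis_apply (hA : A.IsPositive) (i : E.index) (v : H) :
    inner ℂ (E.basis i) (A v) = E.eigenvalue i * inner ℂ (E.basis i) v := by
  rw [← hA.inner_left_eq_inner_right, E.apply_basis, inner_smul_left, Complex.conj_ofReal]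

theorem re_inner_basis (i : E.index) : (inner ℂ (E.basis i) (A (E.basis i))).re =
    E.eigenvalue i := by
  rw [E.apply_basis, inner_smul_right, inner_self_eq_norm_sq_to_K, E.norm_basis]
  simp

theorem quadForm_basis (i : E.index) :
    quadForm A (E.basis i) = ENNReal.ofReal (E.eigenvalue i) := by
  rw [quadForm, E.re_inner_basis]

theorem eigenvalue_nonneg (hA : A.IsPositive) (i : E.index) : 0 ≤ E.eigenvalue i := by
  rw [← E.re_inner_basis]
  exact re_inner_apply_nonneg hA _

theorem hasSum_re_inner (hA : A.IsPositive) (v : H) :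
    HasSum (fun i => E.eigenvalue i * ‖inner ℂ (E.basis i) v‖ ^ 2) (inner ℂ v (A v)).re := by
  have h := (Complex.hasSum_iff _ _ |>.mp (E.basis.hasSum_inner_mul_inner v (A v))).1
  convert h using 1
  ext i
  rw [E.inner_basis_apply hA, mul_left_comm, ← inner_conj_symm v (E.basis i),
    mul_comm ((starRingEnd ℂ) _),
    Complex.mul_conj, Complex.normSq_eq_norm_sq]
  norm_cast

theorem quadForm_eq_tsum (hA : A.IsPositive) (v : H) :
    quadForm A v =
      ∑' i, ENNReal.ofReal (E.eigenvalue i) * ENNReal.ofReal (‖inner ℂ (E.basis i) v‖ ^ 2) := by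
  rw [quadForm, ← (E.hasSum_re_inner hA v).tsum_eq, ENNReal.ofReal_tsum_of_nonneg
    (fun i => mul_nonneg (E.eigenvalue_nonneg hA i) (sq_nonneg _))
    (E.hasSum_re_inner hA v).summable]
  exact tsum_congr fun i => ENNReal.ofReal_mul (E.eigenvalue_nonneg hA i)

theorem opTrace_eq (hA : A.IsPositive) :
    opTrace A = ∑' i, ENNReal.ofReal (E.eigenvalue i) := by
  rw [opTrace_eq_tsum hA E.basis]
  exact tsum_congr fun i => E.quadForm_basis i

/-- An eigenbasis of `A` is an eigenbasis of `f(A)`. -/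
noncomputable def cfc (hA : IsSelfAdjoint A) {f : ℝ → ℝ} (hf : Continuous f) :
    Eigenbasis (_root_.cfc f A) where
  index := E.index
  basis := E.basis
  eigenvalue i := f (E.eigenvalue i)
  apply_basis i := cfc_apply_eigenvector hA (E.apply_basis i) hf.continuousOn

/-- An eigenbasis of `A` is an eigenbasis of `r A`. -/
noncomputable def smul (r : ℝ) : Eigenbasis ((r : ℂ) • A) where
  index := E.index
  basis := E.basis
  eigenvalue i := r * E.eigenvalue i
  apply_basis i := by
    rw [smul_apply, E.apply_basis, smul_smul, Complex.ofReal_mul]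

end Eigenbasis

/-- A positive operator of trace at most one. All eigenvalues lie in `[0, 1]`, so that entropies
are sums of nonnegative terms. -/
def IsSubstate (A : H →L[ℂ] H) : Prop :=
  A.IsPositive ∧ opTrace A ≤ 1

theorem IsState.isSubstate {A : H →L[ℂ] H} (hA : IsState A) : IsSubstate A := ⟨hA.1, hA.2.le⟩

namespace IsSubstate

variable {A B : H →L[ℂ] H}

theorem ne_top (hA : IsSubstate A) : opTrace A ≠ ⊤ := ne_top_of_le_ne_top ENNReal.one_ne_top hA.2

theorem nonempty_eigenbasis (hA : IsSubstate A) : Nonempty (Eigenbasis A) :=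
  exists_eigenbasis (isCompactOperator_of_opTrace hA.1 hA.ne_top) hA.1.isSymmetric

/-- Some eigenbasis of an operator of trace at most one. -/
noncomputable def eigenbasis (hA : IsSubstate A) : Eigenbasis A := hA.nonempty_eigenbasis.some

theorem of_le (hB : IsSubstate B) (hA : A.IsPositive) (h : A ≤ B) : IsSubstate A :=
  ⟨hA, (opTrace_mono hA h).trans hB.2⟩

theorem smul (hA : IsSubstate A) {r : ℝ} (h0 : 0 ≤ r) (h1 : r ≤ 1) :
    IsSubstate ((r : ℂ) • A) := by
  refine ⟨isPositive_smul h0 hA.1, ?_⟩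
  rw [opTrace_smul h0 hA.1]
  exact mul_le_one' (by simpa using h1) hA.2

theorem norm_le_one (hA : IsSubstate A) : ‖A‖ ≤ 1 :=
  (norm_le_of_opTrace hA.1 hA.ne_top).trans (ENNReal.toReal_le_of_le_ofReal zero_le_one
    (by simpa using hA.2))

theorem eigenvalue_le_one (hA : IsSubstate A) (E : Eigenbasis A) (i : E.index) :
    E.eigenvalue i ≤ 1 := by
  have h := (ENNReal.le_tsum i).trans ((E.opTrace_eq hA.1).symm.le.trans hA.2)
  simpa using h

theorem eigenvalue_mem (hA : IsSubstate A) (E : Eigenbasis A) (i : E.index) :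
    0 ≤ E.eigenvalue i ∧ E.eigenvalue i ≤ 1 :=
  ⟨E.eigenvalue_nonneg hA.1 i, hA.eigenvalue_le_one E i⟩

theorem negMulLog_nonneg (hA : IsSubstate A) (E : Eigenbasis A) (i : E.index) :
    0 ≤ Real.negMulLog (E.eigenvalue i) :=
  Real.negMulLog_nonneg (hA.eigenvalue_mem E i).1 (hA.eigenvalue_mem E i).2

/-- The entropy is the Shannon entropy of the eigenvalues. -/
theorem vnEntropy_eq (hA : IsSubstate A) (E : Eigenbasis A) :
    vnEntropy A = ∑' i, ENNReal.ofReal (Real.negMulLog (E.eigenvalue i)) := by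
  have hpos : (_root_.cfc Real.negMulLog A).IsPositive := by
    rw [← ContinuousLinearMap.nonneg_iff_isPositive]
    refine cfc_nonneg fun x hx => ?_
    have h0 : (0 : H →L[ℂ] H) ≤ A := (ContinuousLinearMap.nonneg_iff_isPositive A).mpr hA.1
    refine Real.negMulLog_nonneg (spectrum_nonneg_of_nonneg h0 hx) ?_
    have : Nontrivial H := by
      by_contra hn
      rw [not_nontrivial_iff_subsingleton] at hn
      have : Subsingleton (H →L[ℂ] H) := ⟨fun a b => by ext v; exact Subsingleton.elim _ _⟩
      exact hx (isUnit_of_subsingleton _)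
    have := spectrum.norm_le_norm_of_mem hx
    exact (le_abs_self x).trans (this.trans hA.norm_le_one)
  rw [vnEntropy, (E.cfc hA.1.isSelfAdjoint Real.continuous_negMulLog).opTrace_eq hpos]
  rfl

end IsSubstate

end Eigen

/-! ### Cross entropy and relative entropy -/

section CrossEntropy

open Filter Topology

/-- `- log y` with values in `[0, ∞]`, for `0 ≤ y ≤ 1`. -/
noncomputable def negLog (y : ℝ) : ℝ≥0∞ :=
  if y = 0 then ⊤ else ENNReal.ofReal (-Real.log y)

theorem klTerm_add {x y : ℝ} (hx : 0 ≤ x) (hx1 : x ≤ 1) (hy : 0 ≤ y) (hy1 : y ≤ 1) :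
    klTerm x y + ENNReal.ofReal (Real.negMulLog x) + ENNReal.ofReal x =
      ENNReal.ofReal x * negLog y + ENNReal.ofReal y := by
  rcases hx.eq_or_lt with rfl | hx
  · simp [klTerm]
  rcases hy.eq_or_lt with rfl | hy
  · simp [klTerm, negLog, hx.ne', hx]
  rw [klTerm, if_neg hx.ne', if_neg hy.ne', negLog, if_neg hy.ne']
  have h1 : 0 ≤ -Real.log y := by have := Real.log_nonpos hy.le hy1; linarith
  have h2 : 0 ≤ Real.negMulLog x := Real.negMulLog_nonneg hx.le hx1
  have h3 : 0 ≤ x * Real.log (x / y) + y - x := by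
    have := Real.one_sub_inv_le_log_of_pos (div_pos hx hy)
    have h4 : x * (1 - (x / y)⁻¹) = x - y := by field_simp
    nlinarith
  rw [← ENNReal.ofReal_add h3 h2, ← ENNReal.ofReal_add (by positivity) hx.le,
    ← ENNReal.ofReal_mul hx.le, ← ENNReal.ofReal_add (by positivity) hy.le]
  congr 1
  rw [Real.log_div hx.ne' hy.ne', Real.negMulLog]
  ring

/-- A bounded regularisation of `- log`, which increases to `- log t` as `δ` decreases to `0`. -/
noncomputable def regNegLog (δ t : ℝ) : ℝ := Real.log (1 + δ) - Real.log (t + δ)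

theorem ofReal_regNegLog_le {δ t : ℝ} (hδ : 0 < δ) (ht : 0 ≤ t) (ht1 : t ≤ 1) :
    ENNReal.ofReal (regNegLog δ t) ≤ negLog t := by
  rcases ht.eq_or_lt with rfl | ht
  · simp [negLog]
  rw [negLog, if_neg ht.ne']
  apply ENNReal.ofReal_le_ofReal
  have : Real.log (t * (1 + δ)) ≤ Real.log (t + δ) := Real.log_le_log (by positivity) (by nlinarith)
  rw [Real.log_mul ht.ne' (by positivity)] at this
  rw [regNegLog]
  linarith

theorem tendsto_regNegLog {t : ℝ} (ht : 0 ≤ t) :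
    Tendsto (fun δ => ENNReal.ofReal (regNegLog δ t)) (𝓝[>] 0) (𝓝 (negLog t)) := by
  have h1 : Tendsto (fun δ : ℝ => Real.log (1 + δ)) (𝓝[>] 0) (𝓝 0) := by
    have : ContinuousAt (fun δ : ℝ => Real.log (1 + δ)) 0 :=
      (Real.continuousAt_log (by norm_num)).comp' (by fun_prop)
    have := this.tendsto.mono_left (nhdsWithin_le_nhds (s := Set.Ioi 0))
    simpa using this
  rcases ht.eq_or_lt with rfl | ht
  · rw [negLog, if_pos rfl]
    apply ENNReal.tendsto_ofReal_atTop.comp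
    simp only [regNegLog, zero_add, sub_eq_add_neg]
    exact h1.add_atTop (tendsto_neg_atBot_atTop.comp Real.tendsto_log_nhdsGT_zero)
  · rw [negLog, if_neg ht.ne']
    apply ENNReal.tendsto_ofReal
    have h2 : Tendsto (fun δ : ℝ => Real.log (t + δ)) (𝓝[>] 0) (𝓝 (Real.log t)) := by
      have : ContinuousAt (fun δ : ℝ => Real.log (t + δ)) 0 :=
        (Real.continuousAt_log (by simpa using ht.ne')).comp' (by fun_prop)
      have := this.tendsto.mono_left (nhdsWithin_le_nhds (s := Set.Ioi 0))
      simpa using this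
    simpa [regNegLog] using h1.sub h2

variable {H : Type*} [NormedAddCommGroup H] [InnerProductSpace ℂ H] [CompleteSpace H]

namespace Eigenbasis

variable {A B B' : H →L[ℂ] H}

/-- `⟨v, (- log B) v⟩`, computed in an eigenbasis of `B`. -/
noncomputable def negLogForm (F : Eigenbasis B) (v : H) : ℝ≥0∞ :=
  ∑' j, ENNReal.ofReal (‖inner ℂ (F.basis j) v‖ ^ 2) * negLog (F.eigenvalue j)

/-- The cross entropy `- Tr A log B`, computed in an eigenbasis of `B`. -/
noncomputable def crossEntropy (F : Eigenbasis B) (A : H →L[ℂ] H) : ℝ≥0∞ :=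
  ∑' j, quadForm A (F.basis j) * negLog (F.eigenvalue j)

/-- The relative entropy `Tr (A log A - A log B + B - A)` of two positive operators, computed in
eigenbases. -/
noncomputable def relEnt (E : Eigenbasis A) (F : Eigenbasis B) : ℝ≥0∞ :=
  ∑' (i : E.index) (j : F.index), ENNReal.ofReal (‖inner ℂ (E.basis i) (F.basis j)‖ ^ 2) *
    klTerm (E.eigenvalue i) (F.eigenvalue j)

theorem crossEntropy_eq_tsum (hA : A.IsPositive) (E : Eigenbasis A) (F : Eigenbasis B) :
    F.crossEntropy A = ∑' i, ENNReal.ofReal (E.eigenvalue i) * F.negLogForm (E.basis i) := by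
  simp_rw [crossEntropy, negLogForm, E.quadForm_eq_tsum hA, ← ENNReal.tsum_mul_right,
    ← ENNReal.tsum_mul_left]
  rw [ENNReal.tsum_comm]
  refine tsum_congr fun i => tsum_congr fun j => ?_
  rw [norm_inner_symm, mul_assoc]

theorem crossEntropy_self (hB : IsSubstate B) (F : Eigenbasis B) :
    F.crossEntropy B = vnEntropy B := by
  rw [hB.vnEntropy_eq F, crossEntropy]
  refine tsum_congr fun j => ?_
  rw [F.quadForm_basis, negLog]
  obtain ⟨h0, h1⟩ := hB.eigenvalue_mem F j
  split_ifs with h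
  · simp [h]
  · rw [← ENNReal.ofReal_mul h0, Real.negMulLog]
    congr 1
    ring

/-- The relative entropy is the cross entropy minus the entropy, up to a difference of traces. -/
theorem relEnt_add (hA : IsSubstate A) (hB : IsSubstate B) (E : Eigenbasis A) (F : Eigenbasis B) :
    relEnt E F + vnEntropy A + opTrace A = F.crossEntropy A + opTrace B := by
  have hrow : ∀ (c : ℝ≥0∞) (i : E.index),
      c = ∑' j, ENNReal.ofReal (‖inner ℂ (E.basis i) (F.basis j)‖ ^ 2) * c := by
    intro c i
    rw [ENNReal.tsum_mul_right, F.basis.tsum_ofReal_norm_inner_sq', E.norm_basis]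
    simp
  have hcol : ∀ (c : ℝ≥0∞) (j : F.index),
      c = ∑' i, ENNReal.ofReal (‖inner ℂ (E.basis i) (F.basis j)‖ ^ 2) * c := by
    intro c j
    rw [ENNReal.tsum_mul_right, E.basis.tsum_ofReal_norm_inner_sq, F.norm_basis]
    simp
  have h1 : opTrace B = ∑' i, ∑' j, ENNReal.ofReal (‖inner ℂ (E.basis i) (F.basis j)‖ ^ 2) *
      ENNReal.ofReal (F.eigenvalue j) := by
    rw [F.opTrace_eq hB.1, ENNReal.tsum_comm]
    exact tsum_congr fun j => hcol _ j
  have h2 : opTrace A = ∑' i, ∑' j, ENNReal.ofReal (‖inner ℂ (E.basis i) (F.basis j)‖ ^ 2) *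
      ENNReal.ofReal (E.eigenvalue i) := by
    rw [E.opTrace_eq hA.1]
    exact tsum_congr fun i => hrow _ i
  have h3 : vnEntropy A = ∑' i, ∑' j, ENNReal.ofReal (‖inner ℂ (E.basis i) (F.basis j)‖ ^ 2) *
      ENNReal.ofReal (Real.negMulLog (E.eigenvalue i)) := by
    rw [hA.vnEntropy_eq E]
    exact tsum_congr fun i => hrow _ i
  have h4 : F.crossEntropy A = ∑' i, ∑' j,
      ENNReal.ofReal (‖inner ℂ (E.basis i) (F.basis j)‖ ^ 2) *
      (ENNReal.ofReal (E.eigenvalue i) * negLog (F.eigenvalue j)) := by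
    rw [crossEntropy_eq_tsum hA.1 E F]
    refine tsum_congr fun i => ?_
    rw [negLogForm, ← ENNReal.tsum_mul_left]
    refine tsum_congr fun j => ?_
    rw [norm_inner_symm]
    ring
  rw [h1, h2, h3, h4, relEnt]
  simp_rw [← ENNReal.tsum_add, ← mul_add]
  refine tsum_congr fun i => tsum_congr fun j => ?_
  obtain ⟨hx, hx1⟩ := hA.eigenvalue_mem E i
  obtain ⟨hy, hy1⟩ := hB.eigenvalue_mem F j
  rw [klTerm_add hx hx1 hy hy1]

theorem crossEntropy_add (F : Eigenbasis B) {X Y : H →L[ℂ] H} (hX : X.IsPositive)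
    (hY : Y.IsPositive) : F.crossEntropy (X + Y) = F.crossEntropy X + F.crossEntropy Y := by
  simp_rw [crossEntropy, quadForm_add hX hY, add_mul, ENNReal.tsum_add]

theorem crossEntropy_smul (F : Eigenbasis B) {r : ℝ} (hr : 0 ≤ r) (X : H →L[ℂ] H) :
    F.crossEntropy ((r : ℂ) • X) = ENNReal.ofReal r * F.crossEntropy X := by
  simp_rw [crossEntropy, quadForm_smul hr, mul_assoc, ENNReal.tsum_mul_left]

end Eigenbasis

theorem IsSubstate.le_one {B : H →L[ℂ] H} (hB : IsSubstate B) : B ≤ 1 :=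
  (CStarAlgebra.norm_le_one_iff_of_nonneg B
    ((ContinuousLinearMap.nonneg_iff_isPositive B).mpr hB.1)).mp hB.norm_le_one

theorem isStrictlyPositive_add_smul_one {B : H →L[ℂ] H} (hB : B.IsPositive) {δ : ℝ} (hδ : 0 < δ) :
    IsStrictlyPositive (B + (δ : ℝ) • (1 : H →L[ℂ] H)) := by
  have h0 : (0 : H →L[ℂ] H) ≤ B := (ContinuousLinearMap.nonneg_iff_isPositive B).mpr hB
  have h1 : IsStrictlyPositive ((δ : ℝ) • (1 : H →L[ℂ] H)) := isStrictlyPositive_one.smul hδ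
  exact IsStrictlyPositive.nonneg_add h0 h1

/-- The regularised operator `- log ((B + δ) / (1 + δ))`. -/
noncomputable def regNegLogOp (δ : ℝ) (B : H →L[ℂ] H) : H →L[ℂ] H :=
  CFC.log ((1 : H →L[ℂ] H) + (δ : ℝ) • (1 : H →L[ℂ] H)) - CFC.log (B + (δ : ℝ) • (1 : H →L[ℂ] H))

theorem regNegLogOp_antitone {B B' : H →L[ℂ] H} (hB : B.IsPositive) (h : B ≤ B') {δ : ℝ}
    (hδ : 0 < δ) : regNegLogOp δ B' ≤ regNegLogOp δ B := by
  apply sub_le_sub_left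
  exact CFC.log_le_log (by gcongr) (isStrictlyPositive_add_smul_one hB hδ)

theorem regNegLogOp_isPositive {B : H →L[ℂ] H} (hB : IsSubstate B) {δ : ℝ} (hδ : 0 < δ) :
    (regNegLogOp δ B).IsPositive := by
  rw [← ContinuousLinearMap.nonneg_iff_isPositive]
  have := regNegLogOp_antitone hB.1 hB.le_one hδ
  simpa [regNegLogOp] using this

theorem log_add_apply {B : H →L[ℂ] H} (hB : B.IsPositive) {δ : ℝ} (hδ : 0 < δ) {v : H} {t : ℝ}
    (hv : B v = (t : ℂ) • v) :
    CFC.log (B + (δ : ℝ) • (1 : H →L[ℂ] H)) v = (Real.log (t + δ) : ℂ) • v := by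
  have hsp := isStrictlyPositive_add_smul_one hB hδ
  rw [CFC.log]
  refine cfc_apply_eigenvector hsp.isSelfAdjoint ?_ ?_
  · simp [hv, add_smul]
  · exact Real.continuousOn_log.mono fun x hx => (hsp.spectrum_pos hx).ne'

/-- An eigenbasis of `B` is an eigenbasis of its regularised logarithm. -/
noncomputable def Eigenbasis.reg {B : H →L[ℂ] H} (F : Eigenbasis B) (hB : B.IsPositive) {δ : ℝ}
    (hδ : 0 < δ) : Eigenbasis (regNegLogOp δ B) where
  index := F.index
  basis := F.basis
  eigenvalue j := regNegLog δ (F.eigenvalue j)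
  apply_basis j := by
    have h1 : CFC.log ((1 : H →L[ℂ] H) + (δ : ℝ) • (1 : H →L[ℂ] H)) (F.basis j) =
        (Real.log (1 + δ) : ℂ) • F.basis j :=
      log_add_apply ContinuousLinearMap.isPositive_one hδ (by simp)
    rw [regNegLogOp, sub_apply, h1, log_add_apply hB hδ (F.apply_basis j), ← sub_smul, regNegLog,
      Complex.ofReal_sub]

/-- Operator monotonicity of the logarithm, for possibly singular operators. -/
theorem Eigenbasis.negLogForm_antitone {B B' : H →L[ℂ] H} (hB : IsSubstate B) (hB' : IsSubstate B')
    (h : B ≤ B') (F : Eigenbasis B) (F' : Eigenbasis B') (v : H) :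
    F'.negLogForm v ≤ F.negLogForm v := by
  have key : ∀ δ : ℝ, 0 < δ → ∀ s : Finset F'.index,
      ∑ j ∈ s, ENNReal.ofReal (‖inner ℂ (F'.basis j) v‖ ^ 2) *
        ENNReal.ofReal (regNegLog δ (F'.eigenvalue j)) ≤ F.negLogForm v := by
    intro δ hδ s
    calc _ ≤ ∑' j, ENNReal.ofReal (‖inner ℂ (F'.basis j) v‖ ^ 2) *
          ENNReal.ofReal (regNegLog δ (F'.eigenvalue j)) := ENNReal.sum_le_tsum s
      _ = quadForm (regNegLogOp δ B') v := by
          rw [(F'.reg hB'.1 hδ).quadForm_eq_tsum (regNegLogOp_isPositive hB' hδ)]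
          exact tsum_congr fun j => mul_comm _ _
      _ ≤ quadForm (regNegLogOp δ B) v := quadForm_mono (regNegLogOp_antitone hB.1 h hδ) v
      _ = ∑' j, ENNReal.ofReal (‖inner ℂ (F.basis j) v‖ ^ 2) *
          ENNReal.ofReal (regNegLog δ (F.eigenvalue j)) := by
          rw [(F.reg hB.1 hδ).quadForm_eq_tsum (regNegLogOp_isPositive hB hδ)]
          exact tsum_congr fun j => mul_comm _ _
      _ ≤ _ := by
          refine ENNReal.tsum_le_tsum fun j => ?_
          gcongr
          obtain ⟨h0, h1⟩ := hB.eigenvalue_mem F j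
          exact ofReal_regNegLog_le hδ h0 h1
  rw [negLogForm, ENNReal.tsum_eq_iSup_sum]
  refine iSup_le fun s => ?_
  refine le_of_tendsto (f := fun δ : ℝ => ∑ j ∈ s, ENNReal.ofReal (‖inner ℂ (F'.basis j) v‖ ^ 2) *
        ENNReal.ofReal (regNegLog δ (F'.eigenvalue j))) (x := 𝓝[>] 0) ?_ ?_
  · refine tendsto_finsetSum _ fun j _ => ?_
    exact ENNReal.Tendsto.const_mul (tendsto_regNegLog (F'.eigenvalue_nonneg hB'.1 j))
      (Or.inr ENNReal.ofReal_ne_top)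
  · filter_upwards [self_mem_nhdsWithin] with δ hδ using key δ hδ s

theorem Eigenbasis.crossEntropy_antitone {A B B' : H →L[ℂ] H} (hA : IsSubstate A)
    (hB : IsSubstate B) (hB' : IsSubstate B')
    (h : B ≤ B') (F : Eigenbasis B) (F' : Eigenbasis B') :
    F'.crossEntropy A ≤ F.crossEntropy A := by
  rw [crossEntropy_eq_tsum hA.1 hA.eigenbasis, crossEntropy_eq_tsum hA.1 hA.eigenbasis]
  refine ENNReal.tsum_le_tsum fun i => ?_
  gcongr
  exact negLogForm_antitone hB hB' h F F' _

end CrossEntropy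

/-! ### Elementary entropy inequalities -/

section Entropy

variable {H : Type*} [NormedAddCommGroup H] [InnerProductSpace ℂ H] [CompleteSpace H]
  {A B : H →L[ℂ] H}

theorem le_add_of_isPositive_right (hB : B.IsPositive) : A ≤ A + B := by
  rw [← ContinuousLinearMap.nonneg_iff_isPositive] at hB
  exact le_add_of_nonneg_right hB

theorem le_add_of_isPositive_left (hB : B.IsPositive) : A ≤ B + A := by
  rw [add_comm]
  exact le_add_of_isPositive_right hB

/-- Klein's inequality. -/
theorem vnEntropy_add_opTrace_le (hA : IsSubstate A) (hB : IsSubstate B) (F : Eigenbasis B) :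
    vnEntropy A + opTrace A ≤ F.crossEntropy A + opTrace B := by
  rw [← Eigenbasis.relEnt_add hA hB hA.eigenbasis F, add_assoc]
  exact le_add_self

/-- Subadditivity of the entropy: `- Tr A log (A + B) ≤ - Tr A log A`, as the logarithm is
operator monotone. -/
theorem vnEntropy_add_le (hA : A.IsPositive) (hB : B.IsPositive) (hAB : IsSubstate (A + B)) :
    vnEntropy (A + B) ≤ vnEntropy A + vnEntropy B := by
  have hA' := hAB.of_le hA (le_add_of_isPositive_right hB)
  have hB' := hAB.of_le hB (le_add_of_isPositive_left hA)
  rw [← hAB.eigenbasis.crossEntropy_self hAB, Eigenbasis.crossEntropy_add _ hA hB]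
  rw [← hA'.eigenbasis.crossEntropy_self hA', ← hB'.eigenbasis.crossEntropy_self hB']
  exact add_le_add
    (Eigenbasis.crossEntropy_antitone hA' hA' hAB (le_add_of_isPositive_right hB) _ _)
    (Eigenbasis.crossEntropy_antitone hB' hB' hAB (le_add_of_isPositive_left hA) _ _)

/-- Klein's inequality for `A` and `A + B`. -/
theorem vnEntropy_le_add (hA : A.IsPositive) (hB : B.IsPositive) (hAB : IsSubstate (A + B)) :
    vnEntropy A ≤ vnEntropy (A + B) + opTrace B := by
  have hA' := hAB.of_le hA (le_add_of_isPositive_right hB)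
  have h := vnEntropy_add_opTrace_le hA' hAB hAB.eigenbasis
  rw [opTrace_add hA hB, add_left_comm, add_comm, ENNReal.add_le_add_iff_left hA'.ne_top] at h
  refine h.trans ?_
  gcongr
  rw [← hAB.eigenbasis.crossEntropy_self hAB, Eigenbasis.crossEntropy_add _ hA hB]
  exact le_self_add

theorem vnEntropy_smul (hA : IsSubstate A) {r : ℝ} (h0 : 0 ≤ r) (h1 : r ≤ 1) :
    vnEntropy ((r : ℂ) • A) =
      ENNReal.ofReal r * vnEntropy A + ENNReal.ofReal (Real.negMulLog r) * opTrace A := by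
  rw [(hA.smul h0 h1).vnEntropy_eq (hA.eigenbasis.smul r), hA.vnEntropy_eq hA.eigenbasis,
    hA.eigenbasis.opTrace_eq hA.1, ← ENNReal.tsum_mul_left, ← ENNReal.tsum_mul_left,
    ← ENNReal.tsum_add]
  refine tsum_congr fun i => ?_
  have hn := hA.negMulLog_nonneg hA.eigenbasis i
  have hr := Real.negMulLog_nonneg h0 h1
  have hx := hA.eigenbasis.eigenvalue_nonneg hA.1 i
  rw [← ENNReal.ofReal_mul h0, ← ENNReal.ofReal_mul hr, ← ENNReal.ofReal_add (by positivity)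
    (by positivity)]
  congr 1
  change Real.negMulLog (r * hA.eigenbasis.eigenvalue i) = _
  rw [Real.negMulLog_mul]
  ring

/-- The entropy of an operator `A` of trace `w` is at most `- Tr A log B + η(w)`, for every state
`B`. This is Klein's inequality for `A` and `w B`. -/
theorem vnEntropy_le_crossEntropy (hA : IsSubstate A) (hB : IsSubstate B) (hBt : opTrace B = 1)
    (F : Eigenbasis B) :
    vnEntropy A ≤ F.crossEntropy A + ENNReal.ofReal (Real.negMulLog (opTrace A).toReal) := by
  set w := (opTrace A).toReal with hw
  have hw1 : w ≤ 1 := ENNReal.toReal_le_of_le_ofReal zero_le_one (by simpa using hA.2)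
  have hw0 : 0 ≤ w := ENNReal.toReal_nonneg
  have hwA : opTrace A = ENNReal.ofReal w := (ENNReal.ofReal_toReal hA.ne_top).symm
  have h := vnEntropy_add_opTrace_le hA (hB.smul hw0 hw1) (F.smul w)
  rw [opTrace_smul hw0 hB.1, hBt, mul_one, hwA, ENNReal.add_le_add_iff_right ENNReal.ofReal_ne_top]
    at h
  refine h.trans ?_
  rw [Eigenbasis.crossEntropy, Eigenbasis.crossEntropy]
  have hη : ENNReal.ofReal (Real.negMulLog w) =
      ∑' j, quadForm A (F.basis j) * ENNReal.ofReal (-Real.log w) := by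
    rw [ENNReal.tsum_mul_right, ← opTrace_eq_tsum hA.1 F.basis, hwA, ← ENNReal.ofReal_mul hw0,
      Real.negMulLog]
    congr 1
    ring
  rw [hη, ← ENNReal.tsum_add]
  refine ENNReal.tsum_le_tsum fun j => ?_
  rw [← mul_add]
  change quadForm A (F.basis j) * negLog (w * F.eigenvalue j) ≤ _
  rcases hw0.eq_or_lt with hw0 | hw0
  · rw [← hw0, ENNReal.ofReal_zero, opTrace_eq_tsum hA.1 F.basis, ENNReal.tsum_eq_zero] at hwA
    simp [hwA j]
  gcongr
  rw [negLog, negLog]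
  obtain ⟨hx, hx1⟩ := hB.eigenvalue_mem F j
  by_cases hj : F.eigenvalue j = 0
  · simp [hj]
  rw [if_neg hj, if_neg (by positivity), Real.log_mul hw0.ne' hj, ← ENNReal.ofReal_add]
  · apply le_of_eq; congr 1; ring
  · have := Real.log_nonpos hx hx1; linarith
  · have := Real.log_nonpos hw0.le hw1; linarith

end Entropy

/-! ### A tangent inequality for the relative entropy -/

section Tangent

open Filter Topology intervalIntegral

theorem one_add_mul_sub_pos {c s : ℝ} (hc : 0 < c) (hs : s ∈ Set.Icc (0 : ℝ) 1) :
    0 < 1 + s * (c - 1) := by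
  obtain ⟨h0, h1⟩ := hs
  rcases h0.eq_or_lt with rfl | h0
  · norm_num
  · nlinarith [mul_pos h0 hc]

/-- The optimal parameter in the variational form of the integrand of the relative entropy. -/
noncomputable def tangentParam (c s : ℝ) : ℝ := (c - 1) / (1 + s * (c - 1))

theorem continuousOn_tangentParam {c : ℝ} (hc : 0 < c) :
    ContinuousOn (tangentParam c) (Set.Icc 0 1) :=
  ContinuousOn.div (by fun_prop) (by fun_prop) fun _ hs => (one_add_mul_sub_pos hc hs).ne'

theorem integral_tangentParam_left {c : ℝ} (hc : 0 < c) :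
    ∫ s in (0 : ℝ)..1, (1 - s) * (2 * tangentParam c s - s * tangentParam c s ^ 2) =
      Real.log c := by
  have hz := continuousOn_tangentParam hc
  rw [← Set.uIcc_of_le zero_le_one] at hz
  rw [integral_eq_sub_of_hasDerivAt
    (f := fun s => c * (s / (1 + s * (c - 1))) + Real.log (1 + s * (c - 1)) - s)]
  · simp [hc.ne']
  · intro s hs
    rw [Set.uIcc_of_le zero_le_one] at hs
    have hw := (one_add_mul_sub_pos hc hs).ne'
    have hd : HasDerivAt (fun s : ℝ => 1 + s * (c - 1)) (c - 1) s := by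
      simpa using ((hasDerivAt_id s).mul_const (c - 1)).const_add 1
    have := ((((hasDerivAt_id s).div hd hw).const_mul c).add (hd.log hw)).sub (hasDerivAt_id s)
    refine this.congr_deriv ?_
    simp only [tangentParam, id]
    field_simp
    ring
  · exact ContinuousOn.intervalIntegrable (by fun_prop)

theorem integral_tangentParam_right {c : ℝ} (hc : 0 < c) :
    ∫ s in (0 : ℝ)..1, (1 - s) * (2 * tangentParam c s + (1 - s) * tangentParam c s ^ 2) =
      c - 1 := by
  have hz := continuousOn_tangentParam hc
  rw [← Set.uIcc_of_le zero_le_one] at hz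
  rw [integral_eq_sub_of_hasDerivAt (f := fun s => c ^ 2 * (s / (1 + s * (c - 1))) - s)]
  · simp only [one_mul, add_sub_cancel, zero_mul, add_zero, zero_div, mul_zero, sub_zero]
    field_simp
  · intro s hs
    rw [Set.uIcc_of_le zero_le_one] at hs
    have hw := (one_add_mul_sub_pos hc hs).ne'
    have hd : HasDerivAt (fun s : ℝ => 1 + s * (c - 1)) (c - 1) s := by
      simpa using ((hasDerivAt_id s).mul_const (c - 1)).const_add 1
    have := (((hasDerivAt_id s).div hd hw).const_mul (c ^ 2)).sub (hasDerivAt_id s)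
    refine this.congr_deriv ?_
    simp only [tangentParam, id]
    field_simp
    ring
  · exact ContinuousOn.intervalIntegrable (by fun_prop)

/-- The integral formula `x log (x / y) + y - x = ∫ (1 - s) (x - y)² / (s x + (1 - s) y) ds`. -/
theorem integral_klTerm {x y : ℝ} (hx : 0 < x) (hy : 0 < y) :
    ∫ s in (0 : ℝ)..1, (1 - s) * (x - y) ^ 2 / (y + s * (x - y)) =
      x * Real.log (x / y) + y - x := by
  have hpos : ∀ s ∈ Set.uIcc (0 : ℝ) 1, 0 < y + s * (x - y) := by
    intro s hs
    rw [Set.uIcc_of_le zero_le_one] at hs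
    have := one_add_mul_sub_pos (div_pos hx hy) hs
    have h2 : y + s * (x - y) = y * (1 + s * (x / y - 1)) := by field_simp
    rw [h2]
    positivity
  rw [integral_eq_sub_of_hasDerivAt
    (f := fun s => x * Real.log (y + s * (x - y)) - (y + s * (x - y)))]
  · rw [Real.log_div hx.ne' hy.ne']
    simp
    ring
  · intro s hs
    have hw := (hpos s hs).ne'
    have hd : HasDerivAt (fun s : ℝ => y + s * (x - y)) (x - y) s := by
      simpa using ((hasDerivAt_id s).mul_const (x - y)).const_add y
    have := ((hd.log hw).const_mul x).sub hd
    refine this.congr_deriv ?_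
    rw [eq_div_iff hw, sub_mul, mul_div_assoc', div_mul_cancel₀ _ hw]
    ring
  · refine ContinuousOn.intervalIntegrable ?_
    exact ContinuousOn.div (by fun_prop) (by fun_prop) fun s hs => (hpos s hs).ne'

/-- The coefficient of `x` in the mixed term of the tangent inequality. -/
noncomputable def mixedCoeffLeft (c d : ℝ) : ℝ :=
  ∫ s in (0 : ℝ)..1, (1 - s) * (tangentParam c s + tangentParam d s -
    s * (tangentParam c s * tangentParam d s))

/-- The coefficient of `-y` in the mixed term of the tangent inequality. -/
noncomputable def mixedCoeffRight (c d : ℝ) : ℝ :=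
  ∫ s in (0 : ℝ)..1, (1 - s) * (tangentParam c s + tangentParam d s +
    (1 - s) * (tangentParam c s * tangentParam d s))

theorem tangent_le_of_pos {c d x y : ℝ} (hc : 0 < c) (hd : 0 < d) (hx : 0 < x) (hy : 0 < y)
    (a b : ℝ) :
    a ^ 2 * (x * Real.log c - y * (c - 1)) + b ^ 2 * (x * Real.log d - y * (d - 1)) +
      2 * a * b * (x * mixedCoeffLeft c d - y * mixedCoeffRight c d) ≤
    (a + b) ^ 2 * (x * Real.log (x / y) + y - x) := by
  have hzc := continuousOn_tangentParam hc
  have hzd := continuousOn_tangentParam hd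
  rw [← Set.uIcc_of_le zero_le_one] at hzc hzd
  have hpos : ∀ s ∈ Set.Icc (0 : ℝ) 1, 0 < y + s * (x - y) := by
    intro s hs
    have := one_add_mul_sub_pos (div_pos hx hy) hs
    have h2 : y + s * (x - y) = y * (1 + s * (x / y - 1)) := by field_simp
    rw [h2]
    positivity
  have i1 : IntervalIntegrable (fun s : ℝ => (1 - s) * (2 * tangentParam c s -
      s * tangentParam c s ^ 2)) MeasureTheory.volume 0 1 :=
    ContinuousOn.intervalIntegrable (by fun_prop)
  have i2 : IntervalIntegrable (fun s : ℝ => (1 - s) * (2 * tangentParam c s +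
      (1 - s) * tangentParam c s ^ 2)) MeasureTheory.volume 0 1 :=
    ContinuousOn.intervalIntegrable (by fun_prop)
  have i3 : IntervalIntegrable (fun s : ℝ => (1 - s) * (2 * tangentParam d s -
      s * tangentParam d s ^ 2)) MeasureTheory.volume 0 1 :=
    ContinuousOn.intervalIntegrable (by fun_prop)
  have i4 : IntervalIntegrable (fun s : ℝ => (1 - s) * (2 * tangentParam d s +
      (1 - s) * tangentParam d s ^ 2)) MeasureTheory.volume 0 1 :=
    ContinuousOn.intervalIntegrable (by fun_prop)
  have i5 : IntervalIntegrable (fun s : ℝ => (1 - s) * (tangentParam c s + tangentParam d s -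
      s * (tangentParam c s * tangentParam d s))) MeasureTheory.volume 0 1 :=
    ContinuousOn.intervalIntegrable (by fun_prop)
  have i6 : IntervalIntegrable (fun s : ℝ => (1 - s) * (tangentParam c s + tangentParam d s +
      (1 - s) * (tangentParam c s * tangentParam d s))) MeasureTheory.volume 0 1 :=
    ContinuousOn.intervalIntegrable (by fun_prop)
  have j1 := ((i1.const_mul x).sub (i2.const_mul y)).const_mul (a ^ 2)
  have j2 := ((i3.const_mul x).sub (i4.const_mul y)).const_mul (b ^ 2)
  have j3 := ((i5.const_mul x).sub (i6.const_mul y)).const_mul (2 * a * b)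
  rw [← integral_tangentParam_left hc, ← integral_tangentParam_right hc,
    ← integral_tangentParam_left hd, ← integral_tangentParam_right hd, mixedCoeffLeft,
    mixedCoeffRight, ← integral_klTerm hx hy]
  simp only [← integral_const_mul]
  rw [← integral_sub (i1.const_mul x) (i2.const_mul y),
    ← integral_sub (i3.const_mul x) (i4.const_mul y),
    ← integral_sub (i5.const_mul x) (i6.const_mul y)]
  simp only [← integral_const_mul]
  rw [← integral_add j1 j2, ← integral_add (j1.add j2) j3]
  refine integral_mono_on zero_le_one ((j1.add j2).add j3) ?_ fun s hs => ?_
  · refine ContinuousOn.intervalIntegrable (ContinuousOn.mul continuousOn_const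
      (ContinuousOn.div (by fun_prop) (by fun_prop) fun s hs => ?_))
    rw [Set.uIcc_of_le zero_le_one] at hs
    exact (hpos s hs).ne'
  · -- completing the square
    have hw := hpos s hs
    have hs1 : 0 ≤ 1 - s := sub_nonneg.mpr hs.2
    have : 0 ≤ (1 - s) / (y + s * (x - y)) * ((x - y) * (a + b) -
        (y + s * (x - y)) * (tangentParam c s * a + tangentParam d s * b)) ^ 2 := by positivity
    have h2 : (1 - s) / (y + s * (x - y)) * ((x - y) * (a + b) -
        (y + s * (x - y)) * (tangentParam c s * a + tangentParam d s * b)) ^ 2 =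
        (a + b) ^ 2 * ((1 - s) * (x - y) ^ 2 / (y + s * (x - y))) -
        (1 - s) * (2 * (x - y) * (a + b) * (tangentParam c s * a + tangentParam d s * b) -
        (y + s * (x - y)) * (tangentParam c s * a + tangentParam d s * b) ^ 2) := by
      field_simp
      ring
    rw [h2] at this
    linarith

theorem tangent_le_real {c d x y a b : ℝ} (hc : 0 < c) (hd : 0 < d) (hx : 0 ≤ x) (hy : 0 ≤ y)
    (hxy : y = 0 → x = 0 ∨ a + b = 0) :
    a ^ 2 * (x * Real.log c - y * (c - 1)) + b ^ 2 * (x * Real.log d - y * (d - 1)) +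
      2 * a * b * (x * mixedCoeffLeft c d - y * mixedCoeffRight c d) ≤
    (a + b) ^ 2 * (x * Real.log (x / y) + y - x) := by
  rcases hy.eq_or_lt with rfl | hy
  · rcases hx.eq_or_lt with rfl | hx
    · simp
    have hab := (hxy rfl).resolve_left hx.ne'
    -- the left-hand side is continuous in `y ≥ 0`, the right-hand side vanishes
    have h1 : Tendsto (fun y : ℝ => a ^ 2 * (x * Real.log c - y * (c - 1)) +
        b ^ 2 * (x * Real.log d - y * (d - 1)) +
        2 * a * b * (x * mixedCoeffLeft c d - y * mixedCoeffRight c d)) (𝓝[>] 0)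
        (𝓝 (a ^ 2 * (x * Real.log c - 0 * (c - 1)) + b ^ 2 * (x * Real.log d - 0 * (d - 1)) +
        2 * a * b * (x * mixedCoeffLeft c d - 0 * mixedCoeffRight c d))) :=
      (Continuous.tendsto (by fun_prop) 0).mono_left nhdsWithin_le_nhds
    rw [hab, zero_pow two_ne_zero, zero_mul (_ + _ - _)]
    refine le_of_tendsto h1 ?_
    filter_upwards [self_mem_nhdsWithin] with y hy
    have := tangent_le_of_pos hc hd hx hy a b
    rwa [hab, zero_pow two_ne_zero, zero_mul (_ + _ - _)] at this
  rcases hx.eq_or_lt with rfl | hx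
  · -- both sides are continuous in `x ≥ 0`
    have h1 : Tendsto (fun x : ℝ => a ^ 2 * (x * Real.log c - y * (c - 1)) +
        b ^ 2 * (x * Real.log d - y * (d - 1)) +
        2 * a * b * (x * mixedCoeffLeft c d - y * mixedCoeffRight c d)) (𝓝[>] 0)
        (𝓝 (a ^ 2 * (0 * Real.log c - y * (c - 1)) + b ^ 2 * (0 * Real.log d - y * (d - 1)) +
        2 * a * b * (0 * mixedCoeffLeft c d - y * mixedCoeffRight c d))) :=
      (Continuous.tendsto (by fun_prop) 0).mono_left nhdsWithin_le_nhds
    have h2 : Tendsto (fun x : ℝ => (a + b) ^ 2 * (x * Real.log x - x * Real.log y + y - x))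
        (𝓝[>] 0) (𝓝 ((a + b) ^ 2 * (0 * Real.log 0 - 0 * Real.log y + y - 0))) := by
      refine Tendsto.mono_left (Continuous.tendsto ?_ 0) nhdsWithin_le_nhds
      have := Real.continuous_mul_log
      fun_prop
    have := le_of_tendsto_of_tendsto h1 h2 (by
      filter_upwards [self_mem_nhdsWithin] with x hx
      have := tangent_le_of_pos hc hd hx hy a b
      rw [Real.log_div (ne_of_gt hx) hy.ne'] at this
      linarith)
    simpa using this
  · exact tangent_le_of_pos hc hd hx hy a b

/-- A lower bound for `|u + v|² (x log (x / y) + y - x)` by a quadratic form in `u, v` that is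
linear in `x, y`. -/
theorem tangent_le {c d x y : ℝ} {u v : ℂ} (hc : 0 < c) (hd : 0 < d) (hx : 0 ≤ x) (hy : 0 ≤ y)
    (hxy : y = 0 → x = 0 ∨ u + v = 0) :
    ‖u‖ ^ 2 * (x * Real.log c - y * (c - 1)) + ‖v‖ ^ 2 * (x * Real.log d - y * (d - 1)) +
      (‖u + v‖ ^ 2 - ‖u‖ ^ 2 - ‖v‖ ^ 2) * (x * mixedCoeffLeft c d - y * mixedCoeffRight c d) ≤
    ‖u + v‖ ^ 2 * (x * Real.log (x / y) + y - x) := by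
  have h1 := tangent_le_real (a := u.re) (b := v.re) hc hd hx hy fun h =>
    (hxy h).imp_right fun h => by simpa using congrArg Complex.re h
  have h2 := tangent_le_real (a := u.im) (b := v.im) hc hd hx hy fun h =>
    (hxy h).imp_right fun h => by simpa using congrArg Complex.im h
  simp only [← Complex.normSq_eq_norm_sq, Complex.normSq_apply, Complex.add_re, Complex.add_im]
  linarith

end Tangent

/-! ### Relative entropy and two-outcome measurements -/

section Measurement

variable {H : Type*} [NormedAddCommGroup H] [InnerProductSpace ℂ H] [CompleteSpace H]
  {A B N P Q : H →L[ℂ] H}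

theorem IsStarProjection.inner_left (hQ : IsStarProjection Q) (v w : H) :
    inner ℂ (Q v) w = inner ℂ v (Q w) :=
  hQ.isSelfAdjoint.isSymmetric v w

theorem IsStarProjection.conj_isPositive (hQ : IsStarProjection Q) (hA : A.IsPositive) :
    (Q * A * Q).IsPositive := by
  have := hA.conj_adjoint Q
  rw [hQ.isSelfAdjoint.adjoint_eq] at this
  exact this

theorem IsStarProjection.quadForm_conj (hQ : IsStarProjection Q) (A : H →L[ℂ] H) (v : H) :
    quadForm (Q * A * Q) v = quadForm A (Q v) := by
  rw [quadForm, quadForm, mul_apply_eq_comp, mul_apply_eq_comp, hQ.inner_left]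

theorem IsStarProjection.norm_sq_add (hQ : IsStarProjection Q) (v : H) :
    ‖Q v‖ ^ 2 + ‖(1 - Q) v‖ ^ 2 = ‖v‖ ^ 2 := by
  have h : inner ℂ (Q v) ((1 - Q) v) = 0 := by
    rw [hQ.inner_left, ← mul_apply_eq_comp, mul_sub, mul_one, hQ.isIdempotentElem.eq, sub_self]
    simp
  have h2 := norm_add_sq_eq_norm_sq_add_norm_sq_of_inner_eq_zero (Q v) ((1 - Q) v) h
  rw [show Q v + (1 - Q) v = v by simp] at h2
  linarith

theorem opTrace_conj (hQ : IsStarProjection Q) (hA : A.IsPositive) (E : Eigenbasis A) {ι : Type*}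
    (b : HilbertBasis ι ℂ H) : opTrace (Q * A * Q) =
      ∑' i, ∑' j, ENNReal.ofReal (E.eigenvalue i * ‖inner ℂ (E.basis i) (Q (b j))‖ ^ 2) := by
  rw [opTrace_eq_tsum (hQ.conj_isPositive hA) b, ENNReal.tsum_comm]
  refine tsum_congr fun j => ?_
  rw [hQ.quadForm_conj, E.quadForm_eq_tsum hA]
  exact tsum_congr fun i => (ENNReal.ofReal_mul (E.eigenvalue_nonneg hA i)).symm

theorem opTrace_conj_eq_tsum (hQ : IsStarProjection Q) (hA : A.IsPositive) (E : Eigenbasis A) :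
    opTrace (Q * A * Q) = ∑' i, ENNReal.ofReal (E.eigenvalue i * ‖Q (E.basis i)‖ ^ 2) := by
  rw [opTrace_conj hQ hA E E.basis]
  refine tsum_congr fun i => ?_
  simp_rw [ENNReal.ofReal_mul (E.eigenvalue_nonneg hA i), ENNReal.tsum_mul_left, ← hQ.inner_left]
  rw [E.basis.tsum_ofReal_norm_inner_sq']

theorem opTrace_conj_add (hQ : IsStarProjection Q) (hA : A.IsPositive) (E : Eigenbasis A) :
    opTrace (Q * A * Q) + opTrace ((1 - Q) * A * (1 - Q)) = opTrace A := by
  rw [opTrace_conj_eq_tsum hQ hA E, opTrace_conj_eq_tsum hQ.one_sub hA E, E.opTrace_eq hA,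
    ← ENNReal.tsum_add]
  refine tsum_congr fun i => ?_
  have h := E.eigenvalue_nonneg hA i
  rw [← ENNReal.ofReal_add (by positivity) (by positivity), ← mul_add, hQ.norm_sq_add,
    E.norm_basis, one_pow, mul_one]

theorem IsSubstate.conj_ne_top (hQ : IsStarProjection Q) (hA : IsSubstate A) :
    opTrace (Q * A * Q) ≠ ⊤ := by
  refine ne_top_of_le_ne_top hA.ne_top ?_
  rw [← opTrace_conj_add hQ hA.1 hA.eigenbasis]
  exact le_self_add

theorem hasSum_toReal_of_tsum_ofReal {ι κ : Type*} {f : ι → κ → ℝ} (hf : ∀ i j, 0 ≤ f i j)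
    {a : ℝ≥0∞} (ha : a ≠ ⊤) (h : a = ∑' i, ∑' j, ENNReal.ofReal (f i j)) :
    HasSum (fun p : ι × κ => f p.1 p.2) a.toReal := by
  rw [← ENNReal.tsum_prod (f := fun i j => ENNReal.ofReal (f i j))] at h
  subst h
  have h1 := ENNReal.summable_toReal ha
  rw [ENNReal.tsum_toReal_eq (fun p => ENNReal.ofReal_ne_top)]
  convert h1.hasSum using 1
  ext p
  rw [ENNReal.toReal_ofReal (hf _ _)]

theorem hasSum_opTrace_conj_left (hQ : IsStarProjection Q) (hA : IsSubstate A) (E : Eigenbasis A)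
    (F : Eigenbasis B) :
    HasSum (fun p : E.index × F.index =>
      ‖inner ℂ (E.basis p.1) (Q (F.basis p.2))‖ ^ 2 * E.eigenvalue p.1)
      (opTrace (Q * A * Q)).toReal := by
  refine hasSum_toReal_of_tsum_ofReal (f := fun i j =>
    ‖inner ℂ (E.basis i) (Q (F.basis j))‖ ^ 2 * E.eigenvalue i)
    (fun i j => mul_nonneg (sq_nonneg _) (E.eigenvalue_nonneg hA.1 i))
    (hA.conj_ne_top hQ) ?_
  rw [opTrace_conj hQ hA.1 E F.basis]
  simp_rw [mul_comm]

theorem hasSum_opTrace_conj_right (hQ : IsStarProjection Q) (hB : IsSubstate B) (E : Eigenbasis A)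
    (F : Eigenbasis B) :
    HasSum (fun p : E.index × F.index =>
      ‖inner ℂ (E.basis p.1) (Q (F.basis p.2))‖ ^ 2 * F.eigenvalue p.2)
      (opTrace (Q * B * Q)).toReal := by
  refine hasSum_toReal_of_tsum_ofReal (f := fun i j =>
    ‖inner ℂ (E.basis i) (Q (F.basis j))‖ ^ 2 * F.eigenvalue j)
    (fun i j => mul_nonneg (sq_nonneg _) (F.eigenvalue_nonneg hB.1 j))
    (hB.conj_ne_top hQ) ?_
  rw [opTrace_conj hQ hB.1 F E.basis, ENNReal.tsum_comm]
  refine tsum_congr fun i => tsum_congr fun j => ?_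
  rw [← hQ.inner_left, norm_inner_symm, mul_comm]

/-- The relative entropy dominates the one of the outcome distributions of the measurement
`{Q, 1 - Q}`, in the variational form with free parameters `c, d > 0`. -/
theorem ofReal_le_relEnt (hQ : IsStarProjection Q) (hA : IsSubstate A) (hB : IsSubstate B)
    (E : Eigenbasis A) (F : Eigenbasis B) {c d : ℝ} (hc : 0 < c) (hd : 0 < d) :
    ENNReal.ofReal ((opTrace (Q * A * Q)).toReal * Real.log c -
      (opTrace (Q * B * Q)).toReal * (c - 1) +
      ((opTrace ((1 - Q) * A * (1 - Q))).toReal * Real.log d -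
      (opTrace ((1 - Q) * B * (1 - Q))).toReal * (d - 1))) ≤ Eigenbasis.relEnt E F := by
  by_cases htop : Eigenbasis.relEnt E F = ⊤
  · rw [htop]; exact le_top
  refine ENNReal.ofReal_le_of_le_toReal ?_
  have h1 := hasSum_opTrace_conj_left (Q := 1) (.one _) hA E F
  have h2 := hasSum_opTrace_conj_right (Q := 1) (.one _) hB E F
  have h3 := hasSum_opTrace_conj_left hQ hA E F
  have h4 := hasSum_opTrace_conj_right hQ hB E F
  have h5 := hasSum_opTrace_conj_left hQ.one_sub hA E F
  have h6 := hasSum_opTrace_conj_right hQ.one_sub hB E F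
  have hsum := (((h3.mul_right (Real.log c)).sub (h4.mul_right (c - 1))).add
    ((h5.mul_right (Real.log d)).sub (h6.mul_right (d - 1)))).add
    ((((h1.sub h3).sub h5).mul_right (mixedCoeffLeft c d)).sub
      (((h2.sub h4).sub h6).mul_right (mixedCoeffRight c d)))
  -- the mixed terms sum up to zero
  have hA' : (opTrace (1 * A * 1)).toReal - (opTrace (Q * A * Q)).toReal -
      (opTrace ((1 - Q) * A * (1 - Q))).toReal = 0 := by
    rw [one_mul, mul_one, ← opTrace_conj_add hQ hA.1 E,
      ENNReal.toReal_add (hA.conj_ne_top hQ) (hA.conj_ne_top hQ.one_sub)]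
    ring
  have hB' : (opTrace (1 * B * 1)).toReal - (opTrace (Q * B * Q)).toReal -
      (opTrace ((1 - Q) * B * (1 - Q))).toReal = 0 := by
    rw [one_mul, mul_one, ← opTrace_conj_add hQ hB.1 F,
      ENNReal.toReal_add (hB.conj_ne_top hQ) (hB.conj_ne_top hQ.one_sub)]
    ring
  rw [hA', hB', zero_mul, zero_mul, sub_zero, add_zero] at hsum
  have htop' := htop
  rw [Eigenbasis.relEnt, ← ENNReal.tsum_prod (f := fun i j =>
    ENNReal.ofReal (‖inner ℂ (E.basis i) (F.basis j)‖ ^ 2) *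
      klTerm (E.eigenvalue i) (F.eigenvalue j))] at htop' ⊢
  have hfin := fun p => ENNReal.ne_top_of_tsum_ne_top htop' p
  rw [ENNReal.tsum_toReal_eq hfin]
  refine hasSum_le (fun p => ?_) hsum (ENNReal.summable_toReal htop').hasSum
  obtain ⟨i, j⟩ := p
  have hx := E.eigenvalue_nonneg hA.1 i
  have hy := F.eigenvalue_nonneg hB.1 j
  have huv : inner ℂ (E.basis i) (Q (F.basis j)) + inner ℂ (E.basis i) ((1 - Q) (F.basis j)) =
      inner ℂ (E.basis i) (F.basis j) := by
    rw [← inner_add_right]; simp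
  have hzero : F.eigenvalue j = 0 → E.eigenvalue i = 0 ∨
      inner ℂ (E.basis i) (Q (F.basis j)) + inner ℂ (E.basis i) ((1 - Q) (F.basis j)) = 0 := by
    intro hy0
    by_contra! hcon
    rw [huv] at hcon
    have := hfin (i, j)
    simp only [klTerm, if_neg hcon.1, if_pos hy0] at this
    refine this (ENNReal.mul_top ?_)
    have := norm_pos_iff.mpr hcon.2
    simp only [ne_eq, ENNReal.ofReal_eq_zero, not_le]
    positivity
  have ht := tangent_le hc hd hx hy hzero
  rw [huv] at ht
  have hkl : ‖inner ℂ (E.basis i) (F.basis j)‖ ^ 2 * (E.eigenvalue i *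
      Real.log (E.eigenvalue i / F.eigenvalue j) + F.eigenvalue j - E.eigenvalue i) ≤
      (ENNReal.ofReal (‖inner ℂ (E.basis i) (F.basis j)‖ ^ 2) *
      klTerm (E.eigenvalue i) (F.eigenvalue j)).toReal := by
    rw [ENNReal.toReal_mul, ENNReal.toReal_ofReal (sq_nonneg _)]
    by_cases hx0 : E.eigenvalue i = 0
    · simp [klTerm, hx0, hy]
    by_cases hy0 : F.eigenvalue j = 0
    · have := (hzero hy0).resolve_left hx0
      rw [huv] at this
      simp [this]
    rw [klTerm, if_neg hx0, if_neg hy0]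
    gcongr
    rw [ENNReal.toReal_ofReal']
    exact le_max_left _ _
  refine le_trans (le_of_eq ?_) (ht.trans hkl)
  simp only [one_apply_eq_self]
  ring

end Measurement

/-! ### The entropy inequality for a pair of states -/

section Fundamental

open Filter Topology

variable {H : Type*} [NormedAddCommGroup H] [InnerProductSpace ℂ H] [CompleteSpace H]
  {A B N P Q : H →L[ℂ] H}

theorem eq_zero_of_opTrace (hA : A.IsPositive) (h : opTrace A = 0) : A = 0 := by
  have := norm_le_of_opTrace hA (by simp [h])
  rw [h, ENNReal.toReal_zero] at this
  exact norm_le_zero_iff.mp this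

theorem vnEntropy_zero : vnEntropy (0 : H →L[ℂ] H) = 0 := by
  have h0 : IsSubstate (0 : H →L[ℂ] H) :=
    ⟨ContinuousLinearMap.isPositive_zero, by simp [opTrace_zero]⟩
  have := vnEntropy_smul h0 le_rfl zero_le_one
  simpa [opTrace_zero] using this

/-- Superadditivity of the entropy up to the binary entropy, for `A + N` with `N` supported in the
range of a projection `Q` with `Tr Q A ≤ 1 - ε`, `ε = Tr N`. All operators are halved so that the
traces are at most one. -/
theorem vnEntropy_half_add_le {ε : ℝ} (hε0 : 0 < ε) (hε1 : ε ≤ 1) (hA : IsState A)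
    (hN : N.IsPositive) (hNt : opTrace N = ENNReal.ofReal ε) (hQ : IsStarProjection Q)
    (hQN : Q * N * Q = N) (hQA : opTrace (Q * A * Q) ≤ ENNReal.ofReal (1 - ε)) :
    vnEntropy (((1 / 2 : ℝ) : ℂ) • A) + vnEntropy (((1 / 2 : ℝ) : ℂ) • N) ≤
      vnEntropy (((1 / 2 : ℝ) : ℂ) • (A + N)) + ENNReal.ofReal (Real.binEntropy ε / 2) := by
  set A' := ((1 / 2 : ℝ) : ℂ) • A with hA'
  set N' := ((1 / 2 : ℝ) : ℂ) • N with hN'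
  have hh : (0 : ℝ) ≤ 1 / 2 := by norm_num
  have hNs : IsSubstate N := ⟨hN, by rw [hNt]; simpa using hε1⟩
  have hAs' : IsSubstate A' := hA.isSubstate.smul hh (by norm_num)
  have hNs' : IsSubstate N' := hNs.smul hh (by norm_num)
  have htA' : opTrace A' = ENNReal.ofReal (1 / 2) := by
    rw [hA', opTrace_smul hh hA.1, hA.2, mul_one]
  have htN' : opTrace N' = ENNReal.ofReal (ε / 2) := by
    rw [hN', opTrace_smul hh hN, hNt, ← ENNReal.ofReal_mul hh]; congr 1; ring
  have htT : opTrace (A' + N') = ENNReal.ofReal ((1 + ε) / 2) := by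
    rw [opTrace_add hAs'.1 hNs'.1, htA', htN', ← ENNReal.ofReal_add hh (by positivity)]
    congr 1; ring
  have hT : IsSubstate (A' + N') := by
    refine ⟨hAs'.1.add hNs'.1, ?_⟩
    rw [htT, ← ENNReal.ofReal_one]
    exact ENNReal.ofReal_le_ofReal (by linarith)
  rw [smul_add, ← hA', ← hN']
  -- the traces of the two blocks
  set a := (opTrace (Q * A' * Q)).toReal with ha
  have ha0 : 0 ≤ a := ENNReal.toReal_nonneg
  have ha1 : a ≤ (1 - ε) / 2 := by
    rw [ha, hA', mul_smul_comm, smul_mul_assoc, opTrace_smul hh (hQ.conj_isPositive hA.1)]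
    refine ENNReal.toReal_le_of_le_ofReal (by linarith) ?_
    calc _ ≤ ENNReal.ofReal (1 / 2) * ENNReal.ofReal (1 - ε) := by gcongr
      _ = _ := by rw [← ENNReal.ofReal_mul hh]; congr 1; ring
  have hA2 : (opTrace ((1 - Q) * A' * (1 - Q))).toReal = 1 / 2 - a := by
    have := opTrace_conj_add hQ hAs'.1 hAs'.eigenbasis
    rw [htA'] at this
    have := congrArg ENNReal.toReal this
    rw [ENNReal.toReal_add (hAs'.conj_ne_top hQ) (hAs'.conj_ne_top hQ.one_sub),
      ENNReal.toReal_ofReal hh] at this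
    linarith
  have hQN' : Q * N' * Q = N' := by rw [hN', mul_smul_comm, smul_mul_assoc, hQN]
  have hN1 : (opTrace (Q * N' * Q)).toReal = ε / 2 := by
    rw [hQN', htN', ENNReal.toReal_ofReal (by positivity)]
  have hN0 : (1 - Q) * N' * (1 - Q) = 0 := by
    have : (1 - Q) * N' = 0 := by
      rw [← hQN', ← mul_assoc, ← mul_assoc, sub_mul, one_mul, hQ.isIdempotentElem.eq, sub_self]
      simp
    rw [this, zero_mul]
  have hN2 : (opTrace ((1 - Q) * N' * (1 - Q))).toReal = 0 := by rw [hN0, opTrace_zero]; rfl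
  have hconj : ∀ {R : H →L[ℂ] H}, IsStarProjection R →
      (opTrace (R * (A' + N') * R)).toReal =
        (opTrace (R * A' * R)).toReal + (opTrace (R * N' * R)).toReal := by
    intro R hR
    rw [mul_add, add_mul, opTrace_add (hR.conj_isPositive hAs'.1) (hR.conj_isPositive hNs'.1),
      ENNReal.toReal_add (hAs'.conj_ne_top hR) (hNs'.conj_ne_top hR)]
  have hT1 := hconj hQ
  have hT2 := hconj hQ.one_sub
  rw [hN1, ← ha] at hT1
  rw [hN2, hA2, add_zero] at hT2
  set ET := hT.eigenbasis
  -- the joint lower bound for the two relative entropies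
  have hlow : ENNReal.ofReal ((1 + ε - Real.binEntropy ε) / 2) ≤
      Eigenbasis.relEnt hAs'.eigenbasis ET + Eigenbasis.relEnt hNs'.eigenbasis ET := by
    by_cases htop : Eigenbasis.relEnt hAs'.eigenbasis ET + Eigenbasis.relEnt hNs'.eigenbasis ET = ⊤
    · rw [htop]; exact le_top
    obtain ⟨hf1, hf2⟩ := ENNReal.add_ne_top.mp htop
    refine ENNReal.ofReal_le_of_le_toReal ?_
    rw [ENNReal.toReal_add hf1 hf2]
    have hbound : ∀ δ ∈ Set.Ioo 0 ε, (1 - ε) / 2 * Real.log (1 - ε + δ) - (a + ε / 2) * (δ - ε) +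
        (ε / 2 * Real.log ε - (a + ε / 2) * (ε - 1) - (1 / 2 - a) * (δ - 1)) ≤
        (Eigenbasis.relEnt hAs'.eigenbasis ET).toReal +
          (Eigenbasis.relEnt hNs'.eigenbasis ET).toReal := by
      rintro δ ⟨hδ0, hδ1⟩
      -- for `Tr Q A = 1 - ε` the optimal parameters are `(1 - ε, 1)` and `(ε, 0)`;
      -- the shift by `δ` makes them positive
      have h1 := ofReal_le_relEnt hQ hAs' hT hAs'.eigenbasis ET
        (c := 1 - ε + δ) (d := 1) (by linarith) one_pos
      have h2 := ofReal_le_relEnt hQ hNs' hT hNs'.eigenbasis ET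
        (c := ε) (d := δ) hε0 hδ0
      rw [ENNReal.ofReal_le_iff_le_toReal hf1, hT1, hT2, ← ha, Real.log_one] at h1
      rw [ENNReal.ofReal_le_iff_le_toReal hf2, hT1, hT2, hN1, hN2] at h2
      have hlog : Real.log (1 - ε + δ) ≤ 0 := Real.log_nonpos (by linarith) (by linarith)
      nlinarith
    have hlim : Tendsto (fun δ => (1 - ε) / 2 * Real.log (1 - ε + δ) - (a + ε / 2) * (δ - ε) +
        (ε / 2 * Real.log ε - (a + ε / 2) * (ε - 1) - (1 / 2 - a) * (δ - 1))) (𝓝[>] 0)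
        (𝓝 ((1 - ε) / 2 * Real.log (1 - ε) - (a + ε / 2) * (0 - ε) +
        (ε / 2 * Real.log ε - (a + ε / 2) * (ε - 1) - (1 / 2 - a) * (0 - 1)))) := by
      have hl : Tendsto (fun δ => (1 - ε) / 2 * Real.log (1 - ε + δ)) (𝓝 0)
          (𝓝 ((1 - ε) / 2 * Real.log (1 - ε))) := by
        rcases hε1.eq_or_lt with rfl | hε1
        · simp
        · have : ContinuousAt (fun δ => Real.log (1 - ε + δ)) 0 :=
            (Real.continuousAt_log (by simp only [add_zero]; linarith)).comp' (by fun_prop)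
          have := this.tendsto.const_mul ((1 - ε) / 2)
          simpa using this
      refine Tendsto.mono_left ?_ nhdsWithin_le_nhds
      refine (hl.sub (Continuous.tendsto' (by fun_prop) _ _ rfl)).add
        (Continuous.tendsto' (by fun_prop) _ _ rfl)
    have := le_of_tendsto hlim (Filter.eventually_of_mem (Ioo_mem_nhdsGT hε0) hbound)
    refine le_trans (le_of_eq ?_) this
    rw [Real.binEntropy_eq_negMulLog_add_negMulLog_one_sub, Real.negMulLog, Real.negMulLog]
    ring
  have e1 := Eigenbasis.relEnt_add hAs' hT hAs'.eigenbasis ET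
  have e2 := Eigenbasis.relEnt_add hNs' hT hNs'.eigenbasis ET
  have e3 : ET.crossEntropy A' + ET.crossEntropy N' = vnEntropy (A' + N') := by
    rw [← ET.crossEntropy_add hAs'.1 hNs'.1, ET.crossEntropy_self hT]
  have hb0 : 0 ≤ Real.binEntropy ε := Real.binEntropy_nonneg hε0.le hε1
  have hb1 : Real.binEntropy ε ≤ 1 :=
    Real.binEntropy_le_log_two.trans (Real.log_two_lt_d9.le.trans (by norm_num))
  have hfin : ENNReal.ofReal (1 + ε) ≠ ⊤ := ENNReal.ofReal_ne_top
  rw [← ENNReal.add_le_add_iff_right hfin]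
  calc vnEntropy A' + vnEntropy N' + ENNReal.ofReal (1 + ε)
      = vnEntropy A' + vnEntropy N' + (ENNReal.ofReal ((1 + ε - Real.binEntropy ε) / 2) +
          ENNReal.ofReal (Real.binEntropy ε / 2) + (opTrace A' + opTrace N')) := by
        rw [htA', htN', ← ENNReal.ofReal_add (by linarith) (by linarith),
          ← ENNReal.ofReal_add hh (by linarith), ← ENNReal.ofReal_add (by linarith) (by linarith)]
        congr 2; ring
    _ ≤ vnEntropy A' + vnEntropy N' + ((Eigenbasis.relEnt hAs'.eigenbasis ET +
          Eigenbasis.relEnt hNs'.eigenbasis ET) +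
          ENNReal.ofReal (Real.binEntropy ε / 2) + (opTrace A' + opTrace N')) := by gcongr
    _ = (Eigenbasis.relEnt hAs'.eigenbasis ET + vnEntropy A' + opTrace A') +
        (Eigenbasis.relEnt hNs'.eigenbasis ET + vnEntropy N' + opTrace N') +
        ENNReal.ofReal (Real.binEntropy ε / 2) := by ring
    _ = (ET.crossEntropy A' + ET.crossEntropy N') + (opTrace (A' + N') + opTrace (A' + N')) +
        ENNReal.ofReal (Real.binEntropy ε / 2) := by rw [e1, e2]; ring
    _ = _ := by
        rw [e3, htT, ← ENNReal.ofReal_add (by linarith) (by linarith),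
          show (1 + ε) / 2 + (1 + ε) / 2 = 1 + ε by ring]
        ring

/-- The entropy inequality `S(A) + S(N) ≤ S(B) + S(P) + h(ε)` for states with
`A + N = B + P`, where the trace of `N` and `P` is `ε`, and `N`, `P` are separated by a
projection. -/
theorem vnEntropy_add_le_of_add_eq {ε : ℝ} (hε0 : 0 ≤ ε) (hε1 : ε ≤ 1) (hA : IsState A)
    (hB : IsState B) (hN : N.IsPositive) (hNt : opTrace N = ENNReal.ofReal ε) (hP : P.IsPositive)
    (hPt : opTrace P = ENNReal.ofReal ε) (hsum : A + N = B + P) (hQ : IsStarProjection Q)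
    (hQN : Q * N * Q = N) (hQA : opTrace (Q * A * Q) ≤ ENNReal.ofReal (1 - ε)) :
    vnEntropy A + vnEntropy N ≤ vnEntropy B + vnEntropy P + ENNReal.ofReal (Real.binEntropy ε) := by
  rcases hε0.eq_or_lt with rfl | hε0
  · have h1 := eq_zero_of_opTrace hN (by simpa using hNt)
    have h2 := eq_zero_of_opTrace hP (by simpa using hPt)
    rw [h1, h2, add_zero, add_zero] at hsum
    simp [h1, h2, hsum]
  have hh : (0 : ℝ) ≤ 1 / 2 := by norm_num
  have hh1 : (1 / 2 : ℝ) ≤ 1 := by norm_num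
  have hNs : IsSubstate N := ⟨hN, by rw [hNt]; simpa using hε1⟩
  have hPs : IsSubstate P := ⟨hP, by rw [hPt]; simpa using hε1⟩
  have h1 := vnEntropy_half_add_le hε0 hε1 hA hN hNt hQ hQN hQA
  have hBP : IsSubstate (((1 / 2 : ℝ) : ℂ) • (B + P)) := by
    refine ⟨isPositive_smul hh (hB.1.add hP), ?_⟩
    rw [opTrace_smul hh (hB.1.add hP), opTrace_add hB.1 hP, hB.2, hPt, ← ENNReal.ofReal_one,
      ← ENNReal.ofReal_add zero_le_one hε0.le, ← ENNReal.ofReal_mul hh]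
    exact ENNReal.ofReal_le_ofReal (by linarith)
  have h2 : vnEntropy (((1 / 2 : ℝ) : ℂ) • (B + P)) ≤
      vnEntropy (((1 / 2 : ℝ) : ℂ) • B) + vnEntropy (((1 / 2 : ℝ) : ℂ) • P) := by
    rw [smul_add] at hBP ⊢
    exact vnEntropy_add_le (isPositive_smul hh hB.1) (isPositive_smul hh hP) hBP
  rw [hsum] at h1
  have h3 := h1.trans (add_le_add_left h2 _)
  rw [vnEntropy_smul hA.isSubstate hh hh1, vnEntropy_smul hNs hh hh1,
    vnEntropy_smul hB.isSubstate hh hh1, vnEntropy_smul hPs hh hh1, hA.2, hB.2, hNt, hPt] at h3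
  set k := ENNReal.ofReal (Real.negMulLog (1 / 2))
  have hk : k * 1 + k * ENNReal.ofReal ε ≠ ⊤ := by
    simp only [k]
    finiteness
  have hbin : ENNReal.ofReal (Real.binEntropy ε / 2) =
      ENNReal.ofReal (1 / 2) * ENNReal.ofReal (Real.binEntropy ε) := by
    rw [← ENNReal.ofReal_mul hh]; congr 1; ring
  rw [hbin] at h3
  have h4 : ENNReal.ofReal (1 / 2) * (vnEntropy A + vnEntropy N) +
      (k * 1 + k * ENNReal.ofReal ε) ≤ ENNReal.ofReal (1 / 2) * (vnEntropy B + vnEntropy P +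
        ENNReal.ofReal (Real.binEntropy ε)) + (k * 1 + k * ENNReal.ofReal ε) := by
    refine le_trans (le_of_eq ?_) (h3.trans (le_of_eq ?_)) <;> ring
  rw [ENNReal.add_le_add_iff_right hk] at h4
  exact (ENNReal.mul_le_mul_iff_right (by simp) ENNReal.ofReal_ne_top).mp h4

end Fundamental

/-! ### The Jordan decomposition of the difference of two states -/

section Jordan

variable {H : Type*} [NormedAddCommGroup H] [InnerProductSpace ℂ H] [CompleteSpace H]
  {A B N P Q X : H →L[ℂ] H}

/-- The image of an eigenbasis of `A` under a unitary `u` is an eigenbasis of `u A u*`. -/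
noncomputable def Eigenbasis.conj (E : Eigenbasis A) (u : unitary (H →L[ℂ] H)) :
    Eigenbasis ((u : H →L[ℂ] H) * A * star (u : H →L[ℂ] H)) where
  index := E.index
  basis := HilbertBasis.ofRepr ((Unitary.linearIsometryEquiv u).symm.trans E.basis.repr)
  eigenvalue := E.eigenvalue
  apply_basis i := by
    classical
    have h : (HilbertBasis.ofRepr ((Unitary.linearIsometryEquiv u).symm.trans E.basis.repr) :
        HilbertBasis E.index ℂ H) i = (u : H →L[ℂ] H) (E.basis i) := by
      rw [← HilbertBasis.repr_symm_single, ← HilbertBasis.repr_symm_single]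
      rfl
    have h2 : (star (u : H →L[ℂ] H)) ((u : H →L[ℂ] H) (E.basis i)) = E.basis i := by
      rw [← mul_apply_eq_comp, Unitary.coe_star_mul_self, one_apply_eq_self]
    rw [h, mul_apply_eq_comp, mul_apply_eq_comp, h2, E.apply_basis, map_smul]

theorem isPositive_conj_unitary (hA : A.IsPositive) (u : unitary (H →L[ℂ] H)) :
    ((u : H →L[ℂ] H) * A * star (u : H →L[ℂ] H)).IsPositive :=
  hA.conj_adjoint (u : H →L[ℂ] H)

theorem opTrace_conj_unitary (hA : A.IsPositive) (E : Eigenbasis A) (u : unitary (H →L[ℂ] H)) :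
    opTrace ((u : H →L[ℂ] H) * A * star (u : H →L[ℂ] H)) = opTrace A := by
  rw [(E.conj u).opTrace_eq (isPositive_conj_unitary hA u), E.opTrace_eq hA]
  rfl

theorem vnEntropy_conj_unitary (hA : IsSubstate A) (u : unitary (H →L[ℂ] H)) :
    vnEntropy ((u : H →L[ℂ] H) * A * star (u : H →L[ℂ] H)) = vnEntropy A := by
  have hs : IsSubstate ((u : H →L[ℂ] H) * A * star (u : H →L[ℂ] H)) :=
    ⟨isPositive_conj_unitary hA.1 u, by rw [opTrace_conj_unitary hA.1 hA.eigenbasis]; exact hA.2⟩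
  rw [hs.vnEntropy_eq (hA.eigenbasis.conj u), hA.vnEntropy_eq hA.eigenbasis]
  rfl

/-- Operators below a compression of `A` have finite entropy if `A` has: the pinching
`Q A Q + (1 - Q) A (1 - Q)` is the mean of `A` and a unitary conjugate of `A`. -/
theorem vnEntropy_lt_top_of_le_conj (hQ : IsStarProjection Q) (hA : IsSubstate A)
    (hS : vnEntropy A < ⊤) (hX : X.IsPositive) (h : X ≤ Q * A * Q) : vnEntropy X < ⊤ := by
  let u : unitary (H →L[ℂ] H) := ⟨2 * Q - 1, hQ.two_mul_sub_one_mem_unitary⟩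
  have hh : (0 : ℝ) ≤ 1 / 2 := by norm_num
  have hh1 : (1 / 2 : ℝ) ≤ 1 := by norm_num
  have hus : star (u : H →L[ℂ] H) = u := by
    simp [u, hQ.isSelfAdjoint.star_eq, star_mul, Commute.eq (Commute.ofNat_left 2 Q)]
  set A₂ := (u : H →L[ℂ] H) * A * star (u : H →L[ℂ] H) with hA₂
  have hA₂s : IsSubstate A₂ :=
    ⟨isPositive_conj_unitary hA.1 u, by
      rw [hA₂, opTrace_conj_unitary hA.1 hA.eigenbasis]; exact hA.2⟩
  have hpinch : Q * A * Q + (1 - Q) * A * (1 - Q) =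
      ((1 / 2 : ℝ) : ℂ) • A + ((1 / 2 : ℝ) : ℂ) • A₂ := by
    rw [hA₂, hus]
    have h2 : (2 : ℂ) • (Q * A * Q + (1 - Q) * A * (1 - Q)) =
        A + (2 * Q - 1) * A * (2 * Q - 1) := by
      rw [two_smul]
      noncomm_ring
    change _ = _ + ((1 / 2 : ℝ) : ℂ) • ((2 * Q - 1) * A * (2 * Q - 1))
    rw [← smul_add, ← h2, smul_smul]
    norm_num
  have hpos1 := hQ.conj_isPositive hA.1
  have hpos2 := hQ.one_sub.conj_isPositive hA.1
  have hE : IsSubstate (Q * A * Q + (1 - Q) * A * (1 - Q)) := by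
    refine ⟨hpos1.add hpos2, ?_⟩
    rw [opTrace_add hpos1 hpos2, opTrace_conj_add hQ hA.1 hA.eigenbasis]
    exact hA.2
  have hSE : vnEntropy (Q * A * Q + (1 - Q) * A * (1 - Q)) < ⊤ := by
    have hE' := hE
    rw [hpinch] at hE' ⊢
    refine (vnEntropy_add_le (isPositive_smul hh hA.1) (isPositive_smul hh hA₂s.1) hE').trans_lt ?_
    rw [vnEntropy_smul hA hh hh1, vnEntropy_smul hA₂s hh hh1, hA₂, vnEntropy_conj_unitary hA,
      ← hA₂]
    have h1 := hA.ne_top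
    have h2 := hA₂s.ne_top
    have h3 := hS.ne
    finiteness
  have hle : X ≤ Q * A * Q + (1 - Q) * A * (1 - Q) :=
    h.trans (le_add_of_isPositive_right hpos2)
  obtain ⟨Y, hY⟩ : ∃ Y, X + Y = Q * A * Q + (1 - Q) * A * (1 - Q) := ⟨_, add_sub_cancel _ _⟩
  have hYpos : Y.IsPositive := by
    rw [← ContinuousLinearMap.nonneg_iff_isPositive]
    rw [← hY] at hle
    simpa using hle
  rw [← hY] at hE hSE
  have hYs := hE.of_le hYpos (le_add_of_isPositive_left hX)
  refine (vnEntropy_le_add hX hYpos hE).trans_lt ?_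
  exact ENNReal.add_lt_top.mpr ⟨hSE, hYs.ne_top.lt_top⟩

/-- Orthogonal self-adjoint operators are separated by a projection. -/
theorem exists_isStarProjection (hP : IsSelfAdjoint P) (hPN : P * N = 0) :
    ∃ Q : H →L[ℂ] H, IsStarProjection Q ∧ Q * N = N ∧ Q * P = 0 := by
  let K : Submodule ℂ H := N.range.topologicalClosure
  have : CompleteSpace K := (Submodule.isClosed_topologicalClosure _).completeSpace_coe
  refine ⟨K.starProjection, isStarProjection_starProjection, ?_, ?_⟩
  · ext v
    exact Submodule.starProjection_eq_self_iff.mpr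
      (Submodule.le_topologicalClosure _ ⟨v, rfl⟩)
  · have hK : K ≤ P.ker := by
      refine Submodule.topologicalClosure_minimal _ ?_ P.isClosed_ker
      rintro _ ⟨v, rfl⟩
      exact DFunLike.congr_fun hPN v
    have h0 : P * K.starProjection = 0 := by
      ext v
      exact hK (Submodule.starProjection_apply_mem K v)
    have := congrArg star h0
    rwa [star_mul, hP.star_eq,
      (isStarProjection_starProjection (U := K)).isSelfAdjoint.star_eq, star_zero] at this

/-- The properties of the Jordan decomposition of `B - A` that enter the entropy inequality. -/
theorem jordan_decomposition (hA : IsState A) (hB : IsState B) :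
    ∃ ε : ℝ, ε = (traceNorm (B - A)).toReal / 2 ∧ 0 ≤ ε ∧ ε ≤ 1 ∧
      (B - A)⁺.IsPositive ∧ (B - A)⁻.IsPositive ∧ A + (B - A)⁺ = B + (B - A)⁻ ∧
      opTrace (B - A)⁺ = ENNReal.ofReal ε ∧ opTrace (B - A)⁻ = ENNReal.ofReal ε ∧
      ∃ Q : H →L[ℂ] H, IsStarProjection Q ∧ Q * (B - A)⁺ * Q = (B - A)⁺ ∧
        opTrace (Q * A * Q) ≤ ENNReal.ofReal (1 - ε) ∧ (B - A)⁻ ≤ (1 - Q) * A * (1 - Q) := by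
  have hsa : IsSelfAdjoint (B - A) := hB.1.isSelfAdjoint.sub hA.1.isSelfAdjoint
  have hNP : (B - A)⁺ - (B - A)⁻ = B - A := CFC.posPart_sub_negPart _ hsa
  have habs : (B - A)⁺ + (B - A)⁻ = CFC.abs (B - A) := CFC.posPart_add_negPart _ hsa
  have hNpos : (B - A)⁺.IsPositive :=
    (ContinuousLinearMap.nonneg_iff_isPositive _).mp (CFC.posPart_nonneg _)
  have hPpos : (B - A)⁻.IsPositive :=
    (ContinuousLinearMap.nonneg_iff_isPositive _).mp (CFC.negPart_nonneg _)
  have hPN : (B - A)⁻ * (B - A)⁺ = 0 := CFC.negPart_mul_posPart _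
  rw [traceNorm, ← habs]
  generalize (B - A)⁺ = N at *
  generalize (B - A)⁻ = P at *
  obtain ⟨Q, hQ, hQN, hQP⟩ := exists_isStarProjection hPpos.isSelfAdjoint hPN
  have hNQ : N * Q = N := by
    have := congrArg star hQN
    rwa [star_mul, hNpos.isSelfAdjoint.star_eq, hQ.isSelfAdjoint.star_eq] at this
  have hPQ : P * Q = 0 := by
    have := congrArg star hQP
    rwa [star_mul, hPpos.isSelfAdjoint.star_eq, hQ.isSelfAdjoint.star_eq, star_zero] at this
  have hsum : A + N = B + P := by
    rw [sub_eq_sub_iff_add_eq_add] at hNP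
    rw [add_comm A, hNP]
  have hQNQ : Q * N * Q = N := by rw [hQN, hNQ]
  have hPQ' : (1 - Q) * P * (1 - Q) = P := by
    rw [sub_mul, one_mul, hQP, sub_zero, mul_sub, mul_one, hPQ, sub_zero]
  have hNQ' : (1 - Q) * N * (1 - Q) = 0 := by
    rw [sub_mul, one_mul, hQN, sub_self, zero_mul]
  have hQPQ : Q * P * Q = 0 := by rw [hQP, zero_mul]
  have hAQ : Q * A * Q + N = Q * B * Q := by
    have := congrArg (fun X => Q * X * Q) hsum
    simpa only [mul_add, add_mul, hQNQ, hQPQ, add_zero] using this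
  have hBQ : (1 - Q) * A * (1 - Q) = (1 - Q) * B * (1 - Q) + P := by
    have := congrArg (fun X => (1 - Q) * X * (1 - Q)) hsum
    simp only [mul_add, add_mul, hNQ', add_zero] at this
    rw [this, hPQ']
  have htr : opTrace (Q * A * Q) + opTrace N = opTrace (Q * B * Q) := by
    rw [← hAQ, opTrace_add (hQ.conj_isPositive hA.1) hNpos]
  have hQB : opTrace (Q * B * Q) ≤ 1 := by
    rw [← hB.2, ← opTrace_conj_add hQ hB.1 hB.isSubstate.eigenbasis]
    exact le_self_add
  have hN1 : opTrace N ≤ 1 := le_add_self.trans (htr.le.trans hQB)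
  have hNtop : opTrace N ≠ ⊤ := ne_top_of_le_ne_top ENNReal.one_ne_top hN1
  have hNPt : opTrace N = opTrace P := by
    have := congrArg opTrace hsum
    rwa [opTrace_add hA.1 hNpos, opTrace_add hB.1 hPpos, hA.2, hB.2,
      ENNReal.add_right_inj ENNReal.one_ne_top] at this
  have hε : (opTrace (N + P)).toReal / 2 = (opTrace N).toReal := by
    rw [opTrace_add hNpos hPpos, ← hNPt, ENNReal.toReal_add hNtop hNtop]
    ring
  refine ⟨(opTrace N).toReal, hε.symm, ENNReal.toReal_nonneg,
    ENNReal.toReal_le_of_le_ofReal zero_le_one (by simpa using hN1), hNpos, hPpos, hsum,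
    (ENNReal.ofReal_toReal hNtop).symm, ?_, Q, hQ, hQNQ, ?_, ?_⟩
  · rw [ENNReal.ofReal_toReal hNtop, hNPt]
  · rw [ENNReal.ofReal_sub _ ENNReal.toReal_nonneg, ENNReal.ofReal_toReal hNtop, ENNReal.ofReal_one]
    exact ENNReal.le_sub_of_add_le_right hNtop (htr.le.trans hQB)
  · rw [hBQ]
    exact le_add_of_isPositive_left (hQ.one_sub.conj_isPositive hB.1)

end Jordan

/-! ### Countable mixtures -/

section Mixture

open Filter Topology

variable {H : Type*} [NormedAddCommGroup H] [InnerProductSpace ℂ H] [CompleteSpace H]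
  {I : Type*} {p q : I → ℝ} {X Y : I → (H →L[ℂ] H)}

/-- The mixture `∑ i, p i X i`. -/
noncomputable def mixture (p : I → ℝ) (X : I → (H →L[ℂ] H)) : H →L[ℂ] H :=
  ∑' i, (p i : ℂ) • X i

theorem hasSum_mixture (hp0 : ∀ i, 0 ≤ p i) (hp : Summable p) (hX : ∀ i, IsSubstate (X i)) :
    HasSum (fun i => (p i : ℂ) • X i) (mixture p X) := by
  refine (Summable.of_norm_bounded hp fun i => ?_).hasSum
  rw [norm_smul, Complex.norm_real, Real.norm_of_nonneg (hp0 i)]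
  exact mul_le_of_le_one_right (hp0 i) (hX i).norm_le_one

theorem hasSum_re_inner_mixture (hp0 : ∀ i, 0 ≤ p i) (hp : Summable p)
    (hX : ∀ i, IsSubstate (X i)) (v : H) :
    HasSum (fun i => p i * (inner ℂ v (X i v)).re) (inner ℂ v (mixture p X v)).re := by
  have h := (hasSum_mixture hp0 hp hX).mapL (ContinuousLinearMap.apply ℂ H v)
  have h2 := (Complex.hasSum_iff _ _ |>.mp (h.mapL (innerSL ℂ v))).1
  simpa using h2

theorem mixture_isPositive (hp0 : ∀ i, 0 ≤ p i) (hp : Summable p) (hX : ∀ i, IsSubstate (X i)) :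
    (mixture p X).IsPositive := by
  rw [← ContinuousLinearMap.nonneg_iff_isPositive]
  refine (hasSum_mixture hp0 hp hX).nonneg fun i => ?_
  rw [ContinuousLinearMap.nonneg_iff_isPositive]
  exact isPositive_smul (hp0 i) (hX i).1

theorem quadForm_mixture (hp0 : ∀ i, 0 ≤ p i) (hp : Summable p) (hX : ∀ i, IsSubstate (X i))
    (v : H) : quadForm (mixture p X) v = ∑' i, ENNReal.ofReal (p i) * quadForm (X i) v := by
  have h := hasSum_re_inner_mixture hp0 hp hX v
  have h0 : ∀ i, 0 ≤ (inner ℂ v (X i v)).re := fun i => re_inner_apply_nonneg (hX i).1 v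
  rw [quadForm, ← h.tsum_eq, ENNReal.ofReal_tsum_of_nonneg
    (fun i => mul_nonneg (hp0 i) (h0 i)) h.summable]
  exact tsum_congr fun i => ENNReal.ofReal_mul (hp0 i)

theorem opTrace_mixture (hp0 : ∀ i, 0 ≤ p i) (hp : Summable p) (hX : ∀ i, IsSubstate (X i)) :
    opTrace (mixture p X) = ∑' i, ENNReal.ofReal (p i) * opTrace (X i) := by
  obtain ⟨w, b, -⟩ := exists_hilbertBasis ℂ H
  rw [opTrace_eq_tsum (mixture_isPositive hp0 hp hX) b]
  simp_rw [quadForm_mixture hp0 hp hX]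
  rw [ENNReal.tsum_comm]
  refine tsum_congr fun i => ?_
  rw [ENNReal.tsum_mul_left, opTrace_eq_tsum (hX i).1 b]

theorem crossEntropy_mixture {B : H →L[ℂ] H} (hp0 : ∀ i, 0 ≤ p i) (hp : Summable p)
    (hX : ∀ i, IsSubstate (X i)) (F : Eigenbasis B) :
    F.crossEntropy (mixture p X) = ∑' i, ENNReal.ofReal (p i) * F.crossEntropy (X i) := by
  simp_rw [Eigenbasis.crossEntropy, quadForm_mixture hp0 hp hX, ← ENNReal.tsum_mul_right,
    ← ENNReal.tsum_mul_left, mul_assoc]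
  rw [ENNReal.tsum_comm]

theorem mixture_isSubstate (hp0 : ∀ i, 0 ≤ p i) (hp : Summable p) (hp1 : ∑' i, p i ≤ 1)
    (hX : ∀ i, IsSubstate (X i)) : IsSubstate (mixture p X) := by
  refine ⟨mixture_isPositive hp0 hp hX, ?_⟩
  rw [opTrace_mixture hp0 hp hX]
  calc _ ≤ ∑' i, ENNReal.ofReal (p i) :=
        ENNReal.tsum_le_tsum fun i => mul_le_of_le_one_right' (hX i).2
    _ = ENNReal.ofReal (∑' i, p i) := (ENNReal.ofReal_tsum_of_nonneg hp0 hp).symm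
    _ ≤ 1 := by simpa using hp1

theorem mixture_add_weights (hp0 : ∀ i, 0 ≤ p i) (hp : Summable p) (hq0 : ∀ i, 0 ≤ q i)
    (hq : Summable q) (hX : ∀ i, IsSubstate (X i)) :
    mixture p X + mixture q X = mixture (fun i => p i + q i) X := by
  have := (hasSum_mixture hp0 hp hX).add (hasSum_mixture hq0 hq hX)
  rw [← this.tsum_eq, mixture]
  refine tsum_congr fun i => ?_
  rw [Complex.ofReal_add, add_smul]

theorem mixture_const (hp : Summable p) (A : H →L[ℂ] H) :
    mixture p (fun _ => A) = ((∑' i, p i : ℝ) : ℂ) • A := by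
  rw [mixture]
  have : HasSum (fun i => (p i : ℂ)) ((∑' i, p i : ℝ) : ℂ) := Complex.hasSum_ofReal.mpr hp.hasSum
  exact (this.smul_const A).tsum_eq

theorem mixture_isState (hp0 : ∀ i, 0 ≤ p i) (hp : HasSum p 1) (hX : ∀ i, IsState (X i)) :
    IsState (mixture p X) := by
  refine ⟨mixture_isPositive hp0 hp.summable fun i => (hX i).isSubstate, ?_⟩
  rw [opTrace_mixture hp0 hp.summable fun i => (hX i).isSubstate]
  simp_rw [(hX _).2, mul_one]
  rw [← ENNReal.ofReal_tsum_of_nonneg hp0 hp.summable, hp.tsum_eq, ENNReal.ofReal_one]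

end Mixture

/-! ### The Holevo quantity as an entropy difference -/

section Holevo

variable {H : Type*} [NormedAddCommGroup H] [InnerProductSpace ℂ H] [CompleteSpace H]
  {I : Type*}

theorem crossEntropy_eq {A B : H →L[ℂ] H} (hA : IsSubstate A) (hB : IsSubstate B)
    (F F' : Eigenbasis B) : F.crossEntropy A = F'.crossEntropy A :=
  le_antisymm (Eigenbasis.crossEntropy_antitone hA hB hB le_rfl _ _)
    (Eigenbasis.crossEntropy_antitone hA hB hB le_rfl _ _)

theorem relEntropy_add_vnEntropy {A B : H →L[ℂ] H} (hA : IsState A) (hB : IsState B)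
    (F : Eigenbasis B) : relEntropy A B + vnEntropy A = F.crossEntropy A := by
  have h : Nonempty (Eigenbasis A) ∧ Nonempty (Eigenbasis B) :=
    ⟨hA.isSubstate.nonempty_eigenbasis, hB.isSubstate.nonempty_eigenbasis⟩
  have h2 := Eigenbasis.relEnt_add hA.isSubstate hB.isSubstate h.1.some h.2.some
  rw [hA.2, hB.2, ENNReal.add_left_inj ENNReal.one_ne_top] at h2
  rw [crossEntropy_eq hA.isSubstate hB.isSubstate F h.2.some, ← h2, relEntropy, dif_pos h,
    Eigenbasis.relEnt]

namespace EnsembleData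

theorem avg_eq_mixture (μ : EnsembleData I H) : μ.avg = mixture μ.prob μ.state := rfl

variable {μ : EnsembleData I H}

theorem IsEnsemble.avg_isState (h : μ.IsEnsemble) : IsState μ.avg :=
  mixture_isState h.1 h.2.1 h.2.2

/-- The Holevo quantity is the entropy of the average state minus the average entropy. -/
theorem IsEnsemble.holevo_add (h : μ.IsEnsemble) :
    μ.holevo + ∑' i, ENNReal.ofReal (μ.prob i) * vnEntropy (μ.state i) = vnEntropy μ.avg := by
  have hs := h.avg_isState
  have F := hs.isSubstate.eigenbasis
  rw [holevo, ← ENNReal.tsum_add, ← F.crossEntropy_self hs.isSubstate]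
  refine Eq.trans ?_
    (crossEntropy_mixture h.1 h.2.1.summable (fun i => (h.2.2 i).isSubstate) F).symm
  refine tsum_congr fun i => ?_
  rw [← mul_add, relEntropy_add_vnEntropy (h.2.2 i) hs F]

theorem IsEnsemble.holevo_le (h : μ.IsEnsemble) : μ.holevo ≤ vnEntropy μ.avg := by
  rw [← h.holevo_add]
  exact le_self_add

end EnsembleData

end Holevo

/-! ### Summing the pairwise entropy inequality over an ensemble -/

section Truncation

open Filter Topology

variable {H : Type*} [NormedAddCommGroup H] [InnerProductSpace ℂ H] [CompleteSpace H]
  {I : Type*} {p : I → ℝ} {ρ N P : I → (H →L[ℂ] H)} {ω : H →L[ℂ] H}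

theorem tsum_indicator_finset (s : Finset I) (f : I → ℝ≥0∞) :
    ∑' i, ENNReal.ofReal ((s : Set I).indicator p i) * f i =
      ∑ i ∈ s, ENNReal.ofReal (p i) * f i := by
  rw [tsum_eq_sum (s := s)]
  · exact Finset.sum_congr rfl fun i hi => by rw [Set.indicator_of_mem (Finset.mem_coe.mpr hi)]
  · intro i hi
    rw [Set.indicator_of_notMem (by simpa using hi)]
    simp

theorem tendsto_tsum_indicator_compl {f : I → ℝ≥0∞}
    (hf : ∑' i, ENNReal.ofReal (p i) * f i ≠ ⊤) :
    Tendsto (fun s : Finset I => ∑' i, ENNReal.ofReal ((s : Set I)ᶜ.indicator p i) * f i)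
      atTop (𝓝 0) := by
  refine (ENNReal.tendsto_tsum_compl_atTop_zero hf).congr fun s => ?_
  have : ∀ i, ENNReal.ofReal ((s : Set I)ᶜ.indicator p i) * f i =
      (s : Set I)ᶜ.indicator (fun i => ENNReal.ofReal (p i) * f i) i := by
    intro i
    by_cases hi : i ∈ (s : Set I)ᶜ
    · rw [Set.indicator_of_mem hi, Set.indicator_of_mem hi]
    · rw [Set.indicator_of_notMem hi, Set.indicator_of_notMem hi]; simp
  simp_rw [this]
  rw [← tsum_subtype]
  rfl

/-- The error made when the sum over the ensemble is restricted to a finite set `s` of indices. -/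
noncomputable def tailError (p : I → ℝ) (ρ : I → (H →L[ℂ] H)) (F : Eigenbasis ω)
    (s : Finset I) : ℝ≥0∞ :=
  ∑' i, ENNReal.ofReal ((s : Set I)ᶜ.indicator p i) * F.crossEntropy (ρ i) +
    ENNReal.ofReal (Real.negMulLog
      (∑' i, ENNReal.ofReal ((s : Set I)ᶜ.indicator p i) * 1).toReal) +
    (∑' i, ENNReal.ofReal ((s : Set I)ᶜ.indicator p i) * 1 +
      ∑' i, ENNReal.ofReal ((s : Set I)ᶜ.indicator p i) * 1)

theorem tendsto_tailError (hp0 : ∀ i, 0 ≤ p i) (hp : HasSum p 1) (hρ : ∀ i, IsState (ρ i))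
    (hω : ω = mixture p ρ) (hS : vnEntropy ω ≠ ⊤) (F : Eigenbasis ω) :
    Tendsto (tailError p ρ F) atTop (𝓝 0) := by
  have h1 : ∑' i, ENNReal.ofReal (p i) * F.crossEntropy (ρ i) ≠ ⊤ := by
    rw [← crossEntropy_mixture hp0 hp.summable (fun i => (hρ i).isSubstate), ← hω,
      F.crossEntropy_self (hω ▸ (mixture_isState hp0 hp hρ).isSubstate)]
    exact hS
  have h2 : ∑' i, ENNReal.ofReal (p i) * 1 ≠ ⊤ := by
    simp_rw [mul_one]
    rw [← ENNReal.ofReal_tsum_of_nonneg hp0 hp.summable]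
    exact ENNReal.ofReal_ne_top
  have t1 := tendsto_tsum_indicator_compl h1
  have t2 := tendsto_tsum_indicator_compl h2
  have t3 : Tendsto (fun s : Finset I => ENNReal.ofReal (Real.negMulLog
      (∑' i, ENNReal.ofReal ((s : Set I)ᶜ.indicator p i) * 1).toReal)) atTop (𝓝 0) := by
    have := (ENNReal.continuous_ofReal.tendsto _).comp ((Real.continuous_negMulLog.tendsto _).comp
      ((ENNReal.tendsto_toReal ENNReal.zero_ne_top).comp t2))
    simpa [Function.comp_def] using this
  have := (t1.add t3).add (t2.add t2)
  simp only [add_zero] at this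
  exact this

/-- Finite partial sums of the cross entropies of the positive and negative parts relative to
their common mixture compare up to an error that vanishes in the limit. -/
theorem sum_crossEntropy_le (hp0 : ∀ i, 0 ≤ p i) (hp : HasSum p 1) (hρ : ∀ i, IsState (ρ i))
    (hω : ω = mixture p ρ) (F : Eigenbasis ω) (hN : ∀ i, IsSubstate (N i))
    (hP : ∀ i, IsSubstate (P i)) (hNP : ∀ i, ω + N i = ρ i + P i)
    (hK : mixture p N = mixture p P) (FK : Eigenbasis (mixture p N)) (s : Finset I) :
    ∑ i ∈ s, ENNReal.ofReal (p i) * FK.crossEntropy (P i) ≤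
      ∑ i ∈ s, ENNReal.ofReal (p i) * FK.crossEntropy (N i) + tailError p ρ F s := by
  have hωs : IsState ω := hω ▸ mixture_isState hp0 hp hρ
  have hρs := fun i => (hρ i).isSubstate
  set a : I → ℝ := (s : Set I).indicator p with ha
  set b : I → ℝ := (s : Set I)ᶜ.indicator p with hb
  have ha0 : ∀ i, 0 ≤ a i := fun i => Set.indicator_nonneg (fun i _ => hp0 i) i
  have hb0 : ∀ i, 0 ≤ b i := fun i => Set.indicator_nonneg (fun i _ => hp0 i) i
  have has : Summable a := hp.summable.indicator _
  have hbs : Summable b := hp.summable.indicator _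
  have hab : ∀ i, a i + b i = p i := fun i => Set.indicator_self_add_compl_apply _ p i
  have hab1 : ∑' i, a i + ∑' i, b i = 1 := by
    rw [← has.tsum_add hbs, ← hp.tsum_eq]
    exact tsum_congr hab
  have ha1 : ∑' i, a i ≤ 1 := by have : 0 ≤ ∑' i, b i := tsum_nonneg hb0; linarith
  have hb1 : ∑' i, b i ≤ 1 := by have : 0 ≤ ∑' i, a i := tsum_nonneg ha0; linarith
  have split : ∀ {X : I → (H →L[ℂ] H)}, (∀ i, IsSubstate (X i)) →
      mixture a X + mixture b X = mixture p X := by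
    intro X hX
    rw [mixture_add_weights ha0 has hb0 hbs hX]
    congr 1
    exact funext hab
  have hKs : IsSubstate (mixture p N) := mixture_isSubstate hp0 hp.summable hp.tsum_eq.le hN
  have hNa : IsSubstate (mixture a N) := mixture_isSubstate ha0 has ha1 hN
  have hPa : IsSubstate (mixture a P) := mixture_isSubstate ha0 has ha1 hP
  have hNb : IsSubstate (mixture b N) := mixture_isSubstate hb0 hbs hb1 hN
  have hPb : IsSubstate (mixture b P) := mixture_isSubstate hb0 hbs hb1 hP
  have hW₁ : IsSubstate (mixture b ρ) := mixture_isSubstate hb0 hbs hb1 hρs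
  have hW₂ : IsSubstate (mixture b fun _ => ω) :=
    mixture_isSubstate hb0 hbs hb1 fun _ => hωs.isSubstate
  -- `Tr` of the various tails is at most the tail of the weights
  have htail : ∀ {X : I → (H →L[ℂ] H)}, (∀ i, IsSubstate (X i)) →
      opTrace (mixture b X) ≤ ∑' i, ENNReal.ofReal (b i) * 1 := by
    intro X hX
    rw [opTrace_mixture hb0 hbs hX]
    exact ENNReal.tsum_le_tsum fun i => by gcongr; exact (hX i).2
  have hNle : mixture a N ≤ mixture p N := by
    rw [← split hN]; exact le_add_of_isPositive_right hNb.1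
  have hPle : mixture a P ≤ mixture p N := by
    rw [hK, ← split hP]; exact le_add_of_isPositive_right hPb.1
  -- adding `mixture a ρ` to either side gives `ω` plus the truncated positive parts
  have hswap : mixture a P + mixture b (fun _ => ω) = mixture a N + mixture b ρ := by
    have e1 : mixture a (fun _ => ω) + mixture a N = mixture a ρ + mixture a P := by
      have h1 := (hasSum_mixture ha0 has fun _ => hωs.isSubstate).add (hasSum_mixture ha0 has hN)
      have h2 := (hasSum_mixture ha0 has hρs).add (hasSum_mixture ha0 has hP)
      refine h1.unique ?_
      convert h2 using 1
      ext1 i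
      rw [← smul_add, hNP, smul_add]
    have e2 : mixture a (fun _ => ω) + mixture b (fun _ => ω) = ω := by
      rw [split fun _ => hωs.isSubstate, mixture_const hp.summable, hp.tsum_eq]
      simp
    have e3 : mixture a ρ + mixture b ρ = ω := by rw [split hρs, hω]
    have e4 : mixture a ρ + (mixture a P + mixture b (fun _ => ω)) =
        mixture a ρ + (mixture a N + mixture b ρ) := by
      rw [← add_assoc, ← e1, add_right_comm, e2, add_left_comm, e3, add_comm]
    exact add_left_cancel e4
  have hsub : IsSubstate (mixture a N + mixture b ρ) := by
    refine ⟨hNa.1.add hW₁.1, ?_⟩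
    rw [opTrace_add hNa.1 hW₁.1]
    calc _ ≤ opTrace (mixture a ρ) + opTrace (mixture b ρ) := by
          gcongr ?_ + _
          rw [opTrace_mixture ha0 has hN, opTrace_mixture ha0 has hρs]
          refine ENNReal.tsum_le_tsum fun i => ?_
          gcongr
          rw [(hρ i).2]
          exact (hN i).2
      _ = opTrace ω := by
          rw [← opTrace_add (mixture_isPositive ha0 has hρs) hW₁.1, split hρs, ← hω]
      _ ≤ 1 := hωs.2.le
  calc ∑ i ∈ s, ENNReal.ofReal (p i) * FK.crossEntropy (P i)
      = FK.crossEntropy (mixture a P) := by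
        rw [crossEntropy_mixture ha0 has hP, ha, tsum_indicator_finset]
    _ ≤ hPa.eigenbasis.crossEntropy (mixture a P) :=
        Eigenbasis.crossEntropy_antitone hPa hPa hKs hPle _ _
    _ = vnEntropy (mixture a P) := Eigenbasis.crossEntropy_self hPa _
    _ ≤ vnEntropy (mixture a P + mixture b fun _ => ω) + opTrace (mixture b fun _ => ω) :=
        vnEntropy_le_add hPa.1 hW₂.1 (hswap ▸ hsub)
    _ ≤ vnEntropy (mixture a N) + vnEntropy (mixture b ρ) + opTrace (mixture b fun _ => ω) := by
        rw [hswap]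
        gcongr
        exact vnEntropy_add_le hNa.1 hW₁.1 hsub
    _ ≤ (FK.crossEntropy (mixture a N) + opTrace (mixture b N)) +
          (F.crossEntropy (mixture b ρ) +
            ENNReal.ofReal (Real.negMulLog (opTrace (mixture b ρ)).toReal)) +
          opTrace (mixture b fun _ => ω) := by
        gcongr
        · have := vnEntropy_add_opTrace_le hNa hKs FK
          rw [show opTrace (mixture p N) = opTrace (mixture a N) + opTrace (mixture b N) by
            rw [← opTrace_add hNa.1 hNb.1, split hN], add_left_comm, add_comm,
            ENNReal.add_le_add_iff_left hNa.ne_top] at this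
          exact this
        · exact vnEntropy_le_crossEntropy hW₁ hωs.isSubstate hωs.2 F
    _ ≤ _ := by
        rw [crossEntropy_mixture ha0 has hN, ha, tsum_indicator_finset,
          crossEntropy_mixture hb0 hbs hρs, tailError, ← hb]
        have hW : opTrace (mixture b ρ) = ∑' i, ENNReal.ofReal (b i) * 1 := by
          rw [opTrace_mixture hb0 hbs hρs]
          exact tsum_congr fun i => by rw [(hρ i).2]
        rw [hW]
        have h1 := htail hN
        have h2 := htail (X := fun _ => ω) fun _ => hωs.isSubstate
        calc _ ≤ ∑ i ∈ s, ENNReal.ofReal (p i) * FK.crossEntropy (N i) +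
              ∑' i, ENNReal.ofReal (b i) * 1 +
              (∑' i, ENNReal.ofReal (b i) * F.crossEntropy (ρ i) +
              ENNReal.ofReal (Real.negMulLog (∑' i, ENNReal.ofReal (b i) * 1).toReal)) +
              ∑' i, ENNReal.ofReal (b i) * 1 := by gcongr
          _ = _ := by ring

/-- The summed inequality, with the entropies of the average state and of the members of the
ensemble in place of the Holevo quantity. The numbers `dN i` and `dP i` stand for the relative
entropies of the positive and the negative parts, and `E`, `G` for the terms that come from
normalising these parts. -/
theorem tsum_add_vnEntropy_le (hp0 : ∀ i, 0 ≤ p i) (hp : HasSum p 1) (hρ : ∀ i, IsState (ρ i))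
    (hω : ω = mixture p ρ) (hS : vnEntropy ω ≠ ⊤) (hN : ∀ i, IsSubstate (N i))
    (hP : ∀ i, IsSubstate (P i)) (hNP : ∀ i, ω + N i = ρ i + P i)
    (hK : mixture p N = mixture p P) (FK : Eigenbasis (mixture p N)) {h dN dP E G : I → ℝ≥0∞}
    (hfin : ∀ i, ENNReal.ofReal (p i) * vnEntropy (N i) ≠ ⊤)
    (hfin' : ∀ i, ENNReal.ofReal (p i) * vnEntropy (P i) ≠ ⊤)
    (hmain : ∀ i, vnEntropy ω + vnEntropy (N i) ≤ vnEntropy (ρ i) + vnEntropy (P i) + h i)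
    (hE : ∀ i, E i ≠ ⊤)
    (hdN : ∀ i, dN i + ENNReal.ofReal (p i) * vnEntropy (N i) + E i =
      ENNReal.ofReal (p i) * FK.crossEntropy (N i) + G i)
    (hdP : ∀ i, dP i + ENNReal.ofReal (p i) * vnEntropy (P i) + E i =
      ENNReal.ofReal (p i) * FK.crossEntropy (P i) + G i) :
    ∑' i, dP i + vnEntropy ω ≤ ∑' i, dN i +
      ∑' i, ENNReal.ofReal (p i) * vnEntropy (ρ i) + ∑' i, ENNReal.ofReal (p i) * h i := by
  have hωs : IsState ω := hω ▸ mixture_isState hp0 hp hρ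
  set F := hωs.isSubstate.eigenbasis
  have key : ∀ s : Finset I, ∑ i ∈ s, dP i + ∑ i ∈ s, ENNReal.ofReal (p i) * vnEntropy ω ≤
      ∑ i ∈ s, dN i + ∑ i ∈ s, ENNReal.ofReal (p i) * vnEntropy (ρ i) +
        ∑ i ∈ s, ENNReal.ofReal (p i) * h i + tailError p ρ F s := by
    intro s
    have h1 := sum_crossEntropy_le hp0 hp hρ hω F hN hP hNP hK FK s
    have h2 : ∑ i ∈ s, (ENNReal.ofReal (p i) * vnEntropy ω +
        ENNReal.ofReal (p i) * vnEntropy (N i)) ≤ ∑ i ∈ s, (ENNReal.ofReal (p i) * vnEntropy (ρ i) +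
        ENNReal.ofReal (p i) * vnEntropy (P i) + ENNReal.ofReal (p i) * h i) := by
      refine Finset.sum_le_sum fun i _ => ?_
      simp only [← mul_add]
      exact mul_le_mul' le_rfl (hmain i)
    have h3 : ∑ i ∈ s, (dP i + ENNReal.ofReal (p i) * vnEntropy (P i) + E i) ≤
        ∑ i ∈ s, (dN i + ENNReal.ofReal (p i) * vnEntropy (N i) + E i) + tailError p ρ F s := by
      simp_rw [hdN, hdP]
      rw [Finset.sum_add_distrib, Finset.sum_add_distrib, add_right_comm]
      gcongr
    simp only [Finset.sum_add_distrib] at h2 h3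
    have f1 : ∑ i ∈ s, ENNReal.ofReal (p i) * vnEntropy (N i) ≠ ⊤ :=
      (ENNReal.sum_lt_top.mpr fun i _ => (hfin i).lt_top).ne
    have f2 : ∑ i ∈ s, ENNReal.ofReal (p i) * vnEntropy (P i) ≠ ⊤ :=
      (ENNReal.sum_lt_top.mpr fun i _ => (hfin' i).lt_top).ne
    have f3 : ∑ i ∈ s, E i ≠ ⊤ := (ENNReal.sum_lt_top.mpr fun i _ => (hE i).lt_top).ne
    have f : ∑ i ∈ s, ENNReal.ofReal (p i) * vnEntropy (N i) +
        ∑ i ∈ s, ENNReal.ofReal (p i) * vnEntropy (P i) + ∑ i ∈ s, E i ≠ ⊤ :=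
      ENNReal.add_ne_top.mpr ⟨ENNReal.add_ne_top.mpr ⟨f1, f2⟩, f3⟩
    have h4 := add_le_add h2 h3
    rw [← ENNReal.add_le_add_iff_right f]
    refine le_trans (le_of_eq ?_) (h4.trans (le_of_eq ?_)) <;> ring
  have tsum : ∀ f : I → ℝ≥0∞, Tendsto (fun s : Finset I => ∑ i ∈ s, f i) atTop (𝓝 (∑' i, f i)) :=
    fun f => ENNReal.summable.hasSum
  have hlim := le_of_tendsto_of_tendsto' ((tsum dP).add (tsum _))
    ((((tsum dN).add (tsum _)).add (tsum _)).add (tendsto_tailError hp0 hp hρ hω hS F)) key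
  rw [ENNReal.tsum_mul_right, ← ENNReal.ofReal_tsum_of_nonneg hp0 hp.summable, hp.tsum_eq,
    ENNReal.ofReal_one, one_mul, add_zero] at hlim
  exact hlim

end Truncation

/-! ### The ensembles of normalised positive and negative parts -/

section Normalized

variable {H : Type*} [NormedAddCommGroup H] [InnerProductSpace ℂ H] [CompleteSpace H]
  {I : Type*}

theorem Eigenbasis.crossEntropy_smul_inv {K X : H →L[ℂ] H} (hX : X.IsPositive)
    (hK : K.IsPositive) (FK : Eigenbasis K) {e : ℝ} (he : 0 < e) (he1 : e ≤ 1)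
    (hB : IsSubstate (((e⁻¹ : ℝ) : ℂ) • K)) :
    FK.crossEntropy X =
      (FK.smul e⁻¹).crossEntropy X + ENNReal.ofReal (-Real.log e) * opTrace X := by
  have hF : (FK.smul e⁻¹).crossEntropy X =
      ∑' j, quadForm X (FK.basis j) * negLog (e⁻¹ * FK.eigenvalue j) := rfl
  rw [opTrace_eq_tsum hX FK.basis, mul_comm, ← ENNReal.tsum_mul_right, hF, crossEntropy,
    ← ENNReal.tsum_add]
  refine tsum_congr fun j => ?_
  rw [← mul_add]
  congr 1
  have h0 := FK.eigenvalue_nonneg hK j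
  have h1 : e⁻¹ * FK.eigenvalue j ≤ 1 := hB.eigenvalue_le_one (FK.smul e⁻¹) j
  rw [negLog, negLog]
  by_cases hj : FK.eigenvalue j = 0
  · simp [hj]
  rw [if_neg hj, if_neg (mul_ne_zero (inv_ne_zero he.ne') hj), ← ENNReal.ofReal_add]
  · rw [Real.log_mul (inv_ne_zero he.ne') hj, Real.log_inv]
    congr 1; ring
  · have := Real.log_nonpos (by positivity) h1; linarith
  · have := Real.log_nonpos he.le he1; linarith

/-- The relative entropy of a normalised operator `ε⁻¹ X` with respect to `e⁻¹ K`, in terms of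
quantities for `X` and `K`. -/
theorem relEntropy_normalized {K X τ : H →L[ℂ] H} {ε e : ℝ} (hε0 : 0 ≤ ε) (hε1 : ε ≤ 1)
    (hX : X.IsPositive) (hXt : opTrace X = ENNReal.ofReal ε)
    (hτ : ε ≠ 0 → τ = ((ε⁻¹ : ℝ) : ℂ) • X)
    (hK : K.IsPositive) (FK : Eigenbasis K) (he : 0 < e) (he1 : e ≤ 1)
    (hB : IsState (((e⁻¹ : ℝ) : ℂ) • K)) :
    ENNReal.ofReal ε * relEntropy τ (((e⁻¹ : ℝ) : ℂ) • K) + vnEntropy X +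
      ENNReal.ofReal ε * ENNReal.ofReal (-Real.log e) =
    FK.crossEntropy X + ENNReal.ofReal (Real.negMulLog ε) := by
  rcases hε0.eq_or_lt with rfl | hε0
  · have hX0 : X = 0 := eq_zero_of_opTrace hX (by simpa using hXt)
    simp [hX0, vnEntropy_zero, Eigenbasis.crossEntropy, quadForm]
  have hτ := hτ hε0.ne'
  have hXτ : X = (ε : ℂ) • τ := by
    rw [hτ, smul_smul, ← Complex.ofReal_mul, mul_inv_cancel₀ hε0.ne', Complex.ofReal_one, one_smul]
  have hτs : IsState τ := by
    refine ⟨hτ ▸ isPositive_smul (by positivity) hX, ?_⟩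
    rw [hτ, opTrace_smul (by positivity) hX, hXt, ← ENNReal.ofReal_mul (by positivity),
      inv_mul_cancel₀ hε0.ne', ENNReal.ofReal_one]
  have h1 := relEntropy_add_vnEntropy hτs hB (FK.smul e⁻¹)
  rw [FK.crossEntropy_smul_inv hX hK he he1 hB.isSubstate, hXt]
  conv_lhs => rw [hXτ, vnEntropy_smul hτs.isSubstate hε0.le hε1, hτs.2]
  conv_rhs => rw [hXτ, Eigenbasis.crossEntropy_smul _ hε0.le, ← h1]
  ring

namespace EnsembleData

open Classical in
/-- The ensemble of the normalised operators `(ε i)⁻¹ X i` with probabilities `p i ε i / ε_av`.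
The ensembles `μ₊` and `μ₋` are instances. -/
noncomputable def normalized (μ : EnsembleData I H) (X : I → (H →L[ℂ] H)) (σ : H →L[ℂ] H) :
    EnsembleData I H where
  prob i := μ.prob i * μ.eps i / μ.epsAv
  state i := if μ.eps i = 0 then σ else ((μ.eps i)⁻¹ : ℂ) • X i

theorem plus_eq_normalized (μ : EnsembleData I H) (σ : H →L[ℂ] H) :
    μ.plus σ = μ.normalized (fun i => (μ.state i - μ.avg)⁺) σ := rfl

theorem minus_eq_normalized (μ : EnsembleData I H) (σ : H →L[ℂ] H) :
    μ.minus σ = μ.normalized (fun i => (μ.state i - μ.avg)⁻) σ := rfl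

theorem normalized_state {μ : EnsembleData I H} {X : I → (H →L[ℂ] H)} {σ : H →L[ℂ] H} {i : I}
    (h : μ.eps i ≠ 0) : (μ.normalized X σ).state i = (((μ.eps i)⁻¹ : ℝ) : ℂ) • X i := by
  rw [normalized, Complex.ofReal_inv]
  exact if_neg h

theorem eps_nonneg (μ : EnsembleData I H) (i : I) : 0 ≤ μ.eps i :=
  div_nonneg ENNReal.toReal_nonneg zero_le_two

variable {μ : EnsembleData I H} {X : I → (H →L[ℂ] H)} {σ : H →L[ℂ] H}

theorem IsEnsemble.eps_le_one (h : μ.IsEnsemble) (i : I) : μ.eps i ≤ 1 := by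
  obtain ⟨ε, hε, -, h1, -⟩ := jordan_decomposition h.avg_isState (h.2.2 i)
  rw [eps, ← hε]
  exact h1

theorem IsEnsemble.summable_eps (h : μ.IsEnsemble) : Summable fun i => μ.prob i * μ.eps i :=
  Summable.of_nonneg_of_le (fun i => mul_nonneg (h.1 i) (μ.eps_nonneg i))
    (fun i => mul_le_of_le_one_right (h.1 i) (h.eps_le_one i)) h.2.1.summable

theorem IsEnsemble.epsAv_nonneg (h : μ.IsEnsemble) : 0 ≤ μ.epsAv :=
  tsum_nonneg fun i => mul_nonneg (h.1 i) (μ.eps_nonneg i)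

theorem IsEnsemble.epsAv_le_one (h : μ.IsEnsemble) : μ.epsAv ≤ 1 := by
  rw [← h.2.1.tsum_eq]
  exact h.summable_eps.tsum_le_tsum
    (fun i => mul_le_of_le_one_right (h.1 i) (h.eps_le_one i)) h.2.1.summable

theorem IsEnsemble.normalized_isEnsemble (h : μ.IsEnsemble) (he : 0 < μ.epsAv)
    (hσ : IsState σ) (hX : ∀ i, (X i).IsPositive)
    (hXt : ∀ i, opTrace (X i) = ENNReal.ofReal (μ.eps i)) : (μ.normalized X σ).IsEnsemble := by
  refine ⟨fun i => div_nonneg (mul_nonneg (h.1 i) (μ.eps_nonneg i)) he.le, ?_, fun i => ?_⟩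
  · have := h.summable_eps.hasSum.div_const μ.epsAv
    rwa [show (∑' i, μ.prob i * μ.eps i) = μ.epsAv from rfl, div_self he.ne'] at this
  · by_cases h0 : μ.eps i = 0
    · rw [normalized]
      simpa only [h0, if_true] using hσ
    · rw [normalized_state h0]
      have hi : 0 ≤ (μ.eps i)⁻¹ := inv_nonneg.mpr (μ.eps_nonneg i)
      refine ⟨isPositive_smul hi (hX i), ?_⟩
      rw [opTrace_smul hi (hX i), hXt, ← ENNReal.ofReal_mul hi, inv_mul_cancel₀ h0,
        ENNReal.ofReal_one]

theorem IsEnsemble.isSubstate_of_opTrace (h : μ.IsEnsemble) (hX : ∀ i, (X i).IsPositive)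
    (hXt : ∀ i, opTrace (X i) = ENNReal.ofReal (μ.eps i)) (i : I) : IsSubstate (X i) :=
  ⟨hX i, by rw [hXt]; simpa using h.eps_le_one i⟩

theorem IsEnsemble.normalized_avg (h : μ.IsEnsemble) (hX : ∀ i, (X i).IsPositive)
    (hXt : ∀ i, opTrace (X i) = ENNReal.ofReal (μ.eps i)) :
    (μ.normalized X σ).avg = ((μ.epsAv⁻¹ : ℝ) : ℂ) • mixture μ.prob X := by
  have hs := (hasSum_mixture h.1 h.2.1.summable (h.isSubstate_of_opTrace hX hXt)).const_smul
    ((μ.epsAv⁻¹ : ℝ) : ℂ)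
  rw [← hs.tsum_eq, avg]
  refine tsum_congr fun i => ?_
  by_cases h0 : μ.eps i = 0
  · have : X i = 0 := eq_zero_of_opTrace (hX i) (by simp [hXt, h0])
    simp [normalized, h0, this]
  · rw [normalized_state h0, smul_smul, smul_smul, ← Complex.ofReal_mul, ← Complex.ofReal_mul]
    congr 2
    change μ.prob i * μ.eps i / μ.epsAv * (μ.eps i)⁻¹ = _
    field_simp

theorem normalized_holevo_of_epsAv_eq_zero (he : μ.epsAv = 0) :
    (μ.normalized X σ).holevo = 0 := by
  simp [holevo, normalized, he]

theorem mul_normalized_holevo (h : μ.IsEnsemble) (he : 0 < μ.epsAv) :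
    ENNReal.ofReal μ.epsAv * (μ.normalized X σ).holevo = ∑' i, ENNReal.ofReal (μ.prob i) *
      (ENNReal.ofReal (μ.eps i) *
        relEntropy ((μ.normalized X σ).state i) (μ.normalized X σ).avg) := by
  rw [holevo, ← ENNReal.tsum_mul_left]
  refine tsum_congr fun i => ?_
  rw [← mul_assoc, ← mul_assoc, ← ENNReal.ofReal_mul he.le, ← ENNReal.ofReal_mul (h.1 i)]
  congr 2
  change μ.epsAv * (μ.prob i * μ.eps i / μ.epsAv) = _
  field_simp

theorem IsEnsemble.normalized_identity (h : μ.IsEnsemble) (he : 0 < μ.epsAv) (hσ : IsState σ)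
    (hX : ∀ i, (X i).IsPositive) (hXt : ∀ i, opTrace (X i) = ENNReal.ofReal (μ.eps i))
    {K : H →L[ℂ] H} (hK : K = mixture μ.prob X) (FK : Eigenbasis K) (i : I) :
    ENNReal.ofReal (μ.prob i) * (ENNReal.ofReal (μ.eps i) *
        relEntropy ((μ.normalized X σ).state i) (μ.normalized X σ).avg) +
      ENNReal.ofReal (μ.prob i) * vnEntropy (X i) + ENNReal.ofReal (μ.prob i) *
        (ENNReal.ofReal (μ.eps i) * ENNReal.ofReal (-Real.log μ.epsAv)) =
    ENNReal.ofReal (μ.prob i) * FK.crossEntropy (X i) +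
      ENNReal.ofReal (μ.prob i) * ENNReal.ofReal (Real.negMulLog (μ.eps i)) := by
  have hKp : K.IsPositive :=
    hK ▸ mixture_isPositive h.1 h.2.1.summable (h.isSubstate_of_opTrace hX hXt)
  have havg : (μ.normalized X σ).avg = ((μ.epsAv⁻¹ : ℝ) : ℂ) • K := by
    rw [h.normalized_avg hX hXt, hK]
  have hB := (h.normalized_isEnsemble he hσ hX hXt).avg_isState
  rw [havg] at hB ⊢
  rw [← mul_add, ← mul_add, ← mul_add, relEntropy_normalized (μ.eps_nonneg i) (h.eps_le_one i)
    (hX i) (hXt i) (fun h0 => normalized_state h0) hKp FK he h.epsAv_le_one hB]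

theorem vnEntropy_sum_lt_top {s : Finset I} {Y : I → (H →L[ℂ] H)} (hY : ∀ i, (Y i).IsPositive)
    (hs : IsSubstate (∑ i ∈ s, Y i)) (hf : ∀ i, vnEntropy (Y i) ≠ ⊤) :
    vnEntropy (∑ i ∈ s, Y i) < ⊤ := by
  classical
  induction s using Finset.induction_on with
  | empty => simp [vnEntropy_zero]
  | insert i s hi ih =>
    rw [Finset.sum_insert hi] at hs ⊢
    have hp := ContinuousLinearMap.isPositive_sum s fun i _ => hY i
    refine (vnEntropy_add_le (hY i) hp hs).trans_lt ?_
    exact ENNReal.add_lt_top.mpr ⟨(hf i).lt_top,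
      ih (hs.of_le hp (le_add_of_isPositive_left (hY i)))⟩

/-- A finite ensemble of states of finite entropy has finite Holevo quantity. -/
theorem IsEnsemble.holevo_lt_top [Finite I] (h : μ.IsEnsemble)
    (hf : ∀ i, μ.prob i ≠ 0 → vnEntropy (μ.state i) ≠ ⊤) : μ.holevo < ⊤ := by
  have := Fintype.ofFinite I
  have havg : μ.avg = ∑ i, (μ.prob i : ℂ) • μ.state i := tsum_fintype _
  refine h.holevo_le.trans_lt ?_
  have hs := h.avg_isState.isSubstate
  rw [havg] at hs ⊢
  refine vnEntropy_sum_lt_top (fun i => isPositive_smul (h.1 i) (h.2.2 i).1) hs fun i => ?_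
  have hp1 : μ.prob i ≤ 1 := le_hasSum h.2.1 i fun j _ => h.1 j
  rw [vnEntropy_smul (h.2.2 i).isSubstate (h.1 i) hp1, (h.2.2 i).2]
  refine ENNReal.add_ne_top.mpr ⟨?_, by finiteness⟩
  by_cases h0 : μ.prob i = 0
  · simp [h0]
  · exact ENNReal.mul_ne_top ENNReal.ofReal_ne_top (hf i h0)

/-! ### The mean binary entropy -/

theorem IsEnsemble.summable_binEntropy (h : μ.IsEnsemble) :
    Summable fun i => μ.prob i * Real.binEntropy (μ.eps i) :=
  Summable.of_nonneg_of_le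
    (fun i => mul_nonneg (h.1 i) (Real.binEntropy_nonneg (μ.eps_nonneg i) (h.eps_le_one i)))
    (fun i => mul_le_mul_of_nonneg_left Real.binEntropy_le_log_two (h.1 i))
    (h.2.1.summable.mul_right _)

theorem IsEnsemble.ofReal_meanBinEntropy (h : μ.IsEnsemble) :
    ENNReal.ofReal μ.meanBinEntropy =
      ∑' i, ENNReal.ofReal (μ.prob i) * ENNReal.ofReal (Real.binEntropy (μ.eps i)) := by
  rw [meanBinEntropy, ENNReal.ofReal_tsum_of_nonneg (fun i => mul_nonneg (h.1 i)
    (Real.binEntropy_nonneg (μ.eps_nonneg i) (h.eps_le_one i))) h.summable_binEntropy]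
  exact tsum_congr fun i => ENNReal.ofReal_mul (h.1 i)

theorem negMulLog_le {x y : ℝ} (hx : 0 ≤ x) (hy : 0 < y) :
    Real.negMulLog x ≤ -(x * Real.log y) + y - x := by
  rcases hx.eq_or_lt with rfl | hx
  · simpa using hy.le
  have := Real.log_le_sub_one_of_pos (div_pos hy hx)
  rw [Real.log_div hy.ne' hx.ne'] at this
  have h2 : x * (y / x - 1) = y - x := by field_simp
  rw [Real.negMulLog]
  nlinarith

/-- The tangent of the binary entropy at `y` lies above it. -/
theorem binEntropy_le {x y : ℝ} (hx0 : 0 ≤ x) (hx1 : x ≤ 1) (hy0 : 0 < y) (hy1 : y < 1) :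
    Real.binEntropy x ≤ x * -Real.log y + (1 - x) * -Real.log (1 - y) := by
  have h1 := negMulLog_le hx0 hy0
  have h2 := negMulLog_le (sub_nonneg.mpr hx1) (sub_pos.mpr hy1)
  rw [Real.binEntropy_eq_negMulLog_add_negMulLog_one_sub]
  linarith

theorem IsEnsemble.meanBinEntropy_le (h : μ.IsEnsemble) :
    μ.meanBinEntropy ≤ Real.binEntropy μ.epsAv := by
  have hsub := h.2.1.sub h.summable_eps.hasSum
  have hb := Real.binEntropy_nonneg h.epsAv_nonneg h.epsAv_le_one
  rcases h.epsAv_nonneg.eq_or_lt with he | he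
  · refine le_trans (le_of_eq ?_) hb
    have h0 := (hasSum_zero_iff_of_nonneg fun i => mul_nonneg (h.1 i) (μ.eps_nonneg i)).mp
      (show HasSum (fun i => μ.prob i * μ.eps i) 0 from he ▸ h.summable_eps.hasSum)
    rw [meanBinEntropy, ← tsum_zero (α := ℝ) (β := I)]
    refine tsum_congr fun i => ?_
    rcases mul_eq_zero.mp (congrFun h0 i) with h1 | h1 <;> simp [h1]
  rcases h.epsAv_le_one.eq_or_lt with he1 | he1
  · refine le_trans (le_of_eq ?_) hb
    have h2 : HasSum (fun i => μ.prob i - μ.prob i * μ.eps i) 0 := by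
      have : 1 - ∑' i, μ.prob i * μ.eps i = 0 := sub_eq_zero.mpr he1.symm
      rwa [this] at hsub
    have h0 := (hasSum_zero_iff_of_nonneg fun i => sub_nonneg.mpr
      (mul_le_of_le_one_right (h.1 i) (h.eps_le_one i))).mp h2
    rw [meanBinEntropy, ← tsum_zero (α := ℝ) (β := I)]
    refine tsum_congr fun i => ?_
    have h1 : μ.prob i * (1 - μ.eps i) = 0 := by
      have := congrFun h0 i
      simp only [Pi.zero_apply] at this
      linarith
    rcases mul_eq_zero.mp h1 with h1 | h1
    · simp [h1]
    · rw [← sub_eq_zero.mp h1]; simp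
  · have hs := (h.summable_eps.hasSum.mul_right (-Real.log μ.epsAv)).add
      (hsub.mul_right (-Real.log (1 - μ.epsAv)))
    have hval : (∑' i, μ.prob i * μ.eps i) * -Real.log μ.epsAv +
        (1 - ∑' i, μ.prob i * μ.eps i) * -Real.log (1 - μ.epsAv) = Real.binEntropy μ.epsAv := by
      rw [Real.binEntropy_eq_negMulLog_add_negMulLog_one_sub, Real.negMulLog, Real.negMulLog]
      change μ.epsAv * _ + (1 - μ.epsAv) * _ = _
      ring
    rw [hval] at hs
    refine hasSum_le (fun i => ?_) h.summable_binEntropy.hasSum hs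
    have := mul_le_mul_of_nonneg_left
      (binEntropy_le (μ.eps_nonneg i) (h.eps_le_one i) he he1) (h.1 i)
    linarith

end EnsembleData

end Normalized

/-! ### The inequality for the Holevo quantities -/

section Main

variable {H : Type*} [NormedAddCommGroup H] [InnerProductSpace ℂ H] [CompleteSpace H]
  {I : Type*}

namespace EnsembleData

variable {μ : EnsembleData I H} {σ : H →L[ℂ] H}

theorem IsEnsemble.posPart_isPositive (h : μ.IsEnsemble) (i : I) :
    (μ.state i - μ.avg)⁺.IsPositive := by
  obtain ⟨ε, -, -, -, hN, -⟩ := jordan_decomposition h.avg_isState (h.2.2 i)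
  exact hN

theorem IsEnsemble.negPart_isPositive (h : μ.IsEnsemble) (i : I) :
    (μ.state i - μ.avg)⁻.IsPositive := by
  obtain ⟨ε, -, -, -, -, hP, -⟩ := jordan_decomposition h.avg_isState (h.2.2 i)
  exact hP

theorem IsEnsemble.opTrace_posPart (h : μ.IsEnsemble) (i : I) :
    opTrace (μ.state i - μ.avg)⁺ = ENNReal.ofReal (μ.eps i) := by
  obtain ⟨ε, hε, -, -, -, -, -, hN, -⟩ := jordan_decomposition h.avg_isState (h.2.2 i)
  rw [eps, ← hε, hN]

theorem IsEnsemble.opTrace_negPart (h : μ.IsEnsemble) (i : I) :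
    opTrace (μ.state i - μ.avg)⁻ = ENNReal.ofReal (μ.eps i) := by
  obtain ⟨ε, hε, -, -, -, -, -, -, hP, -⟩ := jordan_decomposition h.avg_isState (h.2.2 i)
  rw [eps, ← hε, hP]

theorem IsEnsemble.avg_add_posPart (h : μ.IsEnsemble) (i : I) :
    μ.avg + (μ.state i - μ.avg)⁺ = μ.state i + (μ.state i - μ.avg)⁻ := by
  obtain ⟨ε, -, -, -, -, -, hs, -⟩ := jordan_decomposition h.avg_isState (h.2.2 i)
  exact hs

theorem IsEnsemble.posPart_isSubstate (h : μ.IsEnsemble) (i : I) :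
    IsSubstate (μ.state i - μ.avg)⁺ :=
  h.isSubstate_of_opTrace h.posPart_isPositive h.opTrace_posPart i

theorem IsEnsemble.negPart_isSubstate (h : μ.IsEnsemble) (i : I) :
    IsSubstate (μ.state i - μ.avg)⁻ :=
  h.isSubstate_of_opTrace h.negPart_isPositive h.opTrace_negPart i

/-- The positive and the negative parts have the same mixture, since the differences
`ρ i - avg μ` have mean zero. -/
theorem IsEnsemble.mixture_posPart (h : μ.IsEnsemble) :
    mixture μ.prob (fun i => (μ.state i - μ.avg)⁺) =
      mixture μ.prob (fun i => (μ.state i - μ.avg)⁻) := by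
  have hp := h.2.1.summable
  have h1 := (hasSum_mixture h.1 hp fun _ => h.avg_isState.isSubstate).add
    (hasSum_mixture h.1 hp h.posPart_isSubstate)
  have h2 := (hasSum_mixture h.1 hp fun i => (h.2.2 i).isSubstate).add
    (hasSum_mixture h.1 hp h.negPart_isSubstate)
  have h3 : mixture μ.prob (fun _ => μ.avg) = mixture μ.prob μ.state := by
    rw [mixture_const hp, h.2.1.tsum_eq, Complex.ofReal_one, one_smul, avg_eq_mixture]
  refine add_left_cancel (a := mixture μ.prob μ.state) ?_
  rw [h3] at h1
  refine h1.unique ?_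
  convert h2 using 1
  ext1 i
  rw [← smul_add, h.avg_add_posPart, smul_add]

theorem IsEnsemble.vnEntropy_avg_add_le (h : μ.IsEnsemble) (i : I) :
    vnEntropy μ.avg + vnEntropy (μ.state i - μ.avg)⁺ ≤ vnEntropy (μ.state i) +
      vnEntropy (μ.state i - μ.avg)⁻ + ENNReal.ofReal (Real.binEntropy (μ.eps i)) := by
  obtain ⟨ε, hε, h0, h1, hN, hP, hs, hNt, hPt, Q, hQ, hQN, hQA, -⟩ :=
    jordan_decomposition h.avg_isState (h.2.2 i)
  rw [eps, ← hε]
  exact vnEntropy_add_le_of_add_eq h0 h1 h.avg_isState (h.2.2 i) hN hNt hP hPt hs hQ hQN hQA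

theorem IsEnsemble.vnEntropy_negPart_lt_top (h : μ.IsEnsemble) (hS : vnEntropy μ.avg < ⊤) (i : I) :
    vnEntropy (μ.state i - μ.avg)⁻ < ⊤ := by
  obtain ⟨ε, -, -, -, -, hP, -, -, -, Q, hQ, -, -, hle⟩ :=
    jordan_decomposition h.avg_isState (h.2.2 i)
  exact vnEntropy_lt_top_of_le_conj hQ.one_sub h.avg_isState.isSubstate hS hP hle

theorem IsEnsemble.vnEntropy_state_lt_top (h : μ.IsEnsemble) (hS : vnEntropy μ.avg < ⊤) {i : I}
    (hi : μ.prob i ≠ 0) : vnEntropy (μ.state i) < ⊤ := by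
  have h1 : ENNReal.ofReal (μ.prob i) * vnEntropy (μ.state i) ≤ vnEntropy μ.avg := by
    rw [← h.holevo_add]
    exact (ENNReal.le_tsum i).trans le_add_self
  by_contra htop
  rw [not_lt, top_le_iff] at htop
  rw [htop, ENNReal.mul_top (by simpa using lt_of_le_of_ne (h.1 i) hi.symm)] at h1
  exact absurd (top_le_iff.mp h1) hS.ne

theorem IsEnsemble.vnEntropy_posPart_lt_top (h : μ.IsEnsemble) (hS : vnEntropy μ.avg < ⊤) {i : I}
    (hi : μ.prob i ≠ 0) : vnEntropy (μ.state i - μ.avg)⁺ < ⊤ := by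
  refine (le_add_self.trans (h.vnEntropy_avg_add_le i)).trans_lt ?_
  exact ENNReal.add_lt_top.mpr ⟨ENNReal.add_lt_top.mpr ⟨h.vnEntropy_state_lt_top hS hi,
    h.vnEntropy_negPart_lt_top hS i⟩, ENNReal.ofReal_lt_top⟩

theorem IsEnsemble.plus_isEnsemble (h : μ.IsEnsemble) (he : 0 < μ.epsAv) (hσ : IsState σ) :
    (μ.plus σ).IsEnsemble :=
  h.normalized_isEnsemble he hσ h.posPart_isPositive h.opTrace_posPart

theorem IsEnsemble.minus_isEnsemble (h : μ.IsEnsemble) (he : 0 < μ.epsAv) (hσ : IsState σ) :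
    (μ.minus σ).IsEnsemble :=
  h.normalized_isEnsemble he hσ h.negPart_isPositive h.opTrace_negPart

theorem plus_holevo_of_epsAv_eq_zero (he : μ.epsAv = 0) : (μ.plus σ).holevo = 0 :=
  normalized_holevo_of_epsAv_eq_zero he

theorem minus_holevo_of_epsAv_eq_zero (he : μ.epsAv = 0) : (μ.minus σ).holevo = 0 :=
  normalized_holevo_of_epsAv_eq_zero he

theorem IsEnsemble.holevo_eq_zero (h : μ.IsEnsemble) (hS : vnEntropy μ.avg < ⊤)
    (he : μ.epsAv = 0) : μ.holevo = 0 := by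
  have h0 := (hasSum_zero_iff_of_nonneg fun i => mul_nonneg (h.1 i) (μ.eps_nonneg i)).mp
    (show HasSum (fun i => μ.prob i * μ.eps i) 0 from he ▸ h.summable_eps.hasSum)
  rw [holevo, ENNReal.tsum_eq_zero]
  intro i
  rcases mul_eq_zero.mp (congrFun h0 i) with h1 | h1
  · simp [h1]
  have hN : (μ.state i - μ.avg)⁺ = 0 :=
    eq_zero_of_opTrace (h.posPart_isPositive i) (by rw [h.opTrace_posPart, h1]; simp)
  have hP : (μ.state i - μ.avg)⁻ = 0 :=
    eq_zero_of_opTrace (h.negPart_isPositive i) (by rw [h.opTrace_negPart, h1]; simp)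
  have hst := h.avg_add_posPart i
  rw [hN, hP, add_zero, add_zero] at hst
  have F := h.avg_isState.isSubstate.eigenbasis
  have h2 := relEntropy_add_vnEntropy h.avg_isState h.avg_isState F
  rw [F.crossEntropy_self h.avg_isState.isSubstate] at h2
  have h3 : relEntropy μ.avg μ.avg = 0 :=
    (ENNReal.add_left_inj hS.ne).mp (by rw [h2, zero_add])
  rw [← hst, h3, mul_zero]

theorem IsEnsemble.holevo_add_le (h : μ.IsEnsemble) (hS : vnEntropy μ.avg < ⊤) (hσ : IsState σ) :
    μ.holevo + ENNReal.ofReal μ.epsAv * (μ.minus σ).holevo ≤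
      ENNReal.ofReal μ.epsAv * (μ.plus σ).holevo + ENNReal.ofReal μ.meanBinEntropy := by
  rcases h.epsAv_nonneg.eq_or_lt with he | he
  · simp [h.holevo_eq_zero hS he.symm, ← he]
  have hK := mixture_isSubstate h.1 h.2.1.summable h.2.1.tsum_eq.le h.posPart_isSubstate
  have hfin : ∀ {S : I → ℝ≥0∞}, (∀ i, μ.prob i ≠ 0 → S i < ⊤) →
      ∀ i, ENNReal.ofReal (μ.prob i) * S i ≠ ⊤ := by
    intro S hS i
    by_cases hi : μ.prob i = 0
    · simp [hi]
    · exact ENNReal.mul_ne_top ENNReal.ofReal_ne_top (hS i hi).ne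
  have key := tsum_add_vnEntropy_le h.1 h.2.1 h.2.2 μ.avg_eq_mixture hS.ne h.posPart_isSubstate
    h.negPart_isSubstate h.avg_add_posPart h.mixture_posPart hK.eigenbasis
    (hfin fun i hi => h.vnEntropy_posPart_lt_top hS hi)
    (hfin fun i _ => h.vnEntropy_negPart_lt_top hS i) h.vnEntropy_avg_add_le
    (fun i => by finiteness)
    (h.normalized_identity he hσ h.posPart_isPositive h.opTrace_posPart rfl hK.eigenbasis)
    (h.normalized_identity he hσ h.negPart_isPositive h.opTrace_negPart h.mixture_posPart
      hK.eigenbasis)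
  rw [← mul_normalized_holevo h he, ← mul_normalized_holevo h he, ← plus_eq_normalized,
    ← minus_eq_normalized, ← h.ofReal_meanBinEntropy, ← h.holevo_add] at key
  have hf : ∑' i, ENNReal.ofReal (μ.prob i) * vnEntropy (μ.state i) ≠ ⊤ := by
    refine ne_top_of_le_ne_top hS.ne ?_
    rw [← h.holevo_add]
    exact le_add_self
  rw [← ENNReal.add_le_add_iff_right hf]
  refine le_trans (le_of_eq ?_) (key.trans (le_of_eq ?_)) <;> ring

theorem IsEnsemble.plus_holevo_lt_top [Finite I] (h : μ.IsEnsemble) (hS : vnEntropy μ.avg < ⊤)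
    (hσ : IsState σ) : (μ.plus σ).holevo < ⊤ := by
  rcases h.epsAv_nonneg.eq_or_lt with he | he
  · rw [plus_holevo_of_epsAv_eq_zero he.symm]
    exact ENNReal.zero_lt_top
  have hE := h.plus_isEnsemble he hσ
  refine hE.holevo_lt_top fun i hi => ?_
  have hi' : μ.prob i * μ.eps i ≠ 0 := fun h0 => hi (by simp [plus, h0])
  have hε : μ.eps i ≠ 0 := right_ne_zero_of_mul hi'
  have h1 := h.vnEntropy_posPart_lt_top hS (left_ne_zero_of_mul hi')
  have hst : (μ.state i - μ.avg)⁺ = (μ.eps i : ℂ) • (μ.plus σ).state i := by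
    rw [plus_eq_normalized, normalized_state hε, smul_smul, ← Complex.ofReal_mul,
      mul_inv_cancel₀ hε, Complex.ofReal_one, one_smul]
  rw [hst, vnEntropy_smul (hE.2.2 i).isSubstate (μ.eps_nonneg i) (h.eps_le_one i)] at h1
  intro htop
  rw [htop, ENNReal.mul_top (by simpa using lt_of_le_of_ne (μ.eps_nonneg i) hε.symm)] at h1
  simp at h1

/-- Passage from an inequality in `[0, ∞]` to one in `ℝ`. -/
theorem IsEnsemble.toReal_le_of_add_le (h : μ.IsEnsemble) (hχ : μ.holevo < ⊤) {b : ℝ} (hb : 0 ≤ b)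
    (hle : μ.holevo + ENNReal.ofReal μ.epsAv * (μ.minus σ).holevo ≤
      ENNReal.ofReal μ.epsAv * (μ.plus σ).holevo + ENNReal.ofReal b)
    (hplus : (μ.plus σ).holevo < ⊤) : (μ.minus σ).holevo < ⊤ ∧ μ.holevo.toReal ≤
      μ.epsAv * ((μ.plus σ).holevo.toReal - (μ.minus σ).holevo.toReal) + b := by
  have hr : ENNReal.ofReal μ.epsAv * (μ.plus σ).holevo + ENNReal.ofReal b ≠ ⊤ := by
    have := hplus.ne
    finiteness
  have hminus : (μ.minus σ).holevo < ⊤ := by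
    rcases h.epsAv_nonneg.eq_or_lt with he | he
    · rw [minus_holevo_of_epsAv_eq_zero he.symm]
      exact ENNReal.zero_lt_top
    · by_contra htop
      rw [not_lt, top_le_iff] at htop
      rw [htop, ENNReal.mul_top (by simpa using he), add_top] at hle
      exact hr (top_le_iff.mp hle)
  refine ⟨hminus, ?_⟩
  have h2 := ENNReal.toReal_mono hr hle
  rw [ENNReal.toReal_add hχ.ne (ENNReal.mul_ne_top ENNReal.ofReal_ne_top hminus.ne),
    ENNReal.toReal_add (ENNReal.mul_ne_top ENNReal.ofReal_ne_top hplus.ne) ENNReal.ofReal_ne_top,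
    ENNReal.toReal_mul, ENNReal.toReal_mul, ENNReal.toReal_ofReal h.epsAv_nonneg,
    ENNReal.toReal_ofReal hb] at h2
  linarith

theorem IsEnsemble.meanBinEntropy_nonneg (h : μ.IsEnsemble) : 0 ≤ μ.meanBinEntropy :=
  tsum_nonneg fun i => mul_nonneg (h.1 i)
    (Real.binEntropy_nonneg (μ.eps_nonneg i) (h.eps_le_one i))

end EnsembleData

end Main

/-! ### Uniform ensembles of orthogonal pure states -/

section Tightness

variable {H : Type*} [NormedAddCommGroup H] [InnerProductSpace ℂ H] [CompleteSpace H]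

/-- A normalised projection of rank `n` has entropy `log n`: its eigenvalues are `0` and
`1 / n`. -/
theorem vnEntropy_smul_isIdempotentElem {Q : H →L[ℂ] H} (hQ : IsIdempotentElem Q) {n : ℕ}
    (h : IsState (((n : ℝ)⁻¹ : ℂ) • Q)) :
    vnEntropy (((n : ℝ)⁻¹ : ℂ) • Q) = ENNReal.ofReal (Real.log n) := by
  have E := h.isSubstate.eigenbasis
  have hterm : ∀ i, ENNReal.ofReal (Real.negMulLog (E.eigenvalue i)) =
      ENNReal.ofReal (E.eigenvalue i) * ENNReal.ofReal (Real.log n) := by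
    intro i
    have h0 := E.eigenvalue_nonneg h.1 i
    rw [← ENNReal.ofReal_mul h0]
    congr 1
    have hsq : (((n : ℝ)⁻¹ : ℂ) • Q) * (((n : ℝ)⁻¹ : ℂ) • Q) =
        ((n : ℝ)⁻¹ : ℂ) • (((n : ℝ)⁻¹ : ℂ) • Q) := by
      rw [smul_mul_smul_comm, hQ.eq, smul_smul]
    have h1 := congrArg (fun T : H →L[ℂ] H => T (E.basis i)) hsq
    simp only [mul_apply_eq_comp] at h1
    rw [show ((((n : ℝ)⁻¹ : ℂ) • (((n : ℝ)⁻¹ : ℂ) • Q) : H →L[ℂ] H)) (E.basis i) =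
        ((n : ℝ)⁻¹ : ℂ) • ((((n : ℝ)⁻¹ : ℂ) • Q : H →L[ℂ] H)) (E.basis i) from rfl,
      E.apply_basis, map_smul, E.apply_basis, smul_smul, smul_smul] at h1
    have hne : E.basis i ≠ 0 := by
      rw [← norm_ne_zero_iff, E.norm_basis]
      exact one_ne_zero
    have h2 := smul_left_injective ℂ hne h1
    have h3 : E.eigenvalue i * E.eigenvalue i = (n : ℝ)⁻¹ * E.eigenvalue i := by
      exact_mod_cast h2
    rcases eq_or_ne (E.eigenvalue i) 0 with hx | hx
    · simp [hx]
    · rw [Real.negMulLog, mul_right_cancel₀ hx h3, Real.log_inv]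
      ring
  rw [h.isSubstate.vnEntropy_eq E, tsum_congr hterm, ENNReal.tsum_mul_right, ← E.opTrace_eq h.1,
    h.2, one_mul]

theorem opTrace_rankOne {v : H} (hv : ‖v‖ = 1) :
    opTrace (InnerProductSpace.rankOne ℂ v v) = 1 := by
  obtain ⟨w, b, -⟩ := exists_hilbertBasis ℂ H
  have h := b.tsum_ofReal_norm_inner_sq v
  rw [hv, one_pow, ENNReal.ofReal_one] at h
  rw [opTrace_eq_tsum (InnerProductSpace.isPositive_rankOne_self v) b, ← h]
  refine tsum_congr fun i => ?_
  rw [quadForm, InnerProductSpace.rankOne_apply, inner_smul_right]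
  have h2 := inner_mul_symm_re_eq_norm (𝕜 := ℂ) v (b i)
  rw [norm_mul, norm_inner_symm v, ← sq] at h2
  exact congrArg ENNReal.ofReal h2

section Orthonormal

variable {m : ℕ} {e : Fin m → H}

/-- The projection onto the span of the vectors `e k`, `k ∈ s`, of an orthonormal family. -/
noncomputable def spanProjection (e : Fin m → H) (s : Finset (Fin m)) : H →L[ℂ] H :=
  ∑ k ∈ s, InnerProductSpace.rankOne ℂ (e k) (e k)

theorem spanProjection_isPositive (e : Fin m → H) (s : Finset (Fin m)) :
    (spanProjection e s).IsPositive :=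
  ContinuousLinearMap.isPositive_sum s fun _ _ => InnerProductSpace.isPositive_rankOne_self _

theorem spanProjection_singleton (e : Fin m → H) (k : Fin m) :
    spanProjection e {k} = InnerProductSpace.rankOne ℂ (e k) (e k) :=
  Finset.sum_singleton _ _

theorem rankOne_mul_rankOne (he : Orthonormal ℂ e) (k l : Fin m) :
    (InnerProductSpace.rankOne ℂ (e k) (e k) * InnerProductSpace.rankOne ℂ (e l) (e l) :
      H →L[ℂ] H) = if k = l then InnerProductSpace.rankOne ℂ (e k) (e k) else 0 := by
  ext v
  rw [mul_apply_eq_comp, InnerProductSpace.rankOne_apply, InnerProductSpace.rankOne_apply,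
    inner_smul_right, orthonormal_iff_ite.mp he]
  split_ifs with h
  · subst h; simp
  · simp

theorem spanProjection_mul (he : Orthonormal ℂ e) (s t : Finset (Fin m)) :
    spanProjection e s * spanProjection e t = spanProjection e (s ∩ t) := by
  simp only [spanProjection, Finset.sum_mul_sum, rankOne_mul_rankOne he, Finset.sum_ite_eq,
    Finset.sum_ite_mem]

theorem opTrace_spanProjection (he : Orthonormal ℂ e) (s : Finset (Fin m)) :
    opTrace (spanProjection e s) = s.card := by
  induction s using Finset.induction_on with
  | empty => simp [spanProjection, opTrace_zero]
  | insert k s hk ih =>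
    rw [spanProjection, Finset.sum_insert hk, ← spanProjection,
      opTrace_add (InnerProductSpace.isPositive_rankOne_self _) (spanProjection_isPositive e s),
      opTrace_rankOne (he.1 k), ih, Finset.card_insert_of_notMem hk]
    push_cast
    ring

theorem isState_spanProjection (he : Orthonormal ℂ e) {s : Finset (Fin m)} {n : ℕ} (hn : n ≠ 0)
    (hs : s.card = n) : IsState (((n : ℝ)⁻¹ : ℂ) • spanProjection e s) := by
  rw [← Complex.ofReal_inv]
  have h0 : (0 : ℝ) ≤ (n : ℝ)⁻¹ := by positivity
  refine ⟨isPositive_smul h0 (spanProjection_isPositive e s), ?_⟩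
  rw [opTrace_smul h0 (spanProjection_isPositive e s), opTrace_spanProjection he, hs,
    ← ENNReal.ofReal_natCast n, ← ENNReal.ofReal_mul h0, inv_mul_cancel₀ (by exact_mod_cast hn),
    ENNReal.ofReal_one]

theorem vnEntropy_spanProjection (he : Orthonormal ℂ e) {s : Finset (Fin m)} {n : ℕ} (hn : n ≠ 0)
    (hs : s.card = n) :
    vnEntropy (((n : ℝ)⁻¹ : ℂ) • spanProjection e s) = ENNReal.ofReal (Real.log n) :=
  vnEntropy_smul_isIdempotentElem
    (by rw [IsIdempotentElem, spanProjection_mul he, Finset.inter_self])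
    (isState_spanProjection he hn hs)

theorem vnEntropy_rankOne (he : Orthonormal ℂ e) (k : Fin m) :
    vnEntropy (InnerProductSpace.rankOne ℂ (e k) (e k)) = 0 := by
  have h := vnEntropy_spanProjection he one_ne_zero (Finset.card_singleton k)
  simpa [spanProjection_singleton] using h

theorem EnsembleData.IsEnsemble.holevo_add_of_vnEntropy_eq {I : Type*} {μ : EnsembleData I H}
    (h : μ.IsEnsemble) {S : ℝ≥0∞} (hS : ∀ i, vnEntropy (μ.state i) = S) :
    μ.holevo + S = vnEntropy μ.avg := by
  rw [← h.holevo_add]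
  simp_rw [hS]
  rw [ENNReal.tsum_mul_right, ← ENNReal.ofReal_tsum_of_nonneg h.1 h.2.1.summable, h.2.1.tsum_eq,
    ENNReal.ofReal_one, one_mul]

theorem uniformPureEnsemble_isEnsemble (hm : m ≠ 0) (he : Orthonormal ℂ e) :
    (uniformPureEnsemble e).IsEnsemble := by
  refine ⟨fun _ => by simp [uniformPureEnsemble], ?_, fun k =>
    ⟨InnerProductSpace.isPositive_rankOne_self _, opTrace_rankOne (he.1 k)⟩⟩
  have h : ∑ k, (uniformPureEnsemble e).prob k = 1 := by
    simp [uniformPureEnsemble, hm]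
  exact h ▸ hasSum_fintype _

theorem uniformPureEnsemble_avg (e : Fin m → H) :
    (uniformPureEnsemble e).avg = ((m : ℝ)⁻¹ : ℂ) • spanProjection e Finset.univ := by
  rw [EnsembleData.avg, tsum_fintype, spanProjection, Finset.smul_sum]
  simp [uniformPureEnsemble]

theorem vnEntropy_uniformPureEnsemble_avg (hm : m ≠ 0) (he : Orthonormal ℂ e) :
    vnEntropy (uniformPureEnsemble e).avg = ENNReal.ofReal (Real.log m) := by
  rw [uniformPureEnsemble_avg, vnEntropy_spanProjection he hm (by simp)]

/-- The Jordan decomposition of `|e k⟩⟨e k| - m⁻¹ ∑ l, |e l⟩⟨e l|`. -/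
theorem uniformPureEnsemble_posPart_negPart (hm : m ≠ 0) (he : Orthonormal ℂ e) (k : Fin m) :
    ((uniformPureEnsemble e).state k - (uniformPureEnsemble e).avg)⁺ =
        ((1 - (m : ℝ)⁻¹ : ℝ) : ℂ) • InnerProductSpace.rankOne ℂ (e k) (e k) ∧
      ((uniformPureEnsemble e).state k - (uniformPureEnsemble e).avg)⁻ =
        (((m : ℝ)⁻¹ : ℝ) : ℂ) • spanProjection e (Finset.univ.erase k) := by
  have h1 : (0 : ℝ) ≤ 1 - (m : ℝ)⁻¹ :=
    sub_nonneg.mpr (inv_le_one_of_one_le₀ (by exact_mod_cast Nat.one_le_iff_ne_zero.mpr hm))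
  refine CFC.posPart_negPart_unique
    (a := (uniformPureEnsemble e).state k - (uniformPureEnsemble e).avg)
    (b := ((1 - (m : ℝ)⁻¹ : ℝ) : ℂ) • InnerProductSpace.rankOne ℂ (e k) (e k))
    (c := (((m : ℝ)⁻¹ : ℝ) : ℂ) • spanProjection e (Finset.univ.erase k)) ?_ ?_ ?_ ?_
  · rw [uniformPureEnsemble_avg, spanProjection, ← Finset.add_sum_erase _ _ (Finset.mem_univ k),
      ← spanProjection]
    change InnerProductSpace.rankOne ℂ (e k) (e k) - _ = _
    push_cast
    module
  · rw [← spanProjection_singleton, smul_mul_smul_comm, spanProjection_mul he,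
      Finset.singleton_inter_of_notMem (Finset.notMem_erase k _), spanProjection,
      Finset.sum_empty, smul_zero]
  · rw [ContinuousLinearMap.nonneg_iff_isPositive]
    exact isPositive_smul h1 (InnerProductSpace.isPositive_rankOne_self _)
  · rw [ContinuousLinearMap.nonneg_iff_isPositive]
    exact isPositive_smul (by positivity) (spanProjection_isPositive _ _)

theorem uniformPureEnsemble_eps (hm : m ≠ 0) (he : Orthonormal ℂ e) (k : Fin m) :
    (uniformPureEnsemble e).eps k = 1 - (m : ℝ)⁻¹ := by
  have h1 : (0 : ℝ) ≤ 1 - (m : ℝ)⁻¹ :=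
    sub_nonneg.mpr (inv_le_one_of_one_le₀ (by exact_mod_cast Nat.one_le_iff_ne_zero.mpr hm))
  have h := (uniformPureEnsemble_isEnsemble hm he).opTrace_posPart k
  rw [(uniformPureEnsemble_posPart_negPart hm he k).1,
    opTrace_smul h1 (InnerProductSpace.isPositive_rankOne_self _), opTrace_rankOne (he.1 k),
    mul_one] at h
  exact ((ENNReal.ofReal_eq_ofReal_iff h1 (EnsembleData.eps_nonneg _ k)).mp h).symm

theorem uniformPureEnsemble_epsAv (hm : m ≠ 0) (he : Orthonormal ℂ e) :
    (uniformPureEnsemble e).epsAv = 1 - (m : ℝ)⁻¹ := by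
  simp_rw [EnsembleData.epsAv, uniformPureEnsemble_eps hm he]
  rw [tsum_mul_right, (uniformPureEnsemble_isEnsemble hm he).2.1.tsum_eq, one_mul]

theorem uniformPureEnsemble_meanBinEntropy (hm : m ≠ 0) (he : Orthonormal ℂ e) :
    (uniformPureEnsemble e).meanBinEntropy = Real.binEntropy (1 - (m : ℝ)⁻¹) := by
  simp_rw [EnsembleData.meanBinEntropy, uniformPureEnsemble_eps hm he]
  rw [tsum_mul_right, (uniformPureEnsemble_isEnsemble hm he).2.1.tsum_eq, one_mul]

theorem uniformPureEnsemble_holevo (hm : m ≠ 0) (he : Orthonormal ℂ e) :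
    (uniformPureEnsemble e).holevo = ENNReal.ofReal (Real.log m) := by
  rw [← vnEntropy_uniformPureEnsemble_avg hm he,
    ← (uniformPureEnsemble_isEnsemble hm he).holevo_add_of_vnEntropy_eq (vnEntropy_rankOne he),
    add_zero]

theorem uniformPureEnsemble_plus_avg (hm : 2 ≤ m) (he : Orthonormal ℂ e) (σ : H →L[ℂ] H) :
    ((uniformPureEnsemble e).plus σ).avg = (uniformPureEnsemble e).avg := by
  have hm0 : m ≠ 0 := by omega
  have hm1 : (1 - (m : ℝ)⁻¹) ≠ 0 :=
    (sub_pos.mpr (inv_lt_one_of_one_lt₀ (by exact_mod_cast hm))).ne'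
  have h := uniformPureEnsemble_isEnsemble hm0 he
  rw [EnsembleData.plus_eq_normalized, h.normalized_avg h.posPart_isPositive h.opTrace_posPart,
    uniformPureEnsemble_epsAv hm0 he, mixture, tsum_fintype, Finset.smul_sum]
  conv_rhs => rw [EnsembleData.avg, tsum_fintype]
  refine Finset.sum_congr rfl fun k _ => ?_
  rw [(uniformPureEnsemble_posPart_negPart hm0 he k).1, smul_smul, smul_smul,
    ← Complex.ofReal_mul, ← Complex.ofReal_mul, mul_comm (1 - (m : ℝ)⁻¹)⁻¹, mul_assoc,
    inv_mul_cancel₀ hm1, mul_one]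
  rfl

theorem uniformPureEnsemble_minus_avg (hm : 2 ≤ m) (he : Orthonormal ℂ e) (σ : H →L[ℂ] H) :
    ((uniformPureEnsemble e).minus σ).avg = (uniformPureEnsemble e).avg := by
  have h := uniformPureEnsemble_isEnsemble (by omega) he
  rw [← uniformPureEnsemble_plus_avg hm he σ, EnsembleData.plus_eq_normalized,
    EnsembleData.minus_eq_normalized, h.normalized_avg h.posPart_isPositive h.opTrace_posPart,
    h.normalized_avg h.negPart_isPositive h.opTrace_negPart, h.mixture_posPart]

theorem uniformPureEnsemble_plus_state (hm : 2 ≤ m) (he : Orthonormal ℂ e) (σ : H →L[ℂ] H)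
    (k : Fin m) :
    ((uniformPureEnsemble e).plus σ).state k = InnerProductSpace.rankOne ℂ (e k) (e k) := by
  have hm0 : m ≠ 0 := by omega
  have hm1 : (1 - (m : ℝ)⁻¹) ≠ 0 :=
    (sub_pos.mpr (inv_lt_one_of_one_lt₀ (by exact_mod_cast hm))).ne'
  have hε := uniformPureEnsemble_eps hm0 he k
  rw [EnsembleData.plus_eq_normalized, EnsembleData.normalized_state (hε ▸ hm1), hε,
    (uniformPureEnsemble_posPart_negPart hm0 he k).1, smul_smul, ← Complex.ofReal_mul,
    inv_mul_cancel₀ hm1, Complex.ofReal_one, one_smul]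

theorem uniformPureEnsemble_minus_state (hm : 2 ≤ m) (he : Orthonormal ℂ e) (σ : H →L[ℂ] H)
    (k : Fin m) : ((uniformPureEnsemble e).minus σ).state k =
      ((((m - 1 : ℕ) : ℝ)⁻¹ : ℂ)) • spanProjection e (Finset.univ.erase k) := by
  have hm0 : m ≠ 0 := by omega
  have hm2 : (1 : ℝ) < m := by exact_mod_cast hm
  have hm1 : (1 - (m : ℝ)⁻¹) ≠ 0 := (sub_pos.mpr (inv_lt_one_of_one_lt₀ hm2)).ne'
  have hε := uniformPureEnsemble_eps hm0 he k
  rw [EnsembleData.minus_eq_normalized, EnsembleData.normalized_state (hε ▸ hm1), hε,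
    (uniformPureEnsemble_posPart_negPart hm0 he k).2, smul_smul, ← Complex.ofReal_mul,
    ← Complex.ofReal_inv, Nat.cast_sub (by omega)]
  congr 2
  have h3 : (m : ℝ) - 1 ≠ 0 := by linarith
  field_simp
  rw [Nat.cast_one, div_self h3]

/-- The uniform ensemble attains equality. If `m ≥ 2`, then `χ(μ) = χ(μ₊) = log m` and
`χ(μ₋) = log m - log (m - 1)`; if `m = 1`, then all the terms vanish. -/
theorem uniformPureEnsemble_holevo_eq (hm : m ≠ 0) (he : Orthonormal ℂ e) {σ : H →L[ℂ] H}
    (hσ : IsState σ) :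
    ((uniformPureEnsemble e).plus σ).holevo < ⊤ ∧ ((uniformPureEnsemble e).minus σ).holevo < ⊤ ∧
      (uniformPureEnsemble e).holevo.toReal =
        (uniformPureEnsemble e).epsAv *
          (((uniformPureEnsemble e).plus σ).holevo.toReal -
            ((uniformPureEnsemble e).minus σ).holevo.toReal) +
          (uniformPureEnsemble e).meanBinEntropy := by
  have h := uniformPureEnsemble_isEnsemble hm he
  have hε := uniformPureEnsemble_epsAv hm he
  have h1m : (1 : ℝ) ≤ m := by exact_mod_cast Nat.one_le_iff_ne_zero.mpr hm
  rw [uniformPureEnsemble_meanBinEntropy hm he, uniformPureEnsemble_holevo hm he,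
    ENNReal.toReal_ofReal (Real.log_nonneg h1m)]
  rcases (Nat.one_le_iff_ne_zero.mpr hm).eq_or_lt with rfl | hm2
  · have h0 : (uniformPureEnsemble e).epsAv = 0 := by simp [hε]
    rw [EnsembleData.plus_holevo_of_epsAv_eq_zero h0, EnsembleData.minus_holevo_of_epsAv_eq_zero h0]
    simp
  have hm3 : (1 : ℝ) < m := by exact_mod_cast hm2
  have hpos : 0 < (uniformPureEnsemble e).epsAv := by
    rw [hε]
    exact sub_pos.mpr (inv_lt_one_of_one_lt₀ hm3)
  have hp := (h.plus_isEnsemble hpos hσ).holevo_add_of_vnEntropy_eq (S := 0) fun k => by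
    rw [uniformPureEnsemble_plus_state hm2 he, vnEntropy_rankOne he]
  have hn := (h.minus_isEnsemble hpos hσ).holevo_add_of_vnEntropy_eq
    (S := ENNReal.ofReal (Real.log ((m - 1 : ℕ) : ℝ))) fun k => by
      rw [uniformPureEnsemble_minus_state hm2 he, vnEntropy_spanProjection he (by omega) (by simp)]
  rw [uniformPureEnsemble_plus_avg hm2 he, vnEntropy_uniformPureEnsemble_avg hm he, add_zero] at hp
  rw [uniformPureEnsemble_minus_avg hm2 he, vnEntropy_uniformPureEnsemble_avg hm he] at hn
  have hnt : ((uniformPureEnsemble e).minus σ).holevo ≠ ⊤ :=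
    ne_top_of_le_ne_top ENNReal.ofReal_ne_top (hn ▸ le_self_add)
  have hcast : (((m - 1 : ℕ) : ℕ) : ℝ) = m - 1 := by rw [Nat.cast_sub hm2.le, Nat.cast_one]
  have hlog : 0 ≤ Real.log ((m : ℝ) - 1) := by
    rw [← hcast]
    exact Real.log_natCast_nonneg _
  have hn' := congrArg ENNReal.toReal hn
  rw [hcast, ENNReal.toReal_add hnt ENNReal.ofReal_ne_top, ENNReal.toReal_ofReal hlog,
    ENNReal.toReal_ofReal (Real.log_nonneg h1m)] at hn'
  refine ⟨hp ▸ ENNReal.ofReal_lt_top, hnt.lt_top, ?_⟩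
  rw [hp, ENNReal.toReal_ofReal (Real.log_nonneg h1m), hε, eq_sub_of_add_eq hn',
    Real.binEntropy_eq_negMulLog_add_negMulLog_one_sub, Real.negMulLog, Real.negMulLog]
  simp only [sub_sub_cancel, Real.log_inv]
  have h4 : 1 - (m : ℝ)⁻¹ = (m - 1) / m := by field_simp
  have h5 : Real.log (1 - (m : ℝ)⁻¹) = Real.log (m - 1) - Real.log m := by
    rw [h4, Real.log_div (by linarith) (by linarith)]
  rw [h5]
  ring

end Orthonormal

end Tightness

theorem theorem1 :
    -- the inequality
    (∀ (H : Type*) [NormedAddCommGroup H] [InnerProductSpace ℂ H] [CompleteSpace H]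
      [TopologicalSpace.SeparableSpace H] (I : Type*) [Countable I]
      (μ : EnsembleData I H) (_ : μ.IsEnsemble) (_ : vnEntropy μ.avg < ⊤)
      (σ : H →L[ℂ] H) (_ : IsState σ),
      (0 < μ.epsAv → (μ.plus σ).IsEnsemble ∧ (μ.minus σ).IsEnsemble) ∧
      μ.holevo < ⊤ ∧
      -- the two bounds in `[0, ∞]`, with the negative term moved to the left
      μ.holevo + ENNReal.ofReal μ.epsAv * (μ.minus σ).holevo ≤
        ENNReal.ofReal μ.epsAv * (μ.plus σ).holevo + ENNReal.ofReal μ.meanBinEntropy ∧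
      μ.holevo + ENNReal.ofReal μ.epsAv * (μ.minus σ).holevo ≤
        ENNReal.ofReal μ.epsAv * (μ.plus σ).holevo +
          ENNReal.ofReal (Real.binEntropy μ.epsAv) ∧
      -- the two bounds as inequalities of real numbers
      ((μ.plus σ).holevo < ⊤ →
        (μ.minus σ).holevo < ⊤ ∧
        μ.holevo.toReal ≤
          μ.epsAv * ((μ.plus σ).holevo.toReal - (μ.minus σ).holevo.toReal) +
            μ.meanBinEntropy ∧
        μ.holevo.toReal ≤
          μ.epsAv * ((μ.plus σ).holevo.toReal - (μ.minus σ).holevo.toReal) +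
            Real.binEntropy μ.epsAv) ∧
      -- finite ensembles
      (Finite I → (μ.plus σ).holevo < ⊤)) ∧
    -- tightness
    (∀ (m : ℕ) (_ : 1 ≤ m) (H : Type*) [NormedAddCommGroup H] [InnerProductSpace ℂ H]
      [CompleteSpace H] [TopologicalSpace.SeparableSpace H]
      (_ : (m : Cardinal) ≤ Module.rank ℂ H),
      ∃ e : Fin m → H, Orthonormal ℂ e ∧
        (uniformPureEnsemble e).IsEnsemble ∧
        vnEntropy (uniformPureEnsemble e).avg < ⊤ ∧
        ∀ (σ : H →L[ℂ] H) (_ : IsState σ),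
          (uniformPureEnsemble e).holevo < ⊤ ∧
          ((uniformPureEnsemble e).plus σ).holevo < ⊤ ∧
          ((uniformPureEnsemble e).minus σ).holevo < ⊤ ∧
          (uniformPureEnsemble e).holevo.toReal =
            (uniformPureEnsemble e).epsAv *
              (((uniformPureEnsemble e).plus σ).holevo.toReal -
                ((uniformPureEnsemble e).minus σ).holevo.toReal) +
              (uniformPureEnsemble e).meanBinEntropy) := by
  refine ⟨fun H _ _ _ _ I _ μ h hS σ hσ => ?_, fun m hm H _ _ _ _ hrank => ?_⟩
  · have hχ := h.holevo_le.trans_lt hS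
    have hle := h.holevo_add_le hS hσ
    have hle' : μ.holevo + ENNReal.ofReal μ.epsAv * (μ.minus σ).holevo ≤
        ENNReal.ofReal μ.epsAv * (μ.plus σ).holevo +
          ENNReal.ofReal (Real.binEntropy μ.epsAv) :=
      hle.trans (add_le_add_right (ENNReal.ofReal_le_ofReal h.meanBinEntropy_le) _)
    refine ⟨fun he => ⟨h.plus_isEnsemble he hσ, h.minus_isEnsemble he hσ⟩, hχ, hle, hle',
      fun hp => ?_, fun _ => h.plus_holevo_lt_top hS hσ⟩
    obtain ⟨h1, h2⟩ := h.toReal_le_of_add_le hχ h.meanBinEntropy_nonneg hle hp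
    exact ⟨h1, h2, (h.toReal_le_of_add_le hχ
      (Real.binEntropy_nonneg h.epsAv_nonneg h.epsAv_le_one) hle' hp).2⟩
  · have hm0 : m ≠ 0 := Nat.one_le_iff_ne_zero.mp hm
    obtain ⟨f, hf⟩ := exists_linearIndependent_of_le_rank hrank
    have he := InnerProductSpace.gramSchmidtNormed_orthonormal hf
    have hS : vnEntropy (uniformPureEnsemble (InnerProductSpace.gramSchmidtNormed ℂ f)).avg < ⊤ :=
      vnEntropy_uniformPureEnsemble_avg hm0 he ▸ ENNReal.ofReal_lt_top
    have hE := uniformPureEnsemble_isEnsemble hm0 he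
    exact ⟨_, he, hE, hS, fun σ hσ =>
      ⟨hE.holevo_le.trans_lt hS, uniformPureEnsemble_holevo_eq hm0 he hσ⟩⟩
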